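/- Let $n\ge 1$, let $M$ be a compact connected oriented smooth manifold of dimension $n-1$ without boundary, let $\bar g=\langle\cdot,\cdot\rangle$ be the Euclidean metric on $\mathbb R^n$, and let $\Phi:\mathbb R\to\mathbb R_{>0}$ be smooth. For a smooth immersion $f:M\to\mathbb R^n$ write $g=f^*\bar g$, $\nabla$ for the Levi-Civita derivative of $g$, $\nabla^*=-\mathrm{Tr}^g\nabla$, $\nu=\nu^f$ for the positively oriented unit normal field, $L$ for the Weingarten map, $\bar g(\nabla_X\nu,Tf.Y)=-g(LX,Y)$, $C(L)$ for the classical adjoint of $L$ (so $C(L)L=L\,C(L)=\det(L)I$), $g^0_2$ for the product metric on $(0,2)$-tensors, and decompose $h\in C^\infty(M,\mathbb R^n)$ as $h=h^\perp\nu+Tf.h^\top$ with $h^\perp=\bar g(h,\nu)$. In the formulas $\Phi,\Phi'$ stand for $\Phi(\det L),\Phi'(\det L)$. On the space $\mathrm{Imm}(M,\mathbb R^n)$ of smooth immersions consider the metric $$G^\Phi_f(h,k)=\int_M\Phi(\det L)\,\bar g(h,k)\,\mathrm{vol}(g),\qquad h,k\in C^\infty(M,\mathbb R^n).$$ 1.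 The metric gradients, characterized by $D_{(f,m)}G^\Phi(h,k)=G^\Phi_f(K_f(m,h),k)=G^\Phi_f(m,H_f(h,k))$ for all $f\in\mathrm{Imm}(M,\mathbb R^n)$ and $m,h,k\in C^\infty(M,\mathbb R^n)$ (where $D_{(f,m)}$ is the derivative at $t=0$ along any smooth curve of immersions starting at $f$ with velocity $m$), exist in $C^\infty(M,\mathbb R^n)$, are unique, and are given by $$K_f(m,h)=\Big[\tfrac{\Phi'}{\Phi}\Big(\mathrm{Tr}(L)\det(L)\,m^\perp+g^0_2\big(g.C(L),\nabla^2(m^\perp)\big)+d\det(L)(m^\top)\Big)+\mathrm{div}^g(m^\top)-\mathrm{Tr}(L)\,m^\perp\Big]h,$$ $$H_f(h,k)=\Big[\tfrac{\Phi'}{\Phi}\mathrm{Tr}(L)\det(L)\,\bar g(h,k)+\tfrac1\Phi\nabla^*\nabla^*\big(\Phi'.g.C(L)\,\bar g(h,k)\big)-\bar g(h,k)\mathrm{Tr}(L)\Big]\nu+\tfrac1\Phi Tf.\Big[\Phi'\bar g(h,k)\,\mathrm{grad}^g(\det L)-\mathrm{grad}^g\big(\Phi\,\bar g(h,k)\big)\Big].$$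 2. Let $J\subseteq\mathbb R$ be an open interval and $f:J\times M\to\mathbb R^n$ a smooth path of immersions. Then $f$ is a geodesic of $G^\Phi$ (that is, for all $[a,b]\subset J$ it is a critical point of the energy $\frac12\int_a^bG^\Phi_f(f_t,f_t)\,dt$ for smooth variations through immersions with fixed end points) if and only if $$f_{tt}=\tfrac12H_f(f_t,f_t)-K_f(f_t,f_t)\quad\text{on }J\times M,$$ equivalently, if and only if there is an $h$ with $$\begin{aligned}f_t&=h=h^\perp\nu+Tf.h^\top,\\ h_t&=\tfrac12\Big[\tfrac{\Phi'}{\Phi}\mathrm{Tr}(L)\det(L)\|h\|^2+\tfrac1\Phi\nabla^*\nabla^*\big(\Phi'.g.C(L)\|h\|^2\big)-\|h\|^2\mathrm{Tr}(L)\Big]\nu\\&\quad+\tfrac1{2\Phi}Tf.\Big[\Phi'\|h\|^2\mathrm{grad}^g(\det L)-\mathrm{grad}^g(\Phi\|h\|^2)\Big]\\&\quad-\Big[\tfrac{\Phi'}{\Phi}\Big(\mathrm{Tr}(L)\det(L)h^\perp+g^0_2\big(g.C(L),\nabla^2(h^\perp)\big)+d\det(L)(h^\top)\Big)+\mathrm{div}^g(h^\top)-\mathrm{Tr}(L)h^\perp\Big]h.\end{aligned}$$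 -/

import Mathlib

open scoped Manifold ContDiff Topology

noncomputable section

namespace ImmGeo

/-- Euclidean space of dimension `d`. -/
abbrev ESp (d : ℕ) := EuclideanSpace ℝ (Fin d)

/-! ### Hypersurface geometry in coordinates

In this part `F : ESp d → ESp (d + 1)` is an immersion written in a chart, `x` is a point of the chart
domain; scalar functions, vector fields and tensor fields on the hypersurface are given by their
coordinates in this chart. -/

/-- The partial derivative `∂ᵢ u` at `x`. -/
def pd {d : ℕ} {W : Type*} [NormedAddCommGroup W] [NormedSpace ℝ W]
    (i : Fin d) (u : ESp d → W) (x : ESp d) : W :=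
  fderiv ℝ u x (EuclideanSpace.single i 1)

/-- The induced metric `g_ij = ⟨∂ᵢF, ∂ⱼF⟩`. -/
def coMetric {d : ℕ} (F : ESp d → ESp (d + 1)) (x : ESp d) : Matrix (Fin d) (Fin d) ℝ :=
  Matrix.of fun i j => inner ℝ (pd i F x) (pd j F x)

/-- The inverse metric `g^ij`. -/
def coMetricInv {d : ℕ} (F : ESp d → ESp (d + 1)) (x : ESp d) : Matrix (Fin d) (Fin d) ℝ :=
  (coMetric F x)⁻¹

/-- The volume density `√det g`. -/
def coVolDensity {d : ℕ} (F : ESp d → ESp (d + 1)) (x : ESp d) : ℝ :=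
  √ (coMetric F x).det

/-- The Christoffel symbol `Γ^k_ij` of the Levi-Civita derivative of `g`. -/
def coChristoffel {d : ℕ} (F : ESp d → ESp (d + 1)) (x : ESp d) (k i j : Fin d) : ℝ :=
  (1 / 2) * ∑ l, coMetricInv F x k l *
    (pd i (fun y => coMetric F y j l) x + pd j (fun y => coMetric F y i l) x
      - pd l (fun y => coMetric F y i j) x)

/-- The cross product of `∂₁F, …, ∂_dF`: the vector `N` with
`⟨N, w⟩ = det (w, ∂₁F, …, ∂_dF)` for all `w`. -/
def coCross {d : ℕ} (F : ESp d → ESp (d + 1)) (x : ESp d) : ESp (d + 1) :=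
  WithLp.toLp 2 fun r : Fin (d + 1) =>
    Matrix.det (Matrix.of (Fin.cons (Pi.single r (1 : ℝ)) (fun (i : Fin d) (j : Fin (d + 1)) => pd i F x j)
      : Fin (d + 1) → Fin (d + 1) → ℝ))

/-- The unit normal `ν` for which `(ν, ∂₁F, …, ∂_dF)` is positively oriented. -/
def coNormal {d : ℕ} (F : ESp d → ESp (d + 1)) (x : ESp d) : ESp (d + 1) :=
  ‖coCross F x‖⁻¹ • coCross F x

/-- The second fundamental form, `s(∂ᵢ, ∂ⱼ) = - ⟨∂ᵢν, ∂ⱼF⟩`. -/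
def coSecond {d : ℕ} (F : ESp d → ESp (d + 1)) (x : ESp d) (i j : Fin d) : ℝ :=
  - inner ℝ (pd i (coNormal F) x) (pd j F x)

/-- The matrix `L^i_j` of the Weingarten mapping, `L ∂ⱼ = ∑ᵢ L^i_j ∂ᵢ`,
determined by `g(L ∂ⱼ, ∂ₖ) = s(∂ⱼ, ∂ₖ)`. -/
def coWeingarten {d : ℕ} (F : ESp d → ESp (d + 1)) (x : ESp d) : Matrix (Fin d) (Fin d) ℝ :=
  Matrix.of fun i j => ∑ k, coMetricInv F x i k * coSecond F x j k

/-- The `(0,2)`-tensor `g.C(L)`, with `C(L)` the classical adjoint of `L`. -/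
def coMetricAdj {d : ℕ} (F : ESp d → ESp (d + 1)) (x : ESp d) : Matrix (Fin d) (Fin d) ℝ :=
  coMetric F x * (coWeingarten F x).adjugate

/-- The Hessian `∇²u` of a function: `∂ᵢ∂ⱼu - Γ^k_ij ∂ₖu`. -/
def coHess {d : ℕ} (F : ESp d → ESp (d + 1)) (u : ESp d → ℝ) (x : ESp d) :
    Matrix (Fin d) (Fin d) ℝ :=
  Matrix.of fun i j => pd i (pd j u) x - ∑ k, coChristoffel F x k i j * pd k u x

/-- The product metric on `(0,2)`-tensors: `g^ik g^jl B_ij C_kl`. -/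
def coPairing {d : ℕ} (F : ESp d → ESp (d + 1)) (x : ESp d)
    (B C : Matrix (Fin d) (Fin d) ℝ) : ℝ :=
  ∑ i, ∑ j, ∑ k, ∑ l, coMetricInv F x i k * coMetricInv F x j l * B i j * C k l

/-- The covariant derivative of a `(0,2)`-tensor field: `(∇ₖB)_ij`. -/
def coCov₂ {d : ℕ} (F : ESp d → ESp (d + 1)) (B : ESp d → Matrix (Fin d) (Fin d) ℝ) (x : ESp d)
    (k i j : Fin d) : ℝ :=
  pd k (fun y => B y i j) x - ∑ l, coChristoffel F x l k i * B x l j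
    - ∑ l, coChristoffel F x l k j * B x i l

/-- `∇*B = - Tr^g ∇B` for a `(0,2)`-tensor field `B`, a 1-form. -/
def coAdj₂ {d : ℕ} (F : ESp d → ESp (d + 1)) (B : ESp d → Matrix (Fin d) (Fin d) ℝ) (x : ESp d)
    (j : Fin d) : ℝ :=
  - ∑ k, ∑ i, coMetricInv F x k i * coCov₂ F B x k i j

/-- The covariant derivative of a 1-form: `(∇ₖθ)_j`. -/
def coCov₁ {d : ℕ} (F : ESp d → ESp (d + 1)) (θ : ESp d → Fin d → ℝ) (x : ESp d)
    (k j : Fin d) : ℝ :=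
  pd k (fun y => θ y j) x - ∑ l, coChristoffel F x l k j * θ x l

/-- `∇*θ = - Tr^g ∇θ` for a 1-form `θ`, a function. -/
def coAdj₁ {d : ℕ} (F : ESp d → ESp (d + 1)) (θ : ESp d → Fin d → ℝ) (x : ESp d) : ℝ :=
  - ∑ k, ∑ j, coMetricInv F x k j * coCov₁ F θ x k j

/-- The components of `grad^g u`: `g^ij ∂ⱼu`. -/
def coGrad {d : ℕ} (F : ESp d → ESp (d + 1)) (u : ESp d → ℝ) (x : ESp d) (i : Fin d) : ℝ :=
  ∑ j, coMetricInv F x i j * pd j u x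

/-- The divergence `div^g X = ∇ᵢX^i = ∂ᵢX^i + Γ^i_ij X^j`. -/
def coDiv {d : ℕ} (F : ESp d → ESp (d + 1)) (X : ESp d → Fin d → ℝ) (x : ESp d) : ℝ :=
  ∑ i, (pd i (fun y => X y i) x + ∑ j, coChristoffel F x i i j * X x j)

/-- The components of the tangential part `h^⊤` of a field `h` along `F`:
`g(h^⊤, ∂ⱼ) = ⟨h, ∂ⱼF⟩`. -/
def coTan {d : ℕ} (F h : ESp d → ESp (d + 1)) (x : ESp d) (i : Fin d) : ℝ :=
  ∑ j, coMetricInv F x i j * inner ℝ (h x) (pd j F x)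

/-- `TF.X = ∑ᵢ X^i ∂ᵢF`. -/
def coPush {d : ℕ} (F : ESp d → ESp (d + 1)) (X : Fin d → ℝ) (x : ESp d) : ESp (d + 1) :=
  ∑ i, X i • pd i F x

/-! ### The objects on the manifold

The manifold `M` is modelled on `ESp d`. The value at `p` of an invariant object is computed in the
preferred chart at `p`. -/

/-- All charts of the atlas of `M` have orientation preserving transition maps: `M` is an oriented
manifold, and its charts are positively oriented. -/
def OrientedAtlas (d : ℕ) (M : Type*) [TopologicalSpace M] [ChartedSpace (ESp d) M] : Prop :=
  ∀ e ∈ atlas (ESp d) M, ∀ e' ∈ atlas (ESp d) M,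
    ∀ x ∈ (e.symm ≫ₕ e').source, 0 < (fderiv ℝ (e.symm ≫ₕ e') x).det

section Manifold

variable {d : ℕ} {M : Type*} [TopologicalSpace M] [ChartedSpace (ESp d) M]

/-- The smooth maps `M → ℝ^(d+1)`; these are the tangent vectors at every immersion. -/
def SmoothField (h : M → ESp (d + 1)) : Prop :=
  ContMDiff (𝓡 d) 𝓘(ℝ, ESp (d + 1)) ∞ h

/-- Smooth immersions `M → ℝ^(d+1)`. -/
def SmoothImm (f : M → ESp (d + 1)) : Prop :=
  ContMDiff (𝓡 d) 𝓘(ℝ, ESp (d + 1)) ∞ f ∧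
    ∀ p, Function.Injective (mfderiv (𝓡 d) 𝓘(ℝ, ESp (d + 1)) f p)

/-- The expression of `u : M → W` in the preferred chart at `p`. -/
def inChart {W : Type*} (p : M) (u : M → W) : ESp d → W :=
  u ∘ (chartAt (ESp d) p).symm

/-- The coordinates of `p` in the preferred chart at `p`. -/
def pt (p : M) : ESp d := chartAt (ESp d) p p

/-- The unit normal field `ν^f`. -/
def normal (f : M → ESp (d + 1)) (p : M) : ESp (d + 1) := coNormal (inChart p f) (pt p)

/-- `Tr(L)`. -/
def trL (f : M → ESp (d + 1)) (p : M) : ℝ := (coWeingarten (inChart p f) (pt p)).trace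

/-- `det(L)`. -/
def detL (f : M → ESp (d + 1)) (p : M) : ℝ := (coWeingarten (inChart p f) (pt p)).det

/-- The normal part `h^⊥ = ⟨h, ν⟩`. -/
def perp (f h : M → ESp (d + 1)) (p : M) : ℝ := inner ℝ (h p) (normal f p)

/-- `Tf.h^⊤`. -/
def pushTan (f h : M → ESp (d + 1)) (p : M) : ESp (d + 1) :=
  coPush (inChart p f) (coTan (inChart p f) (inChart p h) (pt p)) (pt p)

/-- `div^g(h^⊤)`. -/
def divTan (f h : M → ESp (d + 1)) (p : M) : ℝ :=
  coDiv (inChart p f) (coTan (inChart p f) (inChart p h)) (pt p)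

/-- `du(h^⊤)`. -/
def dTan (f : M → ESp (d + 1)) (u : M → ℝ) (h : M → ESp (d + 1)) (p : M) : ℝ :=
  ∑ i, coTan (inChart p f) (inChart p h) (pt p) i * pd i (inChart p u) (pt p)

/-- `Tf.grad^g u`. -/
def pushGrad (f : M → ESp (d + 1)) (u : M → ℝ) (p : M) : ESp (d + 1) :=
  coPush (inChart p f) (coGrad (inChart p f) (inChart p u) (pt p)) (pt p)

/-- `g^0_2(g.C(L), ∇²u)`. -/
def adjHess (f : M → ESp (d + 1)) (u : M → ℝ) (p : M) : ℝ :=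
  coPairing (inChart p f) (pt p) (coMetricAdj (inChart p f) (pt p))
    (coHess (inChart p f) (inChart p u) (pt p))

/-- `∇*∇*(u.g.C(L))` for a function `u`. -/
def adjAdj (f : M → ESp (d + 1)) (u : M → ℝ) (p : M) : ℝ :=
  coAdj₁ (inChart p f)
    (coAdj₂ (inChart p f) (fun x => inChart p u x • coMetricAdj (inChart p f) x)) (pt p)

/-! ### The metric, its gradients, the geodesic equation -/

theorem exists_chartPartition (d : ℕ) (M : Type*) [TopologicalSpace M] [ChartedSpace (ESp d) M]
    [IsManifold (𝓡 d) ∞ M] [T2Space M] [CompactSpace M] :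
    ∃ ρ : SmoothPartitionOfUnity M (𝓡 d) M Set.univ,
      ρ.IsSubordinate fun i : M => (chartAt (ESp d) i).source :=
  SmoothPartitionOfUnity.exists_isSubordinate (𝓡 d) isClosed_univ _
    (fun i => (chartAt (ESp d) i).open_source)
    (fun p _ => Set.mem_iUnion.2 ⟨p, mem_chart_source _ p⟩)

/-- A smooth partition of unity subordinate to the preferred charts. -/
def chartPartition (d : ℕ) (M : Type*) [TopologicalSpace M] [ChartedSpace (ESp d) M]
    [IsManifold (𝓡 d) ∞ M] [T2Space M] [CompactSpace M] :
    SmoothPartitionOfUnity M (𝓡 d) M Set.univ :=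
  (exists_chartPartition d M).choose

variable [IsManifold (𝓡 d) ∞ M] [T2Space M] [CompactSpace M]

/-- `∫_M u vol(g)` for `g` the metric induced by `f`; only finitely many functions of the partition
of unity are nonzero. -/
def integralVol (f : M → ESp (d + 1)) (u : M → ℝ) : ℝ :=
  ∑ᶠ i : M, ∫ x in (chartAt (ESp d) i).target,
    inChart i (chartPartition d M i) x * inChart i u x * coVolDensity (inChart i f) x

/-- The metric `G^Φ_f(h, k) = ∫_M Φ(det L) ⟨h, k⟩ vol(g)`. -/
def GMet (Φ : ℝ → ℝ) (f h k : M → ESp (d + 1)) : ℝ :=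
  integralVol f fun p => Φ (detL f p) * inner ℝ (h p) (k p)

/-- `c` is a smooth path in `C^∞(M, ℝ^(d+1))` that runs through immersions for times near `0`, with
`c(0) = f` and `∂ₜ|₀ c = m`. -/
def CurveThrough (f m : M → ESp (d + 1)) (c : ℝ → M → ESp (d + 1)) : Prop :=
  ContMDiff (𝓘(ℝ, ℝ).prod (𝓡 d)) 𝓘(ℝ, ESp (d + 1)) ∞ (fun q : ℝ × M => c q.1 q.2) ∧
    (∀ᶠ t in 𝓝 (0 : ℝ), SmoothImm (c t)) ∧ c 0 = f ∧
    ∀ p, HasDerivAt (fun t => c t p) (m p) 0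

/-- `X` is the value `K_f(m, h)` of the `K`-gradient: `D_{f,m} G^Φ(h, k) = G^Φ_f(X, k)` for all `k`. -/
def IsKGradient (Φ : ℝ → ℝ) (f m h X : M → ESp (d + 1)) : Prop :=
  SmoothField X ∧ ∀ k, SmoothField k → ∀ c, CurveThrough f m c →
    HasDerivAt (fun t => GMet Φ (c t) h k) (GMet Φ f X k) 0

/-- `X` is the value `H_f(h, k)` of the `H`-gradient: `D_{f,m} G^Φ(h, k) = G^Φ_f(m, X)` for all `m`. -/
def IsHGradient (Φ : ℝ → ℝ) (f h k X : M → ESp (d + 1)) : Prop :=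
  SmoothField X ∧ ∀ m, SmoothField m → ∀ c, CurveThrough f m c →
    HasDerivAt (fun t => GMet Φ (c t) h k) (GMet Φ f m X) 0

/-- The formula for `K_f(m, h)`. -/
def KForm (Φ : ℝ → ℝ) (f m h : M → ESp (d + 1)) (p : M) : ESp (d + 1) :=
  (deriv Φ (detL f p) / Φ (detL f p) *
      (trL f p * detL f p * perp f m p + adjHess f (perp f m) p + dTan f (detL f) m p)
    + divTan f m p - trL f p * perp f m p) • h p

/-- The formula for `H_f(h, k)`. -/
def HForm (Φ : ℝ → ℝ) (f h k : M → ESp (d + 1)) (p : M) : ESp (d + 1) :=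
  (deriv Φ (detL f p) / Φ (detL f p) * trL f p * detL f p * inner ℝ (h p) (k p)
      + 1 / Φ (detL f p) * adjAdj f (fun q => deriv Φ (detL f q) * inner ℝ (h q) (k q)) p
      - inner ℝ (h p) (k p) * trL f p) • normal f p
    + (1 / Φ (detL f p)) •
      ((deriv Φ (detL f p) * inner ℝ (h p) (k p)) • pushGrad f (detL f) p
        - pushGrad f (fun q => Φ (detL f q) * inner ℝ (h q) (k q)) p)

/-- The right hand side of the geodesic equation `h_t = …`. -/
def geodesicRHS (Φ : ℝ → ℝ) (f h : M → ESp (d + 1)) (p : M) : ESp (d + 1) :=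
  (1 / 2 : ℝ) •
      ((deriv Φ (detL f p) / Φ (detL f p) * trL f p * detL f p * ‖h p‖ ^ 2
        + 1 / Φ (detL f p) * adjAdj f (fun q => deriv Φ (detL f q) * ‖h q‖ ^ 2) p
        - ‖h p‖ ^ 2 * trL f p) • normal f p)
    + (1 / (2 * Φ (detL f p))) •
      ((deriv Φ (detL f p) * ‖h p‖ ^ 2) • pushGrad f (detL f) p
        - pushGrad f (fun q => Φ (detL f q) * ‖h q‖ ^ 2) p)
    - (deriv Φ (detL f p) / Φ (detL f p) *
        (trL f p * detL f p * perp f h p + adjHess f (perp f h) p + dTan f (detL f) h p)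
      + divTan f h p - trL f p * perp f h p) • h p

/-- The velocity `f_t`. -/
def velocity (f : ℝ → M → ESp (d + 1)) (t : ℝ) (p : M) : ESp (d + 1) :=
  deriv (fun τ => f τ p) t

/-- A smooth path of immersions, defined for times in the open set `J`. -/
def SmoothImmPath (J : Set ℝ) (f : ℝ → M → ESp (d + 1)) : Prop :=
  ContMDiffOn (𝓘(ℝ, ℝ).prod (𝓡 d)) 𝓘(ℝ, ESp (d + 1)) ∞
      (fun q : ℝ × M => f q.1 q.2) (J ×ˢ Set.univ) ∧
    ∀ t ∈ J, SmoothImm (f t)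

/-- The energy `½ ∫_a^b G^Φ_f(f_t, f_t) dt`. -/
def energy (Φ : ℝ → ℝ) (a b : ℝ) (f : ℝ → M → ESp (d + 1)) : ℝ :=
  (1 / 2) * ∫ t in a..b, GMet Φ (f t) (velocity f t) (velocity f t)

/-- `c` is a smooth variation of the path `f` through paths of immersions on `[a, b]` with the same
end points. -/
def FixedEndVariation (J : Set ℝ) (a b : ℝ) (f : ℝ → M → ESp (d + 1))
    (c : ℝ → ℝ → M → ESp (d + 1)) : Prop :=
  ContMDiffOn (𝓘(ℝ, ℝ).prod (𝓘(ℝ, ℝ).prod (𝓡 d))) 𝓘(ℝ, ESp (d + 1)) ∞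
      (fun q : ℝ × ℝ × M => c q.1 q.2.1 q.2.2) (Set.univ ×ˢ J ×ˢ Set.univ) ∧
    (∀ᶠ s in 𝓝 (0 : ℝ), ∀ t ∈ Set.Icc a b, SmoothImm (c s t)) ∧
    (∀ t ∈ J, c 0 t = f t) ∧ (∀ s, c s a = f a) ∧ (∀ s, c s b = f b)

/-- The path `f`, defined for times in `J`, is a geodesic of `G^Φ`: on every compact subinterval it
is a critical point of the energy for variations with fixed end points. -/
def IsGeodesic (Φ : ℝ → ℝ) (J : Set ℝ) (f : ℝ → M → ESp (d + 1)) : Prop :=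
  ∀ a b, a < b → Set.Icc a b ⊆ J → ∀ c, FixedEndVariation J a b f c →
    HasDerivAt (fun s => energy Φ a b (c s)) 0 0

end Manifold

end ImmGeo

end

/-!
The proof separates a pointwise computation in a chart, an integration by parts, and the calculus
of variations in time.

**First variation.** Let an immersion `F`, written in a chart, move with velocity `m`. Write
`m = a ν + X^l ∂_l F`. The first variations of `g` and of the second fundamental form `s` obey
Leibniz rules in `m` (`varMetric_eq`, `varSecond_eq`); for `m = ν` they are `-2 s` and `-s g⁻¹ s`,
and for `m = ∂_l F` they are spatial derivatives, since moving `F` along `∂_l F` is translating the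
chart. Jacobi's formula then gives the variations of the volume density and of
`det L = det s / det g` (`varVol_eq`, `varDet_eq`). Together these say that the scalar in front of
`h` in `K_f(m, h)`, called `coBracket` in a chart and `bracket` on `M`, is the first variation of
`log (Φ(det L) √det g)` (`hasDerivAt_weightedDensity`). Differentiation under the integral sign
(`hasDerivAt_GMet`) shows that the formula for `K` is a gradient.

**Adjoint.** The integrands `Φ · bracket(m) · ⟨h, k⟩` and `Φ ⟨m, H(h, k)⟩` differ by the divergence
of an explicit vector field `coFlux` which depends linearly on `m` (`coBracket_sub_inner_coHGrad`).
If `m` is supported in a chart this divergence integrates to zero (`setIntegral_coBracket`); a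
partition of unity gives the statement for all `m` (`integralVol_bracket`), so that the formula for
`H` is a gradient as well. Both gradients are unique because `G^Φ` is positive definite and the
straight lines `f + t m` are admissible curves (`eq_of_GMet_right_eq`, `curveThrough_add_smul`).

**Independence of the chart.** The formulas are evaluated at each point in the preferred
chart there, so smoothness and integration need to know that any other chart gives the same value.
The transformation laws of covariant derivatives are not needed for this. A change of chart
multiplies `Φ(det L) √det g` by a factor which does not depend on the immersion, hence leaves its
logarithmic first variation unchanged (`coBracket_comp`). The `H`-gradients computed in two charts
represent the same linear functional of `m`, hence agree (`coHGrad_comp`).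

**Geodesics.** Along a path `f` put `S = f_tt - (½ H(f_t, f_t) - K(f_t, f_t))` (`geoDefect`). For a
variation with field `m`, the two gradient properties give
`∂_s (½ G(f_t, f_t)) = ∂_t G(m, f_t) - G(m, S)` (`fderiv_energyDensity`), so with fixed end points
the first variation of the energy is `-∫ G(m, S) dt` (`hasDerivAt_energy`). It vanishes if `S = 0`.
Conversely, the variations `f + s χ(t) k` with bump functions `χ` show that `G(k, S) = 0` at each
time, for every `k`; the choice `k = S(t₀)` gives `S(t₀) = 0` (`isGeodesic_iff`). These variations
are admissible because being an immersion is an open condition on a compact manifold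
(`eventually_immMap`).
-/

namespace ImmGeo

/-! ### Smooth families and matrix-valued functions -/

section Calculus

variable {d : ℕ} {P V W : Type*} [NormedAddCommGroup P] [NormedSpace ℝ P]
  [NormedAddCommGroup V] [NormedSpace ℝ V] [NormedAddCommGroup W] [NormedSpace ℝ W]

theorem contDiffAt_matrix_det {ι : Type*} [Fintype ι] [DecidableEq ι] {n : WithTop ℕ∞} {x : V}
    {A : V → Matrix ι ι ℝ} (hA : ∀ i j, ContDiffAt ℝ n (fun y => A y i j) x) :
    ContDiffAt ℝ n (fun y => (A y).det) x := by
  simp only [Matrix.det_apply']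
  exact ContDiffAt.sum fun σ _ => contDiffAt_const.mul (contDiffAt_prod fun i _ => hA _ _)

theorem contDiffAt_matrix_adjugate {ι : Type*} [Fintype ι] [DecidableEq ι] {n : WithTop ℕ∞} {x : V}
    {A : V → Matrix ι ι ℝ} (hA : ∀ i j, ContDiffAt ℝ n (fun y => A y i j) x) (i j : ι) :
    ContDiffAt ℝ n (fun y => (A y).adjugate i j) x := by
  simp only [Matrix.adjugate_apply]
  refine contDiffAt_matrix_det fun a b => ?_
  by_cases h : a = j
  · subst h; simpa using contDiffAt_const
  · simpa [Matrix.updateRow_ne h] using hA a b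

theorem contDiffAt_matrix_inv {ι : Type*} [Fintype ι] [DecidableEq ι] {n : WithTop ℕ∞} {x : V}
    {A : V → Matrix ι ι ℝ} (hA : ∀ i j, ContDiffAt ℝ n (fun y => A y i j) x)
    (hx : (A x).det ≠ 0) (i j : ι) :
    ContDiffAt ℝ n (fun y => (A y)⁻¹ i j) x := by
  simp only [Matrix.inv_def, Ring.inverse_eq_inv', Matrix.smul_apply, smul_eq_mul]
  exact ((contDiffAt_matrix_det hA).inv hx).mul (contDiffAt_matrix_adjugate hA i j)

theorem contDiffAt_matrix_mul {ι : Type*} [Fintype ι] {n : WithTop ℕ∞} {x : V}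
    {A B : V → Matrix ι ι ℝ} (hA : ∀ i j, ContDiffAt ℝ n (fun y => A y i j) x)
    (hB : ∀ i j, ContDiffAt ℝ n (fun y => B y i j) x) (i j : ι) :
    ContDiffAt ℝ n (fun y => (A y * B y) i j) x := by
  simp only [Matrix.mul_apply]
  exact ContDiffAt.sum fun k _ => (hA _ _).mul (hB _ _)

/-- Jacobi's formula for the derivative of a determinant. -/
theorem hasDerivAt_matrix_det {ι : Type*} [Fintype ι] [DecidableEq ι] {t : ℝ}
    {A : ℝ → Matrix ι ι ℝ} {A' : Matrix ι ι ℝ}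
    (hA : ∀ i j, HasDerivAt (fun s => A s i j) (A' i j) t) :
    HasDerivAt (fun s => (A s).det) (((A t).adjugate * A').trace) t := by
  have h0 : HasDerivAt (fun s => (A s).det)
      (∑ σ : Equiv.Perm ι, ((Equiv.Perm.sign σ : ℤ) : ℝ) *
        ∑ i, (∏ j ∈ Finset.univ.erase i, A t (σ j) j) • A' (σ i) i) t := by
    simp only [Matrix.det_apply']
    refine HasDerivAt.fun_sum fun σ _ => ?_
    exact (HasDerivAt.fun_finsetProd fun i _ => hA (σ i) i).const_mul _
  convert h0 using 1
  have h1 : ((A t).adjugate * A').trace = ∑ i, ((A t).updateCol i (fun k => A' k i)).det := by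
    simp only [Matrix.trace, Matrix.diag, ← Matrix.cramer_apply, Matrix.cramer_eq_adjugate_mulVec]
    rfl
  rw [h1]
  simp only [Matrix.det_apply', Finset.mul_sum]
  rw [Finset.sum_comm]
  refine Finset.sum_congr rfl fun σ _ => Finset.sum_congr rfl fun i _ => ?_
  rw [← Finset.mul_prod_erase _ _ (Finset.mem_univ i), smul_eq_mul, mul_comm (∏ _ ∈ _, _)]
  congr 2
  · simp
  · refine Finset.prod_congr rfl fun j hj => ?_
    simp [Matrix.updateCol_ne (Finset.ne_of_mem_erase hj)]

/-- The family `u` of maps on `ESp d`, depending on a parameter, is smooth in both variables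
at `(q, x)`. -/
def SmAt (u : P → ESp d → W) (q : P) (x : ESp d) : Prop :=
  ContDiffAt ℝ ∞ (fun z : P × ESp d => u z.1 z.2) (q, x)

theorem SmAt.slice {u : P → ESp d → W} {q : P} {x : ESp d} (h : SmAt u q x) :
    ContDiffAt ℝ ∞ (u q) x :=
  ContDiffAt.comp (g := fun z : P × ESp d => u z.1 z.2) (f := fun y : ESp d => (q, y)) x h
    (contDiffAt_const.prodMk contDiffAt_id)

theorem SmAt.param {u : P → ESp d → W} {q : P} {x : ESp d} (h : SmAt u q x) :
    ContDiffAt ℝ ∞ (fun r => u r x) q :=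
  ContDiffAt.comp (g := fun z : P × ESp d => u z.1 z.2) (f := fun r : P => (r, x)) q h
    (contDiffAt_id.prodMk contDiffAt_const)

theorem SmAt.of_slice (P : Type*) [NormedAddCommGroup P] [NormedSpace ℝ P] (q : P)
    {u : ESp d → W} {x : ESp d} (h : ContDiffAt ℝ ∞ u x) :
    SmAt (fun _ : P => u) q x :=
  ContDiffAt.comp (g := u) (f := fun z : P × ESp d => z.2) (q, x) h contDiffAt_snd

theorem SmAt.congr {u v : P → ESp d → W} {q : P} {x : ESp d} (h : SmAt u q x)
    (he : ∀ᶠ z : P × ESp d in 𝓝 (q, x), v z.1 z.2 = u z.1 z.2) : SmAt v q x :=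
  ContDiffAt.congr_of_eventuallyEq h he

theorem eventually_differentiableAt {f : V → W} {x : V} (h : ContDiffAt ℝ ∞ f x) :
    ∀ᶠ y in 𝓝 x, DifferentiableAt ℝ f y :=
  ((h.of_le (by norm_num : (1 : WithTop ℕ∞) ≤ ∞)).eventually (by simp)).mono
    fun _ hy => hy.differentiableAt (by norm_num)

theorem contDiffAt_fderiv_apply {f : V → W} {x : V} (h : ContDiffAt ℝ ∞ f x) (v : V) :
    ContDiffAt ℝ ∞ (fun y => fderiv ℝ f y v) x :=
  (h.fderiv_right (m := ∞) (by simp)).clm_apply contDiffAt_const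

theorem ContDiffAt.pd {u : ESp d → W} {x : ESp d} (h : ContDiffAt ℝ ∞ u x) (i : Fin d) :
    ContDiffAt ℝ ∞ (ImmGeo.pd i u) x :=
  contDiffAt_fderiv_apply h _

theorem pd_slice {u : P → ESp d → W} {q : P} {x : ESp d}
    (h : DifferentiableAt ℝ (fun z : P × ESp d => u z.1 z.2) (q, x)) (i : Fin d) :
    pd i (u q) x =
      fderiv ℝ (fun z : P × ESp d => u z.1 z.2) (q, x) (0, EuclideanSpace.single i 1) := by
  have h2 : HasFDerivAt (fun y : ESp d => (q, y)) (ContinuousLinearMap.inr ℝ P (ESp d)) x :=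
    hasFDerivAt_prodMk_right q x
  have := (h.hasFDerivAt.comp x h2).fderiv
  simp only [pd]
  change fderiv ℝ ((fun z : P × ESp d => u z.1 z.2) ∘ fun y => (q, y)) x _ = _
  rw [this]; simp

theorem SmAt.pd {u : P → ESp d → W} {q : P} {x : ESp d} (h : SmAt u q x) (i : Fin d) :
    SmAt (fun r => ImmGeo.pd i (u r)) q x :=
  ContDiffAt.congr_of_eventuallyEq (contDiffAt_fderiv_apply h (0, EuclideanSpace.single i 1))
    ((eventually_differentiableAt h).mono fun _ hz => pd_slice hz i)

theorem param_deriv {u : ℝ → ESp d → W} {q : ℝ} {x : ESp d}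
    (h : DifferentiableAt ℝ (fun z : ℝ × ESp d => u z.1 z.2) (q, x)) :
    deriv (fun r => u r x) q = fderiv ℝ (fun z : ℝ × ESp d => u z.1 z.2) (q, x) (1, 0) := by
  have h2 : HasFDerivAt (fun y : ℝ => (y, x)) (ContinuousLinearMap.inl ℝ ℝ (ESp d)) q :=
    hasFDerivAt_prodMk_left q x
  have := (h.hasFDerivAt.comp q h2).hasDerivAt.deriv
  change deriv ((fun z : ℝ × ESp d => u z.1 z.2) ∘ fun y => (y, x)) q = _
  rw [this]; simp

theorem SmAt.param_deriv {u : ℝ → ESp d → W} {q : ℝ} {x : ESp d} (h : SmAt u q x) :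
    SmAt (fun r y => deriv (fun r => u r y) r) q x :=
  ContDiffAt.congr_of_eventuallyEq (contDiffAt_fderiv_apply h (1, 0))
    ((eventually_differentiableAt h).mono fun _ hz => ImmGeo.param_deriv hz)

theorem fderiv_fderiv_apply_comm {f : V → W} {x : V} (h : ContDiffAt ℝ ∞ f x) (v w : V) :
    fderiv ℝ (fun y => fderiv ℝ f y v) x w = fderiv ℝ (fun y => fderiv ℝ f y w) x v := by
  have h1 : DifferentiableAt ℝ (fderiv ℝ f) x :=
    (h.fderiv_right (m := ∞) (by simp)).differentiableAt (by simp)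
  rw [fderiv_clm_apply h1 (differentiableAt_const _), fderiv_clm_apply h1 (differentiableAt_const _)]
  simpa using (h.isSymmSndFDerivAt
    (by simpa using WithTop.coe_le_coe.2 (le_top : (2 : ℕ∞) ≤ ⊤))).eq w v

theorem pd_comm {u : ESp d → W} {x : ESp d} (h : ContDiffAt ℝ ∞ u x) (i j : Fin d) :
    pd i (pd j u) x = pd j (pd i u) x :=
  fderiv_fderiv_apply_comm h _ _

theorem deriv_pd_comm {u : ℝ → ESp d → W} {q : ℝ} {x : ESp d} (h : SmAt u q x) (i : Fin d) :
    HasDerivAt (fun r => pd i (u r) x) (pd i (fun y => deriv (fun r => u r y) q) x) q := by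
  have h1 := (h.pd i).param.differentiableAt (by simp) |>.hasDerivAt
  convert h1 using 1
  rw [ImmGeo.param_deriv (u := fun r => pd i (u r)) ((h.pd i).differentiableAt (by simp)),
    pd_slice (u := fun r y => deriv (fun r => u r y) r) (q := q)
      (h.param_deriv.differentiableAt (by simp)) i]
  have e1 : (fun z : ℝ × ESp d => deriv (fun r => u r z.2) z.1) =ᶠ[𝓝 (q, x)]
      fun z => fderiv ℝ (fun z : ℝ × ESp d => u z.1 z.2) z (1, 0) :=
    (eventually_differentiableAt h).mono fun _ hz => ImmGeo.param_deriv hz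
  have e2 : (fun z : ℝ × ESp d => pd i (u z.1) z.2) =ᶠ[𝓝 (q, x)]
      fun z => fderiv ℝ (fun z : ℝ × ESp d => u z.1 z.2) z (0, EuclideanSpace.single i 1) :=
    (eventually_differentiableAt h).mono fun _ hz => pd_slice hz i
  rw [e1.fderiv_eq, e2.fderiv_eq]
  exact fderiv_fderiv_apply_comm h _ _

section PdRules

variable {x : ESp d} (i : Fin d)

theorem pd_congr {u v : ESp d → W} (h : u =ᶠ[𝓝 x] v) : pd i u x = pd i v x := by
  simp only [pd, h.fderiv_eq]

theorem pd_eventuallyEq {u v : ESp d → W} (h : u =ᶠ[𝓝 x] v) : pd i u =ᶠ[𝓝 x] pd i v :=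
  h.eventuallyEq_nhds.mono fun _ hy => pd_congr i hy

theorem pd_const (c : W) : pd i (fun _ => c) x = 0 := by simp [pd]

theorem pd_add {u v : ESp d → W} (hu : DifferentiableAt ℝ u x) (hv : DifferentiableAt ℝ v x) :
    pd i (fun y => u y + v y) x = pd i u x + pd i v x := by
  simp only [pd]
  rw [fderiv_fun_add hu hv]; rfl

theorem pd_sum {ι : Type*} {s : Finset ι} {u : ι → ESp d → W}
    (hu : ∀ k ∈ s, DifferentiableAt ℝ (u k) x) :
    pd i (fun y => ∑ k ∈ s, u k y) x = ∑ k ∈ s, pd i (u k) x := by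
  simp only [pd]
  rw [fderiv_fun_sum hu]; simp

theorem pd_smul {u : ESp d → ℝ} {v : ESp d → W} (hu : DifferentiableAt ℝ u x)
    (hv : DifferentiableAt ℝ v x) :
    pd i (fun y => u y • v y) x = u x • pd i v x + pd i u x • v x := by
  simp only [pd]
  rw [fderiv_fun_smul hu hv]; simp

theorem pd_mul {u v : ESp d → ℝ} (hu : DifferentiableAt ℝ u x) (hv : DifferentiableAt ℝ v x) :
    pd i (fun y => u y * v y) x = u x * pd i v x + pd i u x * v x :=
  pd_smul i hu hv

theorem pd_inner {n : ℕ} {u v : ESp d → ESp n} (hu : DifferentiableAt ℝ u x)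
    (hv : DifferentiableAt ℝ v x) :
    pd i (fun y => inner ℝ (u y) (v y)) x = inner ℝ (u x) (pd i v x) + inner ℝ (pd i u x) (v x) := by
  simp only [pd]
  rw [fderiv_inner_apply ℝ hu hv]

end PdRules

theorem hasDerivAt_inner {n : ℕ} {u v : ℝ → ESp n} {t : ℝ} {u' v' : ESp n} (hu : HasDerivAt u u' t)
    (hv : HasDerivAt v v' t) :
    HasDerivAt (fun s => (inner ℝ (u s) (v s) : ℝ)) (inner ℝ (u t) v' + inner ℝ u' (v t)) t :=
  hu.inner ℝ hv

end Calculus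

/-! ### Smooth dependence of the geometric objects on the immersion -/

section Smooth

variable {d : ℕ} {P : Type*} [NormedAddCommGroup P] [NormedSpace ℝ P]
  {F h : P → ESp d → ESp (d + 1)} {u : P → ESp d → ℝ} {q : P} {x : ESp d}

theorem SmAt.inner {n : ℕ} {v w : P → ESp d → ESp n} (hv : SmAt v q x) (hw : SmAt w q x) :
    SmAt (fun r y => (inner ℝ (v r y) (w r y) : ℝ)) q x :=
  ContDiffAt.inner ℝ hv hw

theorem SmAt.coMetric (hF : SmAt F q x) (i j : Fin d) :
    SmAt (fun r y => ImmGeo.coMetric (F r) y i j) q x :=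
  (hF.pd i).inner (hF.pd j)

theorem SmAt.det_coMetric (hF : SmAt F q x) : SmAt (fun r y => (ImmGeo.coMetric (F r) y).det) q x :=
  contDiffAt_matrix_det fun i j => hF.coMetric i j

theorem SmAt.coMetricInv (hF : SmAt F q x) (h0 : (ImmGeo.coMetric (F q) x).det ≠ 0) (i j : Fin d) :
    SmAt (fun r y => ImmGeo.coMetricInv (F r) y i j) q x :=
  contDiffAt_matrix_inv (A := fun z : P × ESp d => ImmGeo.coMetric (F z.1) z.2)
    (fun i j => hF.coMetric i j) h0 i j

theorem SmAt.coVolDensity (hF : SmAt F q x) (h0 : (ImmGeo.coMetric (F q) x).det ≠ 0) :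
    SmAt (fun r y => ImmGeo.coVolDensity (F r) y) q x :=
  ContDiffAt.sqrt hF.det_coMetric h0

theorem SmAt.coChristoffel (hF : SmAt F q x) (h0 : (ImmGeo.coMetric (F q) x).det ≠ 0)
    (k i j : Fin d) : SmAt (fun r y => ImmGeo.coChristoffel (F r) y k i j) q x := by
  refine contDiffAt_const.mul (ContDiffAt.sum fun l _ => (hF.coMetricInv h0 k l).mul ?_)
  exact (((hF.coMetric j l).pd i).add ((hF.coMetric i l).pd j)).sub ((hF.coMetric i j).pd l)

theorem SmAt.coCross (hF : SmAt F q x) : SmAt (fun r y => ImmGeo.coCross (F r) y) q x := by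
  refine contDiffAt_euclidean.2 fun r => ?_
  simp only [ImmGeo.coCross]
  refine contDiffAt_matrix_det fun a b => ?_
  refine Fin.cases ?_ (fun a => ?_) a
  · simpa using contDiffAt_const
  · simpa using contDiffAt_euclidean.1 (hF.pd a) b

theorem SmAt.coNormal (hF : SmAt F q x) (h0 : ImmGeo.coCross (F q) x ≠ 0) :
    SmAt (fun r y => ImmGeo.coNormal (F r) y) q x :=
  ((hF.coCross.norm ℝ h0).inv (norm_ne_zero_iff.2 h0)).smul hF.coCross

theorem SmAt.coSecond (hF : SmAt F q x) (h0 : ImmGeo.coCross (F q) x ≠ 0) (i j : Fin d) :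
    SmAt (fun r y => ImmGeo.coSecond (F r) y i j) q x :=
  (((hF.coNormal h0).pd i).inner (hF.pd j)).neg

theorem SmAt.coWeingarten (hF : SmAt F q x) (h0 : ImmGeo.coCross (F q) x ≠ 0)
    (h1 : (ImmGeo.coMetric (F q) x).det ≠ 0) (i j : Fin d) :
    SmAt (fun r y => ImmGeo.coWeingarten (F r) y i j) q x := by
  simp only [SmAt, ImmGeo.coWeingarten, Matrix.of_apply]
  exact ContDiffAt.sum fun k _ => (hF.coMetricInv h1 i k).mul (hF.coSecond h0 j k)

theorem SmAt.coMetricAdj (hF : SmAt F q x) (h0 : ImmGeo.coCross (F q) x ≠ 0)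
    (h1 : (ImmGeo.coMetric (F q) x).det ≠ 0) (i j : Fin d) :
    SmAt (fun r y => ImmGeo.coMetricAdj (F r) y i j) q x :=
  contDiffAt_matrix_mul (A := fun z : P × ESp d => ImmGeo.coMetric (F z.1) z.2)
    (B := fun z : P × ESp d => (ImmGeo.coWeingarten (F z.1) z.2).adjugate)
    (fun i j => hF.coMetric i j)
    (fun i j => contDiffAt_matrix_adjugate (fun i j => hF.coWeingarten h0 h1 i j) i j) i j

theorem SmAt.coTan (hF : SmAt F q x) (hh : SmAt h q x) (h1 : (ImmGeo.coMetric (F q) x).det ≠ 0)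
    (i : Fin d) : SmAt (fun r y => ImmGeo.coTan (F r) (h r) y i) q x :=
  ContDiffAt.sum fun j _ => (hF.coMetricInv h1 i j).mul (hh.inner (hF.pd j))

end Smooth


/-! ### The adapted frame at a point -/

section Frame

variable {d : ℕ} {F : ESp d → ESp (d + 1)} {x : ESp d}

/-- The matrix with rows `w, ∂₁F, …, ∂_dF`. -/
noncomputable def frameMatrix (F : ESp d → ESp (d + 1)) (x : ESp d) (w : ESp (d + 1)) :
    Matrix (Fin (d + 1)) (Fin (d + 1)) ℝ :=
  Matrix.of (Fin.cons (fun j => w j) (fun (i : Fin d) (j : Fin (d + 1)) => pd i F x j) :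
    Fin (d + 1) → Fin (d + 1) → ℝ)

theorem inner_eq_sum {n : ℕ} (v w : ESp n) : (inner ℝ v w : ℝ) = ∑ i, v i * w i := by
  simp [PiLp.inner_apply, mul_comm]

/-- The defining property of the cross product, by expanding the determinant along the first row. -/
theorem inner_coCross (w : ESp (d + 1)) :
    (inner ℝ (coCross F x) w : ℝ) = (frameMatrix F x w).det := by
  rw [inner_eq_sum, Matrix.det_succ_row_zero]
  refine Finset.sum_congr rfl fun r _ => ?_
  have : coCross F x r = (-1) ^ (r : ℕ) * ((frameMatrix F x w).submatrix Fin.succ r.succAbove).det := by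
    simp only [coCross]
    rw [Matrix.det_succ_row_zero, Finset.sum_eq_single r]
    · simp only [Matrix.of_apply, Fin.cons_zero, Pi.single_eq_same, mul_one]
      rfl
    · intro b _ hb
      simp [Pi.single_eq_of_ne hb]
    · simp
  rw [this]
  simp only [frameMatrix, Matrix.of_apply, Fin.cons_zero]
  ring

theorem frameMatrix_mulVec (v w : ESp (d + 1)) :
    (frameMatrix F x w).mulVec v = Fin.cons (inner ℝ w v : ℝ) fun i => inner ℝ (pd i F x) v := by
  ext a
  refine Fin.cases ?_ (fun i => ?_) a
  · simp [frameMatrix, Matrix.mulVec, dotProduct, inner_eq_sum]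
  · simp [frameMatrix, Matrix.mulVec, dotProduct, inner_eq_sum]

/-- The Gram matrix of a frame `w, ∂₁F, …, ∂_dF` whose first vector is orthogonal to the others
is block diagonal. -/
theorem det_frameMatrix_sq {w : ESp (d + 1)} (hw : ∀ i, (inner ℝ w (pd i F x) : ℝ) = 0) :
    (frameMatrix F x w).det ^ 2 = inner ℝ w w * (coMetric F x).det := by
  have h1 : (frameMatrix F x w).det ^ 2
      = (frameMatrix F x w * (frameMatrix F x w).transpose).det := by
    rw [Matrix.det_mul, Matrix.det_transpose, sq]
  have key : ∀ a b, (frameMatrix F x w * (frameMatrix F x w).transpose) a b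
      = inner ℝ ((Fin.cons w fun i => pd i F x : Fin (d + 1) → ESp (d + 1)) a)
          ((Fin.cons w fun i => pd i F x : Fin (d + 1) → ESp (d + 1)) b) := by
    intro a b
    rw [inner_eq_sum, Matrix.mul_apply]
    refine Finset.sum_congr rfl fun j _ => ?_
    refine Fin.cases ?_ (fun i => ?_) a <;> refine Fin.cases ?_ (fun k => ?_) b <;>
      simp [frameMatrix]
  rw [h1, Matrix.det_succ_row_zero, Finset.sum_eq_single 0]
  · rw [key]
    simp only [Fin.val_zero, pow_zero, one_mul, Fin.cons_zero]
    congr 1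
    congr 1
    ext a b
    rw [Matrix.submatrix_apply, key]
    simp [coMetric]
  · intro b _ hb
    obtain ⟨k, rfl⟩ := Fin.exists_succ_eq.2 hb
    rw [key]
    simp [hw]
  · simp

theorem exists_orthogonal_ne_zero (e : Fin d → ESp (d + 1)) :
    ∃ w : ESp (d + 1), w ≠ 0 ∧ ∀ i, (inner ℝ w (e i) : ℝ) = 0 := by
  have h : Submodule.span ℝ (Set.range e) ≠ ⊤ := by
    intro h
    have h1 := finrank_range_le_card (R := ℝ) e
    rw [Set.finrank, h] at h1
    simp at h1
  have h2 : (Submodule.span ℝ (Set.range e))ᗮ ≠ ⊥ := by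
    rwa [Ne, Submodule.orthogonal_eq_bot_iff]
  obtain ⟨w, hw, hw0⟩ := Submodule.exists_mem_ne_zero_of_ne_bot h2
  exact ⟨w, hw0, fun i => (Submodule.mem_orthogonal' _ _).1 hw _
    (Submodule.subset_span (Set.mem_range_self i))⟩

theorem inner_coCross_pd (i : Fin d) : (inner ℝ (coCross F x) (pd i F x) : ℝ) = 0 := by
  rw [inner_coCross]
  refine Matrix.det_zero_of_row_eq (i := 0) (j := i.succ) (Fin.succ_ne_zero i).symm ?_
  ext j
  simp [frameMatrix]

theorem coCross_ne_zero (h : (coMetric F x).det ≠ 0) : coCross F x ≠ 0 := by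
  intro h0
  obtain ⟨w, hw0, hw⟩ := exists_orthogonal_ne_zero fun i => pd i F x
  have h1 := det_frameMatrix_sq hw
  rw [← inner_coCross, h0, inner_zero_left] at h1
  have := mul_ne_zero (inner_self_ne_zero (𝕜 := ℝ).2 hw0) h
  exact this (by rw [← h1]; norm_num)

theorem norm_coNormal (h : (coMetric F x).det ≠ 0) : ‖coNormal F x‖ = 1 := by
  rw [coNormal, norm_smul, norm_inv, norm_norm, inv_mul_cancel₀]
  exact norm_ne_zero_iff.2 (coCross_ne_zero h)

theorem inner_coNormal_self (h : (coMetric F x).det ≠ 0) :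
    (inner ℝ (coNormal F x) (coNormal F x) : ℝ) = 1 := by
  rw [real_inner_self_eq_norm_sq, norm_coNormal h, one_pow]

theorem inner_coNormal_pd (i : Fin d) : (inner ℝ (coNormal F x) (pd i F x) : ℝ) = 0 := by
  rw [coNormal, inner_smul_left, inner_coCross_pd, mul_zero]

theorem inner_pd_coNormal (i : Fin d) : (inner ℝ (pd i F x) (coNormal F x) : ℝ) = 0 := by
  rw [real_inner_comm, inner_coNormal_pd]

theorem coMetric_symm (i j : Fin d) : coMetric F x i j = coMetric F x j i := by
  simp only [coMetric, Matrix.of_apply, real_inner_comm]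

theorem coMetric_transpose : (coMetric F x).transpose = coMetric F x := by
  ext i j; exact coMetric_symm _ _

theorem coMetricInv_transpose : (coMetricInv F x).transpose = coMetricInv F x := by
  rw [coMetricInv, Matrix.transpose_nonsing_inv, coMetric_transpose]

theorem coMetricInv_symm (i j : Fin d) : coMetricInv F x i j = coMetricInv F x j i := by
  conv_lhs => rw [← coMetricInv_transpose]
  rfl

theorem coMetricInv_mul (h : (coMetric F x).det ≠ 0) : coMetricInv F x * coMetric F x = 1 :=
  Matrix.nonsing_inv_mul _ (isUnit_iff_ne_zero.2 h)

theorem mul_coMetricInv (h : (coMetric F x).det ≠ 0) : coMetric F x * coMetricInv F x = 1 :=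
  Matrix.mul_nonsing_inv _ (isUnit_iff_ne_zero.2 h)

theorem eq_zero_of_orthogonal (h : (coMetric F x).det ≠ 0) {v : ESp (d + 1)}
    (h0 : (inner ℝ (coNormal F x) v : ℝ) = 0) (h1 : ∀ i, (inner ℝ (pd i F x) v : ℝ) = 0) : v = 0 := by
  have hd : (frameMatrix F x (coNormal F x)).det ≠ 0 := by
    have := det_frameMatrix_sq (F := F) (x := x) (w := coNormal F x) inner_coNormal_pd
    rw [inner_coNormal_self h, one_mul] at this
    intro h2
    rw [h2] at this
    exact h (by rw [← this]; norm_num)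
  have h2 : (frameMatrix F x (coNormal F x)).mulVec v = 0 := by
    rw [frameMatrix_mulVec]
    ext a
    refine Fin.cases ?_ (fun i => ?_) a
    · simpa using h0
    · simpa using h1 i
  have := Matrix.eq_zero_of_mulVec_eq_zero hd h2
  ext i
  exact congrFun this i

/-- A vector is the sum of its normal and its tangential part. -/
theorem eq_normal_add_tangent (h : (coMetric F x).det ≠ 0) (v : ESp (d + 1)) :
    v = (inner ℝ v (coNormal F x) : ℝ) • coNormal F x
      + ∑ i, (∑ j, coMetricInv F x i j * inner ℝ v (pd j F x)) • pd i F x := by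
  rw [← sub_eq_zero]
  refine eq_zero_of_orthogonal h ?_ fun j => ?_
  · rw [inner_sub_right, inner_add_right, inner_smul_right, inner_coNormal_self h, inner_sum]
    simp only [inner_smul_right, inner_coNormal_pd, mul_zero, Finset.sum_const_zero, add_zero, mul_one]
    rw [real_inner_comm, sub_self]
  · rw [inner_sub_right, inner_add_right, inner_smul_right, inner_pd_coNormal, inner_sum]
    simp only [inner_smul_right, mul_zero, zero_add]
    have h2 : ∑ i, (∑ k, coMetricInv F x i k * inner ℝ v (pd k F x)) * inner ℝ (pd j F x) (pd i F x)
        = ∑ k, (coMetric F x * coMetricInv F x) j k * inner ℝ v (pd k F x) := by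
      simp only [Matrix.mul_apply, Finset.sum_mul]
      rw [Finset.sum_comm]
      refine Finset.sum_congr rfl fun k _ => Finset.sum_congr rfl fun i _ => ?_
      simp only [coMetric, Matrix.of_apply]
      ring
    rw [h2, mul_coMetricInv h]
    simp [Matrix.one_apply, real_inner_comm]

/-- The inner product of two vectors through their normal and tangential components. -/
theorem inner_eq_normal_add_tangent (h : (coMetric F x).det ≠ 0) (v w : ESp (d + 1)) :
    (inner ℝ v w : ℝ) = inner ℝ v (coNormal F x) * inner ℝ w (coNormal F x)
      + ∑ i, ∑ j, coMetricInv F x i j * inner ℝ v (pd j F x) * inner ℝ w (pd i F x) := by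
  conv_lhs => rw [eq_normal_add_tangent h v]
  rw [inner_add_left, real_inner_smul_left, sum_inner]
  simp only [real_inner_comm w, real_inner_smul_right, Finset.sum_mul]

/-- `g` is a Gram matrix. -/
theorem det_coMetric_nonneg : 0 ≤ (coMetric F x).det := by
  have : coMetric F x = (Matrix.of fun (i : Fin d) (j : Fin (d + 1)) => pd i F x j)
      * (Matrix.of fun (i : Fin d) (j : Fin (d + 1)) => pd i F x j).conjTranspose := by
    ext i j
    simp [coMetric, inner_eq_sum, Matrix.mul_apply]
  rw [this]
  exact (Matrix.posSemidef_self_mul_conjTranspose _).det_nonneg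

theorem coVolDensity_pos (h : (coMetric F x).det ≠ 0) : 0 < coVolDensity F x :=
  Real.sqrt_pos.2 (lt_of_le_of_ne det_coMetric_nonneg h.symm)

theorem fderiv_eq_sum_pd (v : ESp d) : fderiv ℝ F x v = ∑ i, v i • pd i F x := by
  have h := (EuclideanSpace.basisFun (Fin d) ℝ).sum_repr v
  conv_lhs => rw [← h]
  simp [pd]

/-- The induced bilinear form is nondegenerate exactly at the points where `F` is an immersion. -/
theorem det_coMetric_ne_zero_iff :
    (coMetric F x).det ≠ 0 ↔ Function.Injective (fderiv ℝ F x) := by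
  rw [injective_iff_map_eq_zero]
  constructor
  · intro h v hv
    have h1 : (coMetric F x).mulVec v = 0 := by
      ext i
      have : (inner ℝ (pd i F x) (fderiv ℝ F x v) : ℝ) = 0 := by rw [hv, inner_zero_right]
      rw [fderiv_eq_sum_pd, inner_sum] at this
      simpa [Matrix.mulVec, dotProduct, coMetric, inner_smul_right, mul_comm] using this
    have := Matrix.eq_zero_of_mulVec_eq_zero h h1
    ext i
    exact congrFun this i
  · intro h h0
    obtain ⟨v, hv0, hv⟩ := Matrix.exists_mulVec_eq_zero_iff.2 h0
    have h1 : fderiv ℝ F x (WithLp.toLp 2 v) = 0 := by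
      rw [← inner_self_eq_zero (𝕜 := ℝ)]
      conv_lhs => rw [fderiv_eq_sum_pd]
      rw [sum_inner]
      refine Finset.sum_eq_zero fun i _ => ?_
      rw [inner_smul_left, inner_sum]
      have := congrFun hv i
      simp only [Matrix.mulVec, dotProduct, coMetric, Matrix.of_apply, Pi.zero_apply] at this
      simp only [inner_smul_right]
      convert mul_zero _
      rw [← this]
      exact Finset.sum_congr rfl fun j _ => mul_comm _ _
    have h2 := h _ h1
    exact hv0 (by ext i; exact congrArg (fun w : ESp d => w i) h2)

end Frame


/-! ### First variation of the geometric objects -/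

section Gauss

variable {d : ℕ} {F : ESp d → ESp (d + 1)} {x : ESp d}

theorem ContDiffAt.coMetric (hF : ContDiffAt ℝ ∞ F x) (i j : Fin d) :
    ContDiffAt ℝ ∞ (fun y => ImmGeo.coMetric F y i j) x :=
  ((SmAt.of_slice ℝ 0 hF).coMetric i j).slice

theorem ContDiffAt.coMetricInv (hF : ContDiffAt ℝ ∞ F x) (h : (ImmGeo.coMetric F x).det ≠ 0)
    (i j : Fin d) : ContDiffAt ℝ ∞ (fun y => ImmGeo.coMetricInv F y i j) x :=
  ((SmAt.of_slice ℝ 0 hF).coMetricInv h i j).slice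

theorem ContDiffAt.coNormal (hF : ContDiffAt ℝ ∞ F x) (h : (ImmGeo.coMetric F x).det ≠ 0) :
    ContDiffAt ℝ ∞ (ImmGeo.coNormal F) x :=
  ((SmAt.of_slice ℝ 0 hF).coNormal (coCross_ne_zero h)).slice

theorem ContDiffAt.differentiableAt_infty {V W : Type*} [NormedAddCommGroup V] [NormedSpace ℝ V]
    [NormedAddCommGroup W] [NormedSpace ℝ W] {f : V → W} {x : V} (h : ContDiffAt ℝ ∞ f x) :
    DifferentiableAt ℝ f x := _root_.ContDiffAt.differentiableAt h (by simp)

theorem eventually_det_coMetric_ne_zero (hF : ContDiffAt ℝ ∞ F x)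
    (h : (coMetric F x).det ≠ 0) : ∀ᶠ y in 𝓝 x, (coMetric F y).det ≠ 0 :=
  (contDiffAt_matrix_det fun i j => ContDiffAt.coMetric hF i j).continuousAt.eventually_ne h

theorem inner_coNormal_pd_coNormal (hF : ContDiffAt ℝ ∞ F x) (h : (coMetric F x).det ≠ 0)
    (i : Fin d) : (inner ℝ (coNormal F x) (pd i (coNormal F) x) : ℝ) = 0 := by
  have hν := ContDiffAt.differentiableAt_infty (ContDiffAt.coNormal hF h)
  have h1 := pd_inner i hν hν
  have h2 : (fun y => (inner ℝ (coNormal F y) (coNormal F y) : ℝ)) =ᶠ[𝓝 x] fun _ => 1 :=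
    (eventually_det_coMetric_ne_zero hF h).mono fun y hy => inner_coNormal_self hy
  rw [pd_congr i h2, pd_const, real_inner_comm (coNormal F x) (pd i (coNormal F) x)] at h1
  linarith

/-- Since `⟨ν, ∂ⱼF⟩ = 0`, the second fundamental form is the normal component of `∂ᵢ∂ⱼF`. -/
theorem coSecond_eq (hF : ContDiffAt ℝ ∞ F x) (h : (coMetric F x).det ≠ 0) (i j : Fin d) :
    coSecond F x i j = inner ℝ (pd i (pd j F) x) (coNormal F x) := by
  have h1 := pd_inner i (ContDiffAt.differentiableAt_infty (ContDiffAt.coNormal hF h))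
    (ContDiffAt.differentiableAt_infty (ContDiffAt.pd hF j))
  have h2 : (fun y => (inner ℝ (coNormal F y) (pd j F y) : ℝ)) = fun _ => 0 := by
    ext y; exact inner_coNormal_pd j
  rw [h2, pd_const] at h1
  rw [coSecond, real_inner_comm (coNormal F x)]
  linarith

theorem coSecond_symm (hF : ContDiffAt ℝ ∞ F x) (h : (coMetric F x).det ≠ 0) (i j : Fin d) :
    coSecond F x i j = coSecond F x j i := by
  rw [coSecond_eq hF h, coSecond_eq hF h, pd_comm hF]

theorem pd_coMetric (hF : ContDiffAt ℝ ∞ F x) (k i j : Fin d) :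
    pd k (fun y => coMetric F y i j) x
      = inner ℝ (pd k (pd i F) x) (pd j F x) + inner ℝ (pd k (pd j F) x) (pd i F x) := by
  have h1 := pd_inner k (ContDiffAt.differentiableAt_infty (ContDiffAt.pd hF i))
    (ContDiffAt.differentiableAt_infty (ContDiffAt.pd hF j))
  refine h1.trans ?_
  rw [real_inner_comm (pd i F x)]; ring

/-- For an induced metric the Christoffel symbols are the tangential components of `∂ᵢ∂ⱼF`. -/
theorem coChristoffel_eq (hF : ContDiffAt ℝ ∞ F x) (k i j : Fin d) :
    coChristoffel F x k i j
      = ∑ l, coMetricInv F x k l * inner ℝ (pd i (pd j F) x) (pd l F x) := by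
  rw [coChristoffel, Finset.mul_sum]
  refine Finset.sum_congr rfl fun l _ => ?_
  rw [pd_coMetric hF, pd_coMetric hF, pd_coMetric hF, pd_comm hF j i, pd_comm hF l i,
    pd_comm hF l j]
  ring

/-- Gauss formula, paired with a vector orthogonal to the normal. -/
theorem inner_pd_pd_of_orthogonal (hF : ContDiffAt ℝ ∞ F x) (h : (coMetric F x).det ≠ 0)
    {w : ESp (d + 1)} (hw : (inner ℝ w (coNormal F x) : ℝ) = 0) (i j : Fin d) :
    (inner ℝ (pd i (pd j F) x) w : ℝ) = ∑ k, coChristoffel F x k i j * inner ℝ w (pd k F x) := by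
  rw [inner_eq_normal_add_tangent h, hw, mul_zero, zero_add]
  refine Finset.sum_congr rfl fun k _ => ?_
  rw [coChristoffel_eq hF, Finset.sum_mul]

end Gauss

section Variation

variable {d : ℕ}

/-- The first variation of the induced metric when `F` moves with velocity `m`. -/
noncomputable def varMetric (F m : ESp d → ESp (d + 1)) (x : ESp d) : Matrix (Fin d) (Fin d) ℝ :=
  Matrix.of fun i j => inner ℝ (pd i m x) (pd j F x) + inner ℝ (pd j m x) (pd i F x)

/-- The first variation of the second fundamental form when `F` moves with velocity `m`: the
normal component of the Hessian of `m`. -/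
noncomputable def varSecond (F m : ESp d → ESp (d + 1)) (x : ESp d) : Matrix (Fin d) (Fin d) ℝ :=
  Matrix.of fun i j => inner ℝ (pd i (pd j m) x) (coNormal F x)
    - ∑ k, coChristoffel F x k i j * inner ℝ (pd k m x) (coNormal F x)

/-- The matrix of the second fundamental form. -/
noncomputable def secondMatrix (F : ESp d → ESp (d + 1)) (x : ESp d) : Matrix (Fin d) (Fin d) ℝ :=
  Matrix.of fun i j => coSecond F x i j

/-- The first variation of `det L` when `F` moves with velocity `m`. -/
noncomputable def varDet (F m : ESp d → ESp (d + 1)) (x : ESp d) : ℝ :=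
  (((secondMatrix F x).adjugate * varSecond F m x).trace
    - (secondMatrix F x).det * (coMetricInv F x * varMetric F m x).trace) / (coMetric F x).det

/-- The first variation of the logarithm of the volume density when `F` moves with velocity `m`. -/
noncomputable def varVol (F m : ESp d → ESp (d + 1)) (x : ESp d) : ℝ :=
  (1 / 2) * (coMetricInv F x * varMetric F m x).trace

/-- The Gauss-Kronecker curvature `det L`, in coordinates. -/
noncomputable def coDet (F : ESp d → ESp (d + 1)) (x : ESp d) : ℝ := (coWeingarten F x).det

theorem secondMatrix_transpose {F : ESp d → ESp (d + 1)} {x : ESp d} (hF : ContDiffAt ℝ ∞ F x)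
    (h : (coMetric F x).det ≠ 0) : (secondMatrix F x).transpose = secondMatrix F x := by
  ext i j; exact coSecond_symm hF h j i

theorem coWeingarten_eq' (F : ESp d → ESp (d + 1)) (x : ESp d) :
    coWeingarten F x = coMetricInv F x * (secondMatrix F x).transpose := by
  ext i j
  simp [coWeingarten, Matrix.mul_apply, secondMatrix]

theorem coWeingarten_eq {F : ESp d → ESp (d + 1)} {x : ESp d} (hF : ContDiffAt ℝ ∞ F x)
    (h : (coMetric F x).det ≠ 0) :
    coWeingarten F x = coMetricInv F x * secondMatrix F x := by
  rw [coWeingarten_eq', secondMatrix_transpose hF h]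

/-- The Gauss-Kronecker curvature as a quotient of determinants, the form in which it is
differentiated. -/
theorem coDet_eq (F : ESp d → ESp (d + 1)) (x : ESp d) :
    coDet F x = (secondMatrix F x).det / (coMetric F x).det := by
  rw [coDet, coWeingarten_eq', Matrix.det_mul, Matrix.det_transpose, coMetricInv,
    Matrix.det_nonsing_inv, Ring.inverse_eq_inv', div_eq_inv_mul]

theorem adjugate_coMetric {F : ESp d → ESp (d + 1)} {x : ESp d} (h : (coMetric F x).det ≠ 0) :
    (coMetric F x).adjugate = (coMetric F x).det • coMetricInv F x := by
  rw [coMetricInv, Matrix.inv_def, Ring.inverse_eq_inv', smul_smul, mul_inv_cancel₀ h, one_smul]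

variable {F : ℝ → ESp d → ESp (d + 1)} {q : ℝ} {x : ESp d} {m : ESp d → ESp (d + 1)}

theorem hasDerivAt_coMetric (hF : SmAt F q x) (hm : ∀ y, m y = deriv (fun r => F r y) q)
    (i j : Fin d) :
    HasDerivAt (fun t => coMetric (F t) x i j) (varMetric (F q) m x i j) q := by
  obtain rfl : m = fun y => deriv (fun r => F r y) q := funext hm
  refine (hasDerivAt_inner (deriv_pd_comm hF i) (deriv_pd_comm hF j)).congr_deriv ?_
  simp only [varMetric, Matrix.of_apply]
  rw [add_comm, real_inner_comm (pd i (F q) x)]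

/-- The derivative of `⟨∂ᵢ∂ⱼF, ν⟩` contains the derivative `μ` of the normal. It is tangential,
because `ν` has unit length, and `⟨μ, ∂ₖF⟩ = -⟨ν, ∂ₖm⟩`; with the Gauss formula the term
`⟨∂ᵢ∂ⱼF, μ⟩` becomes the Christoffel term of `varSecond`. -/
theorem hasDerivAt_coSecond (hF : ∀ᶠ z in 𝓝 (q, x), SmAt F z.1 z.2) (h : (coMetric (F q) x).det ≠ 0)
    (hm : ∀ y, m y = deriv (fun r => F r y) q) (i j : Fin d) :
    HasDerivAt (fun t => coSecond (F t) x i j) (varSecond (F q) m x i j) q := by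
  obtain rfl : m = fun y => deriv (fun r => F r y) q := funext hm
  have hq : SmAt F q x := hF.self_of_nhds
  have hF' : ∀ᶠ t in 𝓝 q, SmAt F t x := (Continuous.prodMk_left x).continuousAt.eventually hF
  have hne : ∀ᶠ t in 𝓝 q, (coMetric (F t) x).det ≠ 0 :=
    hq.det_coMetric.param.continuousAt.eventually_ne h
  have hν : HasDerivAt (fun t => coNormal (F t) x) (deriv (fun t => coNormal (F t) x) q) q :=
    (ContDiffAt.differentiableAt_infty (f := fun t => coNormal (F t) x)
      (hq.coNormal (coCross_ne_zero h)).param).hasDerivAt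
  have hFij : HasDerivAt (fun t => pd i (pd j (F t)) x)
      (pd i (pd j fun y => deriv (fun r => F r y) q) x) q := by
    have hFy : ∀ᶠ y in 𝓝 x, SmAt F q y := (Continuous.prodMk_right q).continuousAt.eventually hF
    refine (deriv_pd_comm (hq.pd j) i).congr_deriv (pd_congr i ?_)
    exact hFy.mono fun y hy => (deriv_pd_comm hy j).deriv
  have hc : HasDerivAt (fun t => coSecond (F t) x i j)
      (inner ℝ (pd i (pd j (F q)) x) (deriv (fun t => coNormal (F t) x) q)
        + inner ℝ (pd i (pd j fun y => deriv (fun r => F r y) q) x) (coNormal (F q) x)) q :=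
    (hasDerivAt_inner hFij hν).congr_of_eventuallyEq
      ((hF'.and hne).mono fun t ht => coSecond_eq ht.1.slice ht.2 i j)
  convert hc using 1
  have hν0 : (inner ℝ (deriv (fun t => coNormal (F t) x) q) (coNormal (F q) x) : ℝ) = 0 := by
    have h1 := hasDerivAt_inner hν hν
    have h2 : (fun t => (inner ℝ (coNormal (F t) x) (coNormal (F t) x) : ℝ)) =ᶠ[𝓝 q] fun _ => 1 :=
      hne.mono fun t ht => inner_coNormal_self ht
    have h3 := (h1.congr_of_eventuallyEq h2.symm).unique (hasDerivAt_const q 1)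
    rw [real_inner_comm (coNormal (F q) x)] at h3
    rw [real_inner_comm]
    linarith
  rw [inner_pd_pd_of_orthogonal hq.slice h hν0]
  simp only [varSecond, Matrix.of_apply]
  have hk : ∀ k, (inner ℝ (deriv (fun t => coNormal (F t) x) q) (pd k (F q) x) : ℝ)
      = - inner ℝ (pd k (fun y => deriv (fun r => F r y) q) x) (coNormal (F q) x) := by
    intro k
    have h1 := hasDerivAt_inner hν (deriv_pd_comm hq k)
    have h2 : (fun t => (inner ℝ (coNormal (F t) x) (pd k (F t) x) : ℝ)) = fun _ => 0 := by
      ext t; exact inner_coNormal_pd k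
    rw [h2] at h1
    have h3 := h1.unique (hasDerivAt_const q 0)
    rw [real_inner_comm (coNormal (F q) x)]
    linarith
  simp only [hk, mul_neg, Finset.sum_neg_distrib]
  ring

theorem hasDerivAt_det_coMetric (hF : SmAt F q x) (h : (coMetric (F q) x).det ≠ 0)
    (hm : ∀ y, m y = deriv (fun r => F r y) q) :
    HasDerivAt (fun t => (coMetric (F t) x).det)
      ((coMetric (F q) x).det * (coMetricInv (F q) x * varMetric (F q) m x).trace) q := by
  convert hasDerivAt_matrix_det fun i j => hasDerivAt_coMetric hF hm i j using 1
  rw [adjugate_coMetric h, Matrix.smul_mul, Matrix.trace_smul, smul_eq_mul]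

theorem hasDerivAt_coDet (hF : ∀ᶠ z in 𝓝 (q, x), SmAt F z.1 z.2) (h : (coMetric (F q) x).det ≠ 0)
    (hm : ∀ y, m y = deriv (fun r => F r y) q) :
    HasDerivAt (fun t => coDet (F t) x) (varDet (F q) m x) q := by
  have h1 := hasDerivAt_matrix_det (A := fun t => secondMatrix (F t) x)
    fun i j => hasDerivAt_coSecond hF h hm i j
  have h2 := h1.div (hasDerivAt_det_coMetric hF.self_of_nhds h hm) h
  simp only [coDet_eq]
  refine h2.congr_deriv ?_
  simp only [varDet]
  field_simp

theorem hasDerivAt_coVolDensity (hF : SmAt F q x) (h : (coMetric (F q) x).det ≠ 0)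
    (hm : ∀ y, m y = deriv (fun r => F r y) q) :
    HasDerivAt (fun t => coVolDensity (F t) x) (coVolDensity (F q) x * varVol (F q) m x) q := by
  refine ((hasDerivAt_det_coMetric hF h hm).sqrt h).congr_deriv ?_
  have h1 : √ (coMetric (F q) x).det * √ (coMetric (F q) x).det = (coMetric (F q) x).det :=
    Real.mul_self_sqrt det_coMetric_nonneg
  have h2 := coVolDensity_pos h
  rw [coVolDensity] at h2 ⊢
  rw [varVol]
  field_simp
  rw [sq, h1, mul_comm]

end Variation


/-! ### Normal and tangential variations -/

section Leibniz

variable {d : ℕ} {F : ESp d → ESp (d + 1)} {x : ESp d}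

theorem varMetric_congr {m m' : ESp d → ESp (d + 1)} (h : m =ᶠ[𝓝 x] m') :
    varMetric F m x = varMetric F m' x := by
  ext i j
  simp only [varMetric, Matrix.of_apply, pd_congr _ h]

theorem varSecond_congr {m m' : ESp d → ESp (d + 1)} (h : m =ᶠ[𝓝 x] m') :
    varSecond F m x = varSecond F m' x := by
  ext i j
  simp only [varSecond, Matrix.of_apply, pd_congr _ h, pd_congr _ (pd_eventuallyEq _ h)]

theorem varDet_congr {m m' : ESp d → ESp (d + 1)} (h : m =ᶠ[𝓝 x] m') :
    varDet F m x = varDet F m' x := by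
  simp only [varDet, varMetric_congr h, varSecond_congr h]

theorem varVol_congr {m m' : ESp d → ESp (d + 1)} (h : m =ᶠ[𝓝 x] m') :
    varVol F m x = varVol F m' x := by
  simp only [varVol, varMetric_congr h]

theorem varMetric_add {m n : ESp d → ESp (d + 1)} (hm : ContDiffAt ℝ ∞ m x)
    (hn : ContDiffAt ℝ ∞ n x) :
    varMetric F (fun y => m y + n y) x = varMetric F m x + varMetric F n x := by
  ext i j
  simp only [varMetric, Matrix.of_apply, Matrix.add_apply,
    pd_add _ (ContDiffAt.differentiableAt_infty hm) (ContDiffAt.differentiableAt_infty hn),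
    inner_add_left]
  ring

theorem pd_pd_add {W : Type*} [NormedAddCommGroup W] [NormedSpace ℝ W] {m n : ESp d → W}
    (hm : ContDiffAt ℝ ∞ m x) (hn : ContDiffAt ℝ ∞ n x) (i j : Fin d) :
    pd i (pd j fun y => m y + n y) x = pd i (pd j m) x + pd i (pd j n) x := by
  rw [← pd_add i (ContDiffAt.differentiableAt_infty (ContDiffAt.pd hm j))
    (ContDiffAt.differentiableAt_infty (ContDiffAt.pd hn j))]
  refine pd_congr i ?_
  filter_upwards [eventually_differentiableAt hm, eventually_differentiableAt hn] with y h1 h2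
  exact pd_add j h1 h2

theorem pd_pd_smul {W : Type*} [NormedAddCommGroup W] [NormedSpace ℝ W] {u : ESp d → ℝ}
    {v : ESp d → W} (hu : ContDiffAt ℝ ∞ u x) (hv : ContDiffAt ℝ ∞ v x) (i j : Fin d) :
    pd i (pd j fun y => u y • v y) x
      = u x • pd i (pd j v) x + pd i u x • pd j v x + (pd j u x • pd i v x + pd i (pd j u) x • v x) := by
  have h : pd i (pd j fun y => u y • v y) x = pd i (fun y => u y • pd j v y + pd j u y • v y) x := by
    refine pd_congr i ?_
    filter_upwards [eventually_differentiableAt hu, eventually_differentiableAt hv] with y h1 h2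
    exact pd_smul j h1 h2
  have hu1 := ContDiffAt.differentiableAt_infty hu
  have hv1 := ContDiffAt.differentiableAt_infty hv
  have hu2 := ContDiffAt.differentiableAt_infty (ContDiffAt.pd hu j)
  have hv2 := ContDiffAt.differentiableAt_infty (ContDiffAt.pd hv j)
  rw [h, pd_add i (hu1.fun_smul hv2) (hu2.fun_smul hv1), pd_smul i hu1 hv2, pd_smul i hu2 hv1]

theorem varSecond_add {m n : ESp d → ESp (d + 1)} (hm : ContDiffAt ℝ ∞ m x)
    (hn : ContDiffAt ℝ ∞ n x) :
    varSecond F (fun y => m y + n y) x = varSecond F m x + varSecond F n x := by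
  ext i j
  simp only [varSecond, Matrix.of_apply, Matrix.add_apply, pd_pd_add hm hn,
    pd_add _ (ContDiffAt.differentiableAt_infty hm) (ContDiffAt.differentiableAt_infty hn),
    inner_add_left, mul_add, Finset.sum_add_distrib]
  ring

theorem varMetric_sum {ι : Type*} (s : Finset ι) {m : ι → ESp d → ESp (d + 1)}
    (hm : ∀ k ∈ s, ContDiffAt ℝ ∞ (m k) x) :
    varMetric F (fun y => ∑ k ∈ s, m k y) x = ∑ k ∈ s, varMetric F (m k) x := by
  classical
  induction s using Finset.induction_on with
  | empty =>
    ext i j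
    simp [varMetric, pd_const]
  | insert a s ha ih =>
    simp only [Finset.sum_insert ha]
    rw [varMetric_add (hm a (Finset.mem_insert_self a s))
      (ContDiffAt.sum fun k hk => hm k (Finset.mem_insert_of_mem hk)),
      ih fun k hk => hm k (Finset.mem_insert_of_mem hk)]

theorem varSecond_sum {ι : Type*} (s : Finset ι) {m : ι → ESp d → ESp (d + 1)}
    (hm : ∀ k ∈ s, ContDiffAt ℝ ∞ (m k) x) :
    varSecond F (fun y => ∑ k ∈ s, m k y) x = ∑ k ∈ s, varSecond F (m k) x := by
  classical
  induction s using Finset.induction_on with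
  | empty =>
    ext i j
    have : pd j (fun _ : ESp d => (0 : ESp (d + 1))) = fun _ => 0 := by ext1 y; exact pd_const j 0
    simp [varSecond, this, pd_const]
  | insert a s ha ih =>
    simp only [Finset.sum_insert ha]
    rw [varSecond_add (hm a (Finset.mem_insert_self a s))
      (ContDiffAt.sum fun k hk => hm k (Finset.mem_insert_of_mem hk)),
      ih fun k hk => hm k (Finset.mem_insert_of_mem hk)]

theorem varMetric_smul {u : ESp d → ℝ} {v : ESp d → ESp (d + 1)} (hu : ContDiffAt ℝ ∞ u x)
    (hv : ContDiffAt ℝ ∞ v x) (i j : Fin d) :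
    varMetric F (fun y => u y • v y) x i j = u x * varMetric F v x i j
      + (pd i u x * inner ℝ (v x) (pd j F x) + pd j u x * inner ℝ (v x) (pd i F x)) := by
  simp only [varMetric, Matrix.of_apply, pd_smul _ (ContDiffAt.differentiableAt_infty hu)
    (ContDiffAt.differentiableAt_infty hv), inner_add_left, real_inner_smul_left]
  ring

theorem varSecond_smul {u : ESp d → ℝ} {v : ESp d → ESp (d + 1)} (hu : ContDiffAt ℝ ∞ u x)
    (hv : ContDiffAt ℝ ∞ v x) (i j : Fin d) :
    varSecond F (fun y => u y • v y) x i j = u x * varSecond F v x i j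
      + (pd i u x * inner ℝ (pd j v x) (coNormal F x) + pd j u x * inner ℝ (pd i v x) (coNormal F x))
      + inner ℝ (v x) (coNormal F x) * coHess F u x i j := by
  simp only [varSecond, coHess, Matrix.of_apply, pd_smul _ (ContDiffAt.differentiableAt_infty hu)
    (ContDiffAt.differentiableAt_infty hv), pd_pd_smul hu hv, inner_add_left, real_inner_smul_left,
    mul_add, mul_sub, Finset.sum_add_distrib, Finset.mul_sum]
  have e1 : ∀ k, coChristoffel F x k i j * (u x * inner ℝ (pd k v x) (coNormal F x))
    = u x * (coChristoffel F x k i j * inner ℝ (pd k v x) (coNormal F x)) := fun k => by ring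
  have e2 : ∀ k, coChristoffel F x k i j * (pd k u x * inner ℝ (v x) (coNormal F x))
    = inner ℝ (v x) (coNormal F x) * (coChristoffel F x k i j * pd k u x) := fun k => by ring
  simp only [e1, e2]
  ring

theorem contDiffAt_coTan {m : ESp d → ESp (d + 1)} (hF : ContDiffAt ℝ ∞ F x)
    (h : (coMetric F x).det ≠ 0) (hm : ContDiffAt ℝ ∞ m x) (l : Fin d) :
    ContDiffAt ℝ ∞ (fun y => coTan F m y l) x :=
  ((SmAt.of_slice ℝ 0 hF).coTan (SmAt.of_slice ℝ 0 hm) h l).slice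

theorem contDiffAt_inner_coNormal {m : ESp d → ESp (d + 1)} (hF : ContDiffAt ℝ ∞ F x)
    (h : (coMetric F x).det ≠ 0) (hm : ContDiffAt ℝ ∞ m x) :
    ContDiffAt ℝ ∞ (fun y => (inner ℝ (m y) (coNormal F y) : ℝ)) x :=
  hm.inner ℝ (ContDiffAt.coNormal hF h)

variable {m : ESp d → ESp (d + 1)}

theorem eventually_eq_normal_add_tangent (hF : ContDiffAt ℝ ∞ F x) (h : (coMetric F x).det ≠ 0)
    (m : ESp d → ESp (d + 1)) :
    m =ᶠ[𝓝 x] fun y => (inner ℝ (m y) (coNormal F y) : ℝ) • coNormal F y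
      + ∑ l, coTan F m y l • pd l F y :=
  (eventually_det_coMetric_ne_zero hF h).mono fun y hy => eq_normal_add_tangent hy (m y)

theorem varMetric_coNormal (i j : Fin d) (hF : ContDiffAt ℝ ∞ F x) (h : (coMetric F x).det ≠ 0) :
    varMetric F (coNormal F) x i j = - 2 * coSecond F x i j := by
  have h1 := coSecond_symm hF h i j
  simp only [coSecond] at h1
  simp only [varMetric, Matrix.of_apply, coSecond]
  linarith

/-- Differentiating `⟨∂ⱼν, ν⟩ = 0` reduces the normal component of `∂ᵢ∂ⱼν` to `-⟨∂ⱼν, ∂ᵢν⟩`,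
which is expressed through the Weingarten equation. -/
theorem varSecond_coNormal (i j : Fin d) (hF : ContDiffAt ℝ ∞ F x) (h : (coMetric F x).det ≠ 0) :
    varSecond F (coNormal F) x i j
      = - (secondMatrix F x * coMetricInv F x * secondMatrix F x) i j := by
  have h0 : ∀ k, (inner ℝ (pd k (coNormal F) x) (coNormal F x) : ℝ) = 0 := fun k => by
    rw [real_inner_comm]; exact inner_coNormal_pd_coNormal hF h k
  simp only [varSecond, Matrix.of_apply, h0, mul_zero, Finset.sum_const_zero, sub_zero]
  have hν := ContDiffAt.coNormal hF h
  have h1 := pd_inner i (ContDiffAt.differentiableAt_infty (ContDiffAt.pd hν j))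
    (ContDiffAt.differentiableAt_infty hν)
  have h2 : (fun y => (inner ℝ (pd j (coNormal F) y) (coNormal F y) : ℝ)) =ᶠ[𝓝 x] fun _ => 0 := by
    have : ∀ᶠ y in 𝓝 x, (inner ℝ (coNormal F y) (coNormal F y) : ℝ) = 1 :=
      (eventually_det_coMetric_ne_zero hF h).mono fun y hy => inner_coNormal_self hy
    filter_upwards [this.eventually_nhds, eventually_differentiableAt hν] with y hy hd
    have h3 := pd_inner j hd hd
    have h4 : (fun y => (inner ℝ (coNormal F y) (coNormal F y) : ℝ)) =ᶠ[𝓝 y] fun _ => 1 := hy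
    rw [pd_congr j h4, pd_const, real_inner_comm (pd j (coNormal F) y)] at h3
    linarith
  rw [pd_congr i h2, pd_const] at h1
  have h5 : (inner ℝ (pd i (pd j (coNormal F)) x) (coNormal F x) : ℝ)
      = - inner ℝ (pd j (coNormal F) x) (pd i (coNormal F) x) := by linarith
  rw [h5, inner_eq_normal_add_tangent h, h0, zero_mul, zero_add]
  congr 1
  simp only [Matrix.mul_apply, Finset.sum_mul, secondMatrix, Matrix.of_apply]
  rw [Finset.sum_comm]
  refine Finset.sum_congr rfl fun a _ => Finset.sum_congr rfl fun b _ => ?_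
  rw [coSecond_symm hF h a j, coMetricInv_symm]
  simp only [coSecond]
  ring

/-- The matrix `∂ᵢX^l` of the derivatives of the tangential part. -/
noncomputable def tanDeriv (F m : ESp d → ESp (d + 1)) (x : ESp d) : Matrix (Fin d) (Fin d) ℝ :=
  Matrix.of fun i l => pd i (fun y => coTan F m y l) x

/-- The first variation of the metric for `m = a ν + X^l ∂_l F`: a Lie derivative along `X`, and
`-2 a s` from the normal part. -/
theorem varMetric_eq (hF : ContDiffAt ℝ ∞ F x) (h : (coMetric F x).det ≠ 0)
    (hm : ContDiffAt ℝ ∞ m x) :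
    varMetric F m x = ∑ l, coTan F m x l • varMetric F (pd l F) x
      + (tanDeriv F m x * coMetric F x + coMetric F x * (tanDeriv F m x).transpose)
      - (2 * inner ℝ (m x) (coNormal F x) : ℝ) • secondMatrix F x := by
  have hν := ContDiffAt.coNormal hF h
  have ha := contDiffAt_inner_coNormal hF h hm
  have hX := contDiffAt_coTan hF h hm
  have hs : ContDiffAt ℝ ∞ (fun y => (inner ℝ (m y) (coNormal F y) : ℝ) • coNormal F y) x :=
    ha.smul hν
  have hsX : ∀ l ∈ Finset.univ, ContDiffAt ℝ ∞ (fun y => coTan F m y l • pd l F y) x :=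
    fun l _ => (hX l).smul (ContDiffAt.pd hF l)
  rw [varMetric_congr (eventually_eq_normal_add_tangent hF h m), varMetric_add hs
    (ContDiffAt.sum hsX), varMetric_sum _ hsX]
  ext i j
  simp only [Matrix.add_apply, Matrix.sub_apply, Matrix.smul_apply, Matrix.sum_apply,
    varMetric_smul ha hν, varMetric_smul (hX _) (ContDiffAt.pd hF _), inner_coNormal_pd,
    varMetric_coNormal i j hF h, Finset.sum_add_distrib, smul_eq_mul, Matrix.mul_apply,
    Matrix.transpose_apply, tanDeriv, secondMatrix, Matrix.of_apply]
  have e : ∀ l, pd j (fun y => coTan F m y l) x * inner ℝ (pd l F x) (pd i F x)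
      = coMetric F x i l * pd j (fun y => coTan F m y l) x := fun l => by
    rw [mul_comm, real_inner_comm]; rfl
  simp only [e]
  simp only [coMetric, Matrix.of_apply]
  ring

/-- The first variation of the second fundamental form for `m = a ν + X^l ∂_l F`: a Lie
derivative along `X`, and `∇²a - a s g⁻¹ s` from the normal part. -/
theorem varSecond_eq (hF : ContDiffAt ℝ ∞ F x) (h : (coMetric F x).det ≠ 0)
    (hm : ContDiffAt ℝ ∞ m x) :
    varSecond F m x = ∑ l, coTan F m x l • varSecond F (pd l F) x
      + (tanDeriv F m x * secondMatrix F x + secondMatrix F x * (tanDeriv F m x).transpose)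
      + (coHess F (fun y => inner ℝ (m y) (coNormal F y)) x
        - (inner ℝ (m x) (coNormal F x) : ℝ) •
          (secondMatrix F x * coMetricInv F x * secondMatrix F x)) := by
  have hν := ContDiffAt.coNormal hF h
  have ha := contDiffAt_inner_coNormal hF h hm
  have hX := contDiffAt_coTan hF h hm
  have h0 : ∀ k, (inner ℝ (pd k (coNormal F) x) (coNormal F x) : ℝ) = 0 := fun k => by
    rw [real_inner_comm]; exact inner_coNormal_pd_coNormal hF h k
  have hs : ContDiffAt ℝ ∞ (fun y => (inner ℝ (m y) (coNormal F y) : ℝ) • coNormal F y) x :=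
    ha.smul hν
  have hsX : ∀ l ∈ Finset.univ, ContDiffAt ℝ ∞ (fun y => coTan F m y l • pd l F y) x :=
    fun l _ => (hX l).smul (ContDiffAt.pd hF l)
  rw [varSecond_congr (eventually_eq_normal_add_tangent hF h m), varSecond_add hs
    (ContDiffAt.sum hsX), varSecond_sum _ hsX]
  ext i j
  simp only [Matrix.add_apply, Matrix.sub_apply, Matrix.smul_apply, Matrix.sum_apply,
    varSecond_smul ha hν, varSecond_smul (hX _) (ContDiffAt.pd hF _), inner_pd_coNormal,
    varSecond_coNormal i j hF h, h0, inner_coNormal_self h, Finset.sum_add_distrib, smul_eq_mul,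
    ← coSecond_eq hF h]
  rw [Matrix.mul_apply (M := tanDeriv F m x), Matrix.mul_apply (N := (tanDeriv F m x).transpose)]
  simp only [Matrix.transpose_apply, tanDeriv, Matrix.of_apply]
  have e1 : ∀ l, pd j (fun y => coTan F m y l) x * coSecond F x i l
      = secondMatrix F x i l * pd j (fun y => coTan F m y l) x := fun l => mul_comm _ _
  have e2 : ∀ l, pd i (fun y => coTan F m y l) x * coSecond F x j l
      = pd i (fun y => coTan F m y l) x * secondMatrix F x l j := fun l => by
    rw [coSecond_symm hF h]; rfl
  simp only [e1, e2, zero_mul, Finset.sum_const_zero]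
  ring

/-- `g.C(L)` in terms of the adjugate of the second fundamental form; unlike `L`, it is
manifestly symmetric. -/
theorem coMetricAdj_eq (hF : ContDiffAt ℝ ∞ F x) (h : (coMetric F x).det ≠ 0) :
    coMetricAdj F x = ((coMetric F x).det)⁻¹ •
      (coMetric F x * (secondMatrix F x).adjugate * coMetric F x) := by
  have h1 : (coMetricInv F x).adjugate = ((coMetric F x).det)⁻¹ • coMetric F x := by
    have h2 := Matrix.adjugate_mul (coMetricInv F x)
    have h3 : (coMetricInv F x).det = ((coMetric F x).det)⁻¹ := by
      rw [coMetricInv, Matrix.det_nonsing_inv, Ring.inverse_eq_inv']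
    calc (coMetricInv F x).adjugate
        = (coMetricInv F x).adjugate * (coMetricInv F x * coMetric F x) := by
          rw [coMetricInv_mul h, mul_one]
      _ = _ := by rw [← mul_assoc, h2, h3, Matrix.smul_mul, one_mul]
  rw [coMetricAdj, coWeingarten_eq hF h, Matrix.adjugate_mul_distrib, h1, Matrix.mul_smul,
    Matrix.mul_smul, mul_assoc]

theorem coPairing_eq_trace (B H : Matrix (Fin d) (Fin d) ℝ) :
    coPairing F x B H = ((coMetricInv F x * B * coMetricInv F x).transpose * H).trace := by
  simp only [coPairing, Matrix.trace, Matrix.diag, Matrix.mul_apply, Matrix.transpose_apply,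
    Finset.sum_mul]
  have e : ∀ i j k l, coMetricInv F x i k * coMetricInv F x j l * B i j * H k l
      = coMetricInv F x k i * B i j * coMetricInv F x j l * H k l := fun i j k l => by
    rw [coMetricInv_symm i k]; ring
  simp only [e]
  -- reorder the summation from `i, j, k, l` to `l, k, j, i`
  calc _ = ∑ i, ∑ j, ∑ l, ∑ k, coMetricInv F x k i * B i j * coMetricInv F x j l * H k l :=
        Finset.sum_congr rfl fun i _ => Finset.sum_congr rfl fun j _ => Finset.sum_comm
    _ = ∑ i, ∑ l, ∑ j, ∑ k, coMetricInv F x k i * B i j * coMetricInv F x j l * H k l :=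
        Finset.sum_congr rfl fun i _ => Finset.sum_comm
    _ = ∑ l, ∑ i, ∑ j, ∑ k, coMetricInv F x k i * B i j * coMetricInv F x j l * H k l :=
        Finset.sum_comm
    _ = ∑ l, ∑ i, ∑ k, ∑ j, coMetricInv F x k i * B i j * coMetricInv F x j l * H k l :=
        Finset.sum_congr rfl fun l _ => Finset.sum_congr rfl fun i _ => Finset.sum_comm
    _ = ∑ l, ∑ k, ∑ i, ∑ j, coMetricInv F x k i * B i j * coMetricInv F x j l * H k l :=
        Finset.sum_congr rfl fun l _ => Finset.sum_comm
    _ = _ := Finset.sum_congr rfl fun l _ => Finset.sum_congr rfl fun k _ => Finset.sum_comm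

/-- The pairing of `g.C(L)` with `H` is the linear term in Jacobi's formula for
`det (s + t H) / det g`. -/
theorem coPairing_coMetricAdj (hF : ContDiffAt ℝ ∞ F x) (h : (coMetric F x).det ≠ 0)
    (H : Matrix (Fin d) (Fin d) ℝ) :
    coPairing F x (coMetricAdj F x) H
      = ((secondMatrix F x).adjugate * H).trace / (coMetric F x).det := by
  have h1 : coMetricInv F x * coMetricAdj F x * coMetricInv F x
      = ((coMetric F x).det)⁻¹ • (secondMatrix F x).adjugate := by
    rw [coMetricAdj_eq hF h, Matrix.mul_smul, Matrix.smul_mul]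
    congr 1
    calc _ = (coMetricInv F x * coMetric F x) * (secondMatrix F x).adjugate
          * (coMetric F x * coMetricInv F x) := by simp only [mul_assoc]
      _ = _ := by rw [coMetricInv_mul h, mul_coMetricInv h, one_mul, mul_one]
  rw [coPairing_eq_trace, h1, Matrix.transpose_smul, Matrix.adjugate_transpose,
    secondMatrix_transpose hF h, Matrix.smul_mul, Matrix.trace_smul, smul_eq_mul, div_eq_inv_mul]

/-- The first variation of the volume density in terms of the normal and tangential parts, before
the derivatives along the coordinate fields are identified. -/
theorem varVol_eq_sum (hF : ContDiffAt ℝ ∞ F x) (h : (coMetric F x).det ≠ 0)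
    (hm : ContDiffAt ℝ ∞ m x) :
    varVol F m x = ∑ l, coTan F m x l * varVol F (pd l F) x + (tanDeriv F m x).trace
      - inner ℝ (m x) (coNormal F x) * (coWeingarten F x).trace := by
  rw [varVol, varMetric_eq hF h hm, Matrix.mul_sub, Matrix.mul_add, Matrix.mul_add,
    Matrix.trace_sub, Matrix.trace_add, Matrix.trace_add, Matrix.mul_smul, Matrix.trace_smul,
    Matrix.mul_sum, Matrix.trace_sum, ← mul_assoc (coMetricInv F x) (coMetric F x),
    coMetricInv_mul h, one_mul, Matrix.trace_transpose,
    Matrix.trace_mul_comm (coMetricInv F x) (_ * _), mul_assoc, mul_coMetricInv h, mul_one,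
    ← coWeingarten_eq hF h]
  simp only [Matrix.mul_smul, Matrix.trace_smul, smul_eq_mul, varVol]
  rw [mul_sub, mul_add, Finset.mul_sum]
  have e : ∀ l, 1 / 2 * (coTan F m x l * (coMetricInv F x * varMetric F (pd l F) x).trace)
      = coTan F m x l * (1 / 2 * (coMetricInv F x * varMetric F (pd l F) x).trace) :=
    fun l => by ring
  simp only [e]
  ring

/-- The first variation of `det L` in terms of the normal and tangential parts, before the
derivatives along the coordinate fields are identified. The terms with `∂ᵢX^l` coming from
`det s` and `det g` cancel. -/
theorem varDet_eq_sum (hF : ContDiffAt ℝ ∞ F x) (h : (coMetric F x).det ≠ 0)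
    (hm : ContDiffAt ℝ ∞ m x) :
    varDet F m x = ∑ l, coTan F m x l * varDet F (pd l F) x
      + coPairing F x (coMetricAdj F x) (coHess F (fun y => inner ℝ (m y) (coNormal F y)) x)
      + (coWeingarten F x).trace * coDet F x * inner ℝ (m x) (coNormal F x) := by
  set S := secondMatrix F x
  have t1 : (S.adjugate * (tanDeriv F m x * S)).trace = S.det * (tanDeriv F m x).trace := by
    rw [Matrix.trace_mul_comm, mul_assoc, Matrix.mul_adjugate, Matrix.mul_smul, mul_one,
      Matrix.trace_smul, smul_eq_mul]
  have t2 : (S.adjugate * (S * (tanDeriv F m x).transpose)).trace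
      = S.det * (tanDeriv F m x).trace := by
    rw [← mul_assoc, Matrix.adjugate_mul, Matrix.smul_mul, one_mul, Matrix.trace_smul,
      Matrix.trace_transpose, smul_eq_mul]
  have t3 : (S.adjugate * (S * coMetricInv F x * S)).trace
      = S.det * (coWeingarten F x).trace := by
    rw [mul_assoc, ← mul_assoc, Matrix.adjugate_mul, Matrix.smul_mul, one_mul, Matrix.trace_smul,
      smul_eq_mul, coWeingarten_eq hF h]
  have t4 : (coMetricInv F x * varMetric F m x).trace = 2 * varVol F m x := by rw [varVol]; ring
  have t5 : ∀ l, (coMetricInv F x * varMetric F (pd l F) x).trace = 2 * varVol F (pd l F) x :=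
    fun l => by rw [varVol]; ring
  have t6 : (S.adjugate * varSecond F m x).trace
      = ∑ l, coTan F m x l * (S.adjugate * varSecond F (pd l F) x).trace
        + 2 * (S.det * (tanDeriv F m x).trace)
        + ((S.adjugate * coHess F (fun y => inner ℝ (m y) (coNormal F y)) x).trace
          - inner ℝ (m x) (coNormal F x) * (S.det * (coWeingarten F x).trace)) := by
    rw [varSecond_eq hF h hm, Matrix.mul_add, Matrix.mul_add, Matrix.mul_add, Matrix.mul_sub,
      Matrix.trace_add, Matrix.trace_add, Matrix.trace_add, Matrix.trace_sub, t1, t2,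
      Matrix.mul_smul, Matrix.trace_smul, t3, Matrix.mul_sum, Matrix.trace_sum]
    simp only [Matrix.mul_smul, Matrix.trace_smul, smul_eq_mul]
    ring
  have t7 : ∑ l, coTan F m x l * varDet F (pd l F) x
      = (∑ l, coTan F m x l * (S.adjugate * varSecond F (pd l F) x).trace
        - S.det * (2 * ∑ l, coTan F m x l * varVol F (pd l F) x)) / (coMetric F x).det := by
    simp only [varDet, t5]
    rw [Finset.mul_sum, Finset.mul_sum, ← Finset.sum_sub_distrib, Finset.sum_div]
    exact Finset.sum_congr rfl fun l _ => by ring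
  rw [t7, varDet, t4, t6, varVol_eq_sum hF h hm, coPairing_coMetricAdj hF h, coDet_eq]
  field_simp
  ring

end Leibniz


/-! ### Derivatives along the coordinate fields -/

section Spatial

variable {d : ℕ} {F : ESp d → ESp (d + 1)} {x : ESp d}

theorem pd_translate {W : Type*} [NormedAddCommGroup W] [NormedSpace ℝ W] (u : ESp d → W)
    (c : ESp d) (i : Fin d) : pd i (fun y => u (y + c)) = fun y => pd i u (y + c) := by
  ext1 y
  simp only [pd, fderiv_comp_add_right]

theorem coMetric_translate (c : ESp d) (y : ESp d) :
    coMetric (fun y => F (y + c)) y = coMetric F (y + c) := by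
  simp only [coMetric, pd_translate]

theorem coNormal_translate (c : ESp d) :
    coNormal (fun y => F (y + c)) = fun y => coNormal F (y + c) := by
  ext1 y
  simp only [coNormal, coCross, pd_translate]

theorem coDet_translate (c : ESp d) (y : ESp d) :
    coDet (fun y => F (y + c)) y = coDet F (y + c) := by
  simp only [coDet, coWeingarten, coMetricInv, coSecond, coMetric_translate, coNormal_translate,
    pd_translate]

theorem coVolDensity_translate (c : ESp d) (y : ESp d) :
    coVolDensity (fun y => F (y + c)) y = coVolDensity F (y + c) := by
  simp only [coVolDensity, coMetric_translate]

theorem translate_smAt (l : Fin d) {r : ℝ} {y : ESp d}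
    (hF : ContDiffAt ℝ ∞ F (y + r • EuclideanSpace.single l 1)) :
    SmAt (fun r y => F (y + r • EuclideanSpace.single l 1)) r y :=
  ContDiffAt.comp (g := F) (f := fun z : ℝ × ESp d => z.2 + z.1 • EuclideanSpace.single l (1 : ℝ))
    (r, y) hF (contDiffAt_snd.add (contDiffAt_fst.smul contDiffAt_const))

theorem eventually_translate_smAt (hF : ∀ᶠ y in 𝓝 x, ContDiffAt ℝ ∞ F y) (l : Fin d) :
    ∀ᶠ z : ℝ × ESp d in 𝓝 (0, x),
      SmAt (fun r y => F (y + r • EuclideanSpace.single l 1)) z.1 z.2 := by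
  have hc : Continuous fun z : ℝ × ESp d => z.2 + z.1 • EuclideanSpace.single l (1 : ℝ) := by fun_prop
  have h0 : Filter.Tendsto (fun z : ℝ × ESp d => z.2 + z.1 • EuclideanSpace.single l (1 : ℝ))
      (𝓝 (0, x)) (𝓝 x) := by
    simpa using hc.tendsto ((0 : ℝ), x)
  exact (h0.eventually hF).mono fun z hz => translate_smAt l hz

/-- Together with the invariance of the geometric objects under translations of the chart, this
identifies spatial derivatives with variations along the coordinate fields. -/
theorem hasDerivAt_translate {W : Type*} [NormedAddCommGroup W] [NormedSpace ℝ W] {u : ESp d → W}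
    (hu : DifferentiableAt ℝ u x) (l : Fin d) :
    HasDerivAt (fun r : ℝ => u (x + r • EuclideanSpace.single l 1)) (pd l u x) 0 :=
  hu.hasFDerivAt.hasLineDerivAt _

theorem translate_velocity (hF : ContDiffAt ℝ ∞ F x) (l : Fin d) :
    (fun y => deriv (fun r : ℝ => F (y + r • EuclideanSpace.single l 1)) 0) =ᶠ[𝓝 x] pd l F :=
  (eventually_differentiableAt hF).mono fun _ hy => (hasDerivAt_translate hy l).deriv

theorem contDiffAt_coDet (hF : ContDiffAt ℝ ∞ F x) (h : (coMetric F x).det ≠ 0) :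
    ContDiffAt ℝ ∞ (coDet F) x :=
  contDiffAt_matrix_det fun i j =>
    ((SmAt.of_slice ℝ 0 hF).coWeingarten (coCross_ne_zero h) h i j).slice

theorem contDiffAt_coVolDensity (hF : ContDiffAt ℝ ∞ F x) (h : (coMetric F x).det ≠ 0) :
    ContDiffAt ℝ ∞ (coVolDensity F) x :=
  ((SmAt.of_slice ℝ 0 hF).coVolDensity h).slice

/-- The spatial derivative of `det L` is its first variation when `F` moves with velocity
`∂_l F`. -/
theorem pd_coDet (hF : ∀ᶠ y in 𝓝 x, ContDiffAt ℝ ∞ F y) (h : (coMetric F x).det ≠ 0) (l : Fin d) :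
    pd l (coDet F) x = varDet F (pd l F) x := by
  have h1 := hasDerivAt_coDet (F := fun r y => F (y + r • EuclideanSpace.single l (1 : ℝ)))
    (q := 0) (x := x) (eventually_translate_smAt hF l) (by simpa using h) (fun y => rfl)
  simp only [coDet_translate] at h1
  have h2 := hasDerivAt_translate
    (ContDiffAt.differentiableAt_infty (contDiffAt_coDet hF.self_of_nhds h)) l
  rw [h2.unique h1, varDet_congr (translate_velocity hF.self_of_nhds l)]
  simp

theorem pd_coVolDensity (hF : ContDiffAt ℝ ∞ F x) (h : (coMetric F x).det ≠ 0)
    (l : Fin d) : pd l (coVolDensity F) x = coVolDensity F x * varVol F (pd l F) x := by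
  have h1 := hasDerivAt_coVolDensity (F := fun r y => F (y + r • EuclideanSpace.single l (1 : ℝ)))
    (q := 0) (x := x) (translate_smAt l (by simpa using hF)) (by simpa using h) (fun y => rfl)
  simp only [coVolDensity_translate] at h1
  have h2 := hasDerivAt_translate
    (ContDiffAt.differentiableAt_infty (contDiffAt_coVolDensity hF h)) l
  rw [h2.unique h1, varVol_congr (translate_velocity hF l)]
  simp

/-- `∂_l log √det g = Γ^i_il`. -/
theorem varVol_pd (hF : ContDiffAt ℝ ∞ F x) (l : Fin d) :
    varVol F (pd l F) x = ∑ i, coChristoffel F x i i l := by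
  simp only [varVol, Matrix.trace, Matrix.diag, Matrix.mul_apply, varMetric, Matrix.of_apply,
    coChristoffel_eq hF]
  have e : ∑ i, ∑ k, coMetricInv F x i k * inner ℝ (pd i (pd l F) x) (pd k F x)
      = ∑ i, ∑ k, coMetricInv F x i k * inner ℝ (pd k (pd l F) x) (pd i F x) := by
    rw [Finset.sum_comm]
    exact Finset.sum_congr rfl fun i _ => Finset.sum_congr rfl fun k _ => by
      rw [coMetricInv_symm]
  simp only [mul_add, Finset.sum_add_distrib]
  rw [e]
  ring

variable {m : ESp d → ESp (d + 1)}

/-- The first variation of the volume form. -/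
theorem varVol_eq (hF : ContDiffAt ℝ ∞ F x) (h : (coMetric F x).det ≠ 0)
    (hm : ContDiffAt ℝ ∞ m x) :
    varVol F m x = coDiv F (coTan F m) x
      - (coWeingarten F x).trace * inner ℝ (m x) (coNormal F x) := by
  rw [varVol_eq_sum hF h hm, coDiv, Finset.sum_add_distrib]
  simp only [varVol_pd hF, Finset.mul_sum]
  rw [Finset.sum_comm]
  simp only [Matrix.trace, Matrix.diag, tanDeriv, Matrix.of_apply]
  have e : ∀ i l, coTan F m x l * coChristoffel F x i i l
    = coChristoffel F x i i l * coTan F m x l := fun i l => mul_comm _ _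
  simp only [e]
  rw [mul_comm (inner ℝ _ _)]
  ring

/-- The first variation of `det L`. -/
theorem varDet_eq (hF : ∀ᶠ y in 𝓝 x, ContDiffAt ℝ ∞ F y) (h : (coMetric F x).det ≠ 0)
    (hm : ContDiffAt ℝ ∞ m x) :
    varDet F m x = (coWeingarten F x).trace * coDet F x * inner ℝ (m x) (coNormal F x)
      + coPairing F x (coMetricAdj F x) (coHess F (fun y => inner ℝ (m y) (coNormal F y)) x)
      + ∑ l, coTan F m x l * pd l (coDet F) x := by
  rw [varDet_eq_sum hF.self_of_nhds h hm]
  simp only [pd_coDet hF h]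
  ring

/-! ### Divergence and adjoints in coordinates -/

/-- The inverse metric is parallel. -/
theorem pd_coMetricInv (hF : ContDiffAt ℝ ∞ F x) (h : (coMetric F x).det ≠ 0) (k i j : Fin d) :
    pd k (fun y => coMetricInv F y i j) x
      = - ∑ l, (coChristoffel F x i k l * coMetricInv F x l j
          + coChristoffel F x j k l * coMetricInv F x l i) := by
  set G := coMetric F x
  set Gi := coMetricInv F x with hGi
  set dG : Matrix (Fin d) (Fin d) ℝ := Matrix.of fun a b => pd k (fun y => coMetric F y a b) x
  set dI : Matrix (Fin d) (Fin d) ℝ := Matrix.of fun a b => pd k (fun y => coMetricInv F y a b) x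
  set Λ : Matrix (Fin d) (Fin d) ℝ := Matrix.of fun a b => inner ℝ (pd k (pd a F) x) (pd b F x)
  have h1 : G * dI + dG * Gi = 0 := by
    ext a b
    have e1 : pd k (fun y => (coMetric F y * coMetricInv F y) a b) x = (G * dI + dG * Gi) a b := by
      simp only [Matrix.mul_apply]
      rw [pd_sum k fun c _ => (ContDiffAt.differentiableAt_infty (ContDiffAt.coMetric hF a c)).fun_mul
        (ContDiffAt.differentiableAt_infty (ContDiffAt.coMetricInv hF h c b))]
      simp only [Matrix.add_apply, Matrix.mul_apply]
      rw [← Finset.sum_add_distrib]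
      refine Finset.sum_congr rfl fun c _ => ?_
      exact pd_mul k (ContDiffAt.differentiableAt_infty (ContDiffAt.coMetric hF a c))
        (ContDiffAt.differentiableAt_infty (ContDiffAt.coMetricInv hF h c b))
    rw [← e1]
    have e2 : (fun y => (coMetric F y * coMetricInv F y) a b) =ᶠ[𝓝 x]
        fun _ => (1 : Matrix (Fin d) (Fin d) ℝ) a b :=
      (eventually_det_coMetric_ne_zero hF h).mono fun y hy => by
        simp only [mul_coMetricInv hy]
    rw [pd_congr k e2, pd_const]; rfl
  have h2 : dG = Λ + Λ.transpose := by
    ext a b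
    exact pd_coMetric hF k a b
  have h3 : dI = - (Gi * Λ.transpose * Gi + Gi * Λ * Gi) := by
    have : dI = Gi * (G * dI) := by rw [← mul_assoc, coMetricInv_mul h, one_mul]
    rw [this, eq_neg_of_add_eq_zero_left h1, h2]
    noncomm_ring
  have h4 : ∀ a b, ∑ l, coChristoffel F x a k l * Gi l b = (Gi * Λ.transpose * Gi) a b := by
    intro a b
    simp only [Matrix.mul_apply, coChristoffel_eq hF]
    rfl
  have h5 : (Gi * Λ.transpose * Gi) j i = (Gi * Λ * Gi) i j := by
    rw [← Matrix.transpose_apply (Gi * Λ * Gi)]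
    simp only [Matrix.transpose_mul, hGi, coMetricInv_transpose, mul_assoc]
  rw [Finset.sum_add_distrib, h4, h4, h5]
  change dI i j = _
  rw [h3]
  rfl

theorem coDiv_smul {u : ESp d → ℝ} {X : ESp d → Fin d → ℝ} (hu : DifferentiableAt ℝ u x)
    (hX : ∀ i, DifferentiableAt ℝ (fun y => X y i) x) :
    coDiv F (fun y i => u y * X y i) x = u x * coDiv F X x + ∑ i, X x i * pd i u x := by
  simp only [coDiv, pd_mul _ hu (hX _), Finset.mul_sum, mul_add, Finset.sum_add_distrib]
  have e1 : ∀ i j, coChristoffel F x i i j * (u x * X x j)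
    = u x * (coChristoffel F x i i j * X x j) := fun i j => by ring
  have e2 : ∀ i, pd i u x * X x i = X x i * pd i u x := fun i => by ring
  simp only [e1, e2]
  ring

theorem coDiv_add {X Y : ESp d → Fin d → ℝ} (hX : ∀ i, DifferentiableAt ℝ (fun y => X y i) x)
    (hY : ∀ i, DifferentiableAt ℝ (fun y => Y y i) x) :
    coDiv F (fun y i => X y i + Y y i) x = coDiv F X x + coDiv F Y x := by
  simp only [coDiv, pd_add _ (hX _) (hY _), mul_add, Finset.sum_add_distrib]
  ring

/-- The vector field `θ♯` with components `g^ij θ_j`. -/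
noncomputable def coSharp (F : ESp d → ESp (d + 1)) (θ : ESp d → Fin d → ℝ) (x : ESp d) (i : Fin d) :
    ℝ := ∑ j, coMetricInv F x i j * θ x j

theorem contDiffAt_coSharp (hF : ContDiffAt ℝ ∞ F x) (h : (coMetric F x).det ≠ 0)
    {θ : ESp d → Fin d → ℝ} (hθ : ∀ i, ContDiffAt ℝ ∞ (fun y => θ y i) x) (i : Fin d) :
    ContDiffAt ℝ ∞ (fun y => coSharp F θ y i) x :=
  ContDiffAt.sum fun j _ => (ContDiffAt.coMetricInv hF h i j).mul (hθ j)

/-- The musical isomorphism commutes with covariant differentiation. -/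
theorem pd_coSharp (hF : ContDiffAt ℝ ∞ F x) (h : (coMetric F x).det ≠ 0)
    {θ : ESp d → Fin d → ℝ} (hθ : ∀ i, ContDiffAt ℝ ∞ (fun y => θ y i) x) (k i : Fin d) :
    pd k (fun y => coSharp F θ y i) x + ∑ l, coChristoffel F x i k l * coSharp F θ x l
      = ∑ j, coMetricInv F x i j * coCov₁ F θ x k j := by
  have hd : ∀ j, DifferentiableAt ℝ (fun y => coMetricInv F y i j) x :=
    fun j => ContDiffAt.differentiableAt_infty (ContDiffAt.coMetricInv hF h i j)
  have hd' : ∀ j, DifferentiableAt ℝ (fun y => θ y j) x :=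
    fun j => ContDiffAt.differentiableAt_infty (hθ j)
  simp only [coSharp]
  rw [pd_sum k fun j _ => (hd j).fun_mul (hd' j)]
  simp only [pd_mul k (hd _) (hd' _), pd_coMetricInv hF h, coCov₁, mul_sub, neg_mul,
    Finset.sum_add_distrib, Finset.sum_sub_distrib, Finset.sum_neg_distrib, Finset.mul_sum,
    Finset.sum_mul, add_mul]
  have e1 : ∑ j, ∑ l, coChristoffel F x i k l * coMetricInv F x l j * θ x j
      = ∑ l, ∑ j, coChristoffel F x i k l * (coMetricInv F x l j * θ x j) := by
    rw [Finset.sum_comm]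
    exact Finset.sum_congr rfl fun _ _ => Finset.sum_congr rfl fun _ _ => by ring
  have e2 : ∑ j, ∑ l, coChristoffel F x j k l * coMetricInv F x l i * θ x j
      = ∑ l, ∑ j, coMetricInv F x i l * (coChristoffel F x j k l * θ x j) := by
    rw [Finset.sum_comm]
    exact Finset.sum_congr rfl fun l _ => Finset.sum_congr rfl fun j _ => by
      rw [coMetricInv_symm l i]; ring
  rw [e1, e2]
  ring

theorem coDiv_coSharp (hF : ContDiffAt ℝ ∞ F x) (h : (coMetric F x).det ≠ 0)
    {θ : ESp d → Fin d → ℝ} (hθ : ∀ i, ContDiffAt ℝ ∞ (fun y => θ y i) x) :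
    coDiv F (coSharp F θ) x = - coAdj₁ F θ x := by
  rw [coAdj₁, neg_neg, coDiv]
  exact Finset.sum_congr rfl fun i _ => pd_coSharp hF h hθ i i

/-- The contraction `B_ij Y^j` of a `(0,2)`-tensor with a vector field. -/
noncomputable def coContract (B : ESp d → Matrix (Fin d) (Fin d) ℝ) (Y : ESp d → Fin d → ℝ) (x : ESp d)
    (i : Fin d) : ℝ := ∑ j, B x i j * Y x j

/-- The Leibniz rule for the adjoint derivative of the contraction `B(·, Y)`. -/
theorem coAdj₁_coContract {B : ESp d → Matrix (Fin d) (Fin d) ℝ} {Y : ESp d → Fin d → ℝ}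
    (hB : ∀ i j, DifferentiableAt ℝ (fun y => B y i j) x)
    (hY : ∀ i, DifferentiableAt ℝ (fun y => Y y i) x) :
    coAdj₁ F (coContract B Y) x = ∑ j, coAdj₂ F B x j * Y x j
      - ∑ k, ∑ i, ∑ j, coMetricInv F x k i * B x i j *
          (pd k (fun y => Y y j) x + ∑ l, coChristoffel F x j k l * Y x l) := by
  have h1 : ∀ k i, coCov₁ F (coContract B Y) x k i = ∑ j, (coCov₂ F B x k i j * Y x j
      + B x i j * (pd k (fun y => Y y j) x + ∑ l, coChristoffel F x j k l * Y x l)) := by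
    intro k i
    simp only [coCov₁, coContract]
    rw [pd_sum k fun j _ => (hB i j).fun_mul (hY j)]
    simp only [pd_mul k (hB i _) (hY _), coCov₂, sub_mul, mul_add, Finset.sum_add_distrib,
      Finset.sum_sub_distrib, Finset.mul_sum, Finset.sum_mul]
    have e1 : ∑ j, ∑ l, coChristoffel F x l k i * (B x l j * Y x j)
        = ∑ j, ∑ l, coChristoffel F x l k i * B x l j * Y x j :=
      Finset.sum_congr rfl fun _ _ => Finset.sum_congr rfl fun _ _ => by ring
    have e2 : ∑ j, ∑ l, B x i j * (coChristoffel F x j k l * Y x l)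
        = ∑ j, ∑ l, coChristoffel F x l k j * B x i l * Y x j := by
      rw [Finset.sum_comm]
      exact Finset.sum_congr rfl fun _ _ => Finset.sum_congr rfl fun _ _ => by ring
    rw [Finset.sum_comm, e1, e2]
    ring
  simp only [coAdj₁, h1, coAdj₂, neg_mul, Finset.sum_neg_distrib, Finset.mul_sum,
    Finset.sum_add_distrib, mul_add, Finset.sum_mul]
  have e3 : ∑ j, ∑ k, ∑ i, coMetricInv F x k i * coCov₂ F B x k i j * Y x j
      = ∑ k, ∑ i, ∑ j, coMetricInv F x k i * (coCov₂ F B x k i j * Y x j) := by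
    rw [Finset.sum_comm]
    refine Finset.sum_congr rfl fun k _ => ?_
    rw [Finset.sum_comm]
    exact Finset.sum_congr rfl fun _ _ => Finset.sum_congr rfl fun _ _ => by ring
  rw [e3]
  simp only [mul_assoc]
  ring

/-- The Hessian pairing and the double adjoint differ by a divergence. -/
theorem coPairing_coHess_sub (hF : ContDiffAt ℝ ∞ F x) (h : (coMetric F x).det ≠ 0)
    {B : ESp d → Matrix (Fin d) (Fin d) ℝ} (hB : ∀ i j, ContDiffAt ℝ ∞ (fun y => B y i j) x)
    (hB' : ∀ i, ContDiffAt ℝ ∞ (fun y => coAdj₂ F B y i) x) {a : ESp d → ℝ}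
    (ha : ContDiffAt ℝ ∞ a x) :
    coPairing F x (B x) (coHess F a x) - a x * coAdj₁ F (coAdj₂ F B) x
      = coDiv F (fun y i => coSharp F (coContract B (coSharp F fun z j => pd j a z)) y i
          + a y * coSharp F (coAdj₂ F B) y i) x := by
  have hda : ∀ i, ContDiffAt ℝ ∞ (fun y => pd i a y) x := fun i => ContDiffAt.pd ha i
  have hY := contDiffAt_coSharp hF h hda
  have hω : ∀ i, ContDiffAt ℝ ∞ (fun y => coContract B (coSharp F fun z j => pd j a z) y i) x :=
    fun i => ContDiffAt.sum fun j _ => (hB i j).mul (hY j)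
  have hV := contDiffAt_coSharp hF h hω
  have hθ := contDiffAt_coSharp hF h hB'
  rw [coDiv_add (fun i => ContDiffAt.differentiableAt_infty (hV i))
      (fun i => ContDiffAt.differentiableAt_infty (ha.mul (hθ i))),
    coDiv_coSharp hF h hω,
    coDiv_smul (ContDiffAt.differentiableAt_infty ha)
      (fun i => ContDiffAt.differentiableAt_infty (hθ i)),
    coDiv_coSharp hF h hB',
    coAdj₁_coContract (fun i j => ContDiffAt.differentiableAt_infty (hB i j))
      (fun i => ContDiffAt.differentiableAt_infty (hY i))]
  have e1 : ∑ i, coSharp F (coAdj₂ F B) x i * pd i a x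
      = ∑ j, coAdj₂ F B x j * coSharp F (fun z j => pd j a z) x j := by
    simp only [coSharp, Finset.sum_mul, Finset.mul_sum]
    rw [Finset.sum_comm]
    exact Finset.sum_congr rfl fun _ _ => Finset.sum_congr rfl fun _ _ => by
      rw [coMetricInv_symm]; ring
  have e2 : ∀ k j, coCov₁ F (fun z j => pd j a z) x k j = coHess F a x k j := fun k j => rfl
  have e3 : ∑ k, ∑ i, ∑ j, coMetricInv F x k i * B x i j *
      (pd k (fun y => coSharp F (fun z j => pd j a z) y j) x
        + ∑ l, coChristoffel F x j k l * coSharp F (fun z j => pd j a z) x l)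
      = coPairing F x (B x) (coHess F a x) := by
    simp only [pd_coSharp hF h hda, e2, coPairing]
    rw [Finset.sum_comm]
    refine Finset.sum_congr rfl fun i _ => ?_
    rw [Finset.sum_comm]
    refine Finset.sum_congr rfl fun j _ => Finset.sum_congr rfl fun k _ => ?_
    rw [Finset.mul_sum]
    refine Finset.sum_congr rfl fun l _ => ?_
    rw [coMetricInv_symm k i]
    ring
  rw [e1, e3]
  ring

/-- The divergence with respect to the volume density: `√det g div X = ∂ᵢ(√det g X^i)`. -/
theorem coVolDensity_mul_coDiv (hF : ContDiffAt ℝ ∞ F x) (h : (coMetric F x).det ≠ 0)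
    {X : ESp d → Fin d → ℝ} (hX : ∀ i, DifferentiableAt ℝ (fun y => X y i) x) :
    coVolDensity F x * coDiv F X x = ∑ i, pd i (fun y => coVolDensity F y * X y i) x := by
  have hv := ContDiffAt.differentiableAt_infty (contDiffAt_coVolDensity hF h)
  simp only [pd_mul _ hv (hX _), pd_coVolDensity hF h, varVol_pd hF, coDiv, Finset.mul_sum,
    Finset.sum_add_distrib, mul_add, Finset.sum_mul]
  congr 1
  rw [Finset.sum_comm]
  exact Finset.sum_congr rfl fun _ _ => Finset.sum_congr rfl fun _ _ => by ring

end Spatial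


/-! ### The local expressions of the two gradients -/

section Gradients

variable {d : ℕ} {F m : ESp d → ESp (d + 1)} {x : ESp d} {Φ : ℝ → ℝ} {u : ESp d → ℝ}

/-- The scalar factor of the `K`-gradient in coordinates: the first variation of
`log (Φ (det L) √det g)` when `F` moves with velocity `m`. -/
noncomputable def coBracket (Φ : ℝ → ℝ) (F m : ESp d → ESp (d + 1)) (x : ESp d) : ℝ :=
  deriv Φ (coDet F x) / Φ (coDet F x) *
      ((coWeingarten F x).trace * coDet F x * inner ℝ (m x) (coNormal F x)
        + coPairing F x (coMetricAdj F x) (coHess F (fun y => inner ℝ (m y) (coNormal F y)) x)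
        + ∑ i, coTan F m x i * pd i (coDet F) x)
    + coDiv F (coTan F m) x - (coWeingarten F x).trace * inner ℝ (m x) (coNormal F x)

/-- The `H`-gradient in coordinates, as a function of `u = ⟨h, k⟩`. -/
noncomputable def coHGrad (Φ : ℝ → ℝ) (F : ESp d → ESp (d + 1)) (u : ESp d → ℝ) (x : ESp d) :
    ESp (d + 1) :=
  (deriv Φ (coDet F x) / Φ (coDet F x) * (coWeingarten F x).trace * coDet F x * u x
      + 1 / Φ (coDet F x) * coAdj₁ F
          (coAdj₂ F (fun y => (deriv Φ (coDet F y) * u y) • coMetricAdj F y)) x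
      - u x * (coWeingarten F x).trace) • coNormal F x
    + (1 / Φ (coDet F x)) •
      ((deriv Φ (coDet F x) * u x) • coPush F (coGrad F (coDet F) x) x
        - coPush F (coGrad F (fun y => Φ (coDet F y) * u y) x) x)

theorem coBracket_eq (hF : ∀ᶠ y in 𝓝 x, ContDiffAt ℝ ∞ F y) (h : (coMetric F x).det ≠ 0)
    (hm : ContDiffAt ℝ ∞ m x) :
    coBracket Φ F m x = deriv Φ (coDet F x) / Φ (coDet F x) * varDet F m x + varVol F m x := by
  rw [varDet_eq hF h hm, varVol_eq hF.self_of_nhds h hm, coBracket]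
  ring

/-- The first variation of the weighted volume density `Φ (det L) √det g`. -/
theorem hasDerivAt_weightedDensity {F : ℝ → ESp d → ESp (d + 1)} {q : ℝ}
    (hΦ : ContDiff ℝ ∞ Φ) (hpos : ∀ s, 0 < Φ s)
    (hF : ∀ᶠ z in 𝓝 (q, x), SmAt F z.1 z.2) (h : (coMetric (F q) x).det ≠ 0)
    (hm : m = fun y => deriv (fun r => F r y) q) :
    HasDerivAt (fun t => Φ (coDet (F t) x) * coVolDensity (F t) x)
      (Φ (coDet (F q) x) * coBracket Φ (F q) m x * coVolDensity (F q) x) q := by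
  have hq : SmAt F q x := hF.self_of_nhds
  have hm' : ContDiffAt ℝ ∞ m x := by rw [hm]; exact hq.param_deriv.slice
  have hFx : ∀ᶠ y in 𝓝 x, ContDiffAt ℝ ∞ (F q) y := by
    have hFy : ∀ᶠ y in 𝓝 x, SmAt F q y := (Continuous.prodMk_right q).continuousAt.eventually hF
    exact hFy.mono fun y hy => hy.slice
  have h1 := hasDerivAt_coDet hF h (congrFun hm)
  have h2 := hasDerivAt_coVolDensity hq h (congrFun hm)
  have h3 : HasDerivAt Φ (deriv Φ (coDet (F q) x)) (coDet (F q) x) :=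
    (hΦ.differentiable (by simp) _).hasDerivAt
  refine ((h3.comp q h1).mul h2).congr_deriv ?_
  rw [coBracket_eq hFx h hm']
  have := (hpos (coDet (F q) x)).ne'
  simp only [Function.comp]
  field_simp

theorem ContDiffAt.coChristoffel (hF : ContDiffAt ℝ ∞ F x) (h : (ImmGeo.coMetric F x).det ≠ 0)
    (k i j : Fin d) : ContDiffAt ℝ ∞ (fun y => ImmGeo.coChristoffel F y k i j) x :=
  ((SmAt.of_slice ℝ 0 hF).coChristoffel h k i j).slice

theorem ContDiffAt.coMetricAdj (hF : ContDiffAt ℝ ∞ F x) (h : (ImmGeo.coMetric F x).det ≠ 0)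
    (i j : Fin d) : ContDiffAt ℝ ∞ (fun y => ImmGeo.coMetricAdj F y i j) x :=
  ((SmAt.of_slice ℝ 0 hF).coMetricAdj (coCross_ne_zero h) h i j).slice

theorem contDiffAt_trace_coWeingarten (hF : ContDiffAt ℝ ∞ F x) (h : (coMetric F x).det ≠ 0) :
    ContDiffAt ℝ ∞ (fun y => (coWeingarten F y).trace) x :=
  ContDiffAt.sum fun i _ =>
    ((SmAt.of_slice ℝ 0 hF).coWeingarten (coCross_ne_zero h) h i i).slice

theorem contDiffAt_coAdj₂ (hF : ContDiffAt ℝ ∞ F x) (h : (coMetric F x).det ≠ 0)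
    {B : ESp d → Matrix (Fin d) (Fin d) ℝ} (hB : ∀ i j, ContDiffAt ℝ ∞ (fun y => B y i j) x)
    (j : Fin d) : ContDiffAt ℝ ∞ (fun y => coAdj₂ F B y j) x := by
  refine (ContDiffAt.sum fun k _ => ContDiffAt.sum fun i _ =>
    (ContDiffAt.coMetricInv hF h k i).mul ?_).neg
  exact ((ContDiffAt.pd (hB i j) k).sub (ContDiffAt.sum fun l _ =>
    (ContDiffAt.coChristoffel hF h l k i).mul (hB l j))).sub (ContDiffAt.sum fun l _ =>
    (ContDiffAt.coChristoffel hF h l k j).mul (hB i l))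

theorem contDiffAt_coAdj₁ (hF : ContDiffAt ℝ ∞ F x) (h : (coMetric F x).det ≠ 0)
    {θ : ESp d → Fin d → ℝ} (hθ : ∀ i, ContDiffAt ℝ ∞ (fun y => θ y i) x) :
    ContDiffAt ℝ ∞ (coAdj₁ F θ) x := by
  refine (ContDiffAt.sum fun k _ => ContDiffAt.sum fun i _ =>
    (ContDiffAt.coMetricInv hF h k i).mul ?_).neg
  exact (ContDiffAt.pd (hθ i) k).sub (ContDiffAt.sum fun l _ =>
    (ContDiffAt.coChristoffel hF h l k i).mul (hθ l))

theorem contDiffAt_coHess (hF : ContDiffAt ℝ ∞ F x) (h : (coMetric F x).det ≠ 0)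
    (hu : ContDiffAt ℝ ∞ u x) (i j : Fin d) : ContDiffAt ℝ ∞ (fun y => coHess F u y i j) x :=
  (ContDiffAt.pd (ContDiffAt.pd hu j) i).sub (ContDiffAt.sum fun k _ =>
    (ContDiffAt.coChristoffel hF h k i j).mul (ContDiffAt.pd hu k))

theorem contDiffAt_coPush {X : ESp d → Fin d → ℝ} (hF : ContDiffAt ℝ ∞ F x)
    (hX : ∀ i, ContDiffAt ℝ ∞ (fun y => X y i) x) :
    ContDiffAt ℝ ∞ (fun y => coPush F (X y) y) x :=
  ContDiffAt.sum fun i _ => (hX i).smul (ContDiffAt.pd hF i)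

theorem contDiffAt_coGrad (hF : ContDiffAt ℝ ∞ F x) (h : (coMetric F x).det ≠ 0)
    (hu : ContDiffAt ℝ ∞ u x) (i : Fin d) : ContDiffAt ℝ ∞ (fun y => coGrad F u y i) x :=
  ContDiffAt.sum fun j _ => (ContDiffAt.coMetricInv hF h i j).mul (ContDiffAt.pd hu j)

theorem contDiffAt_coDiv (hF : ContDiffAt ℝ ∞ F x) (h : (coMetric F x).det ≠ 0)
    {X : ESp d → Fin d → ℝ} (hX : ∀ i, ContDiffAt ℝ ∞ (fun y => X y i) x) :
    ContDiffAt ℝ ∞ (coDiv F X) x :=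
  ContDiffAt.sum fun i _ => (ContDiffAt.pd (hX i) i).add (ContDiffAt.sum fun j _ =>
    (ContDiffAt.coChristoffel hF h i i j).mul (hX j))

theorem contDiff_deriv (hΦ : ContDiff ℝ ∞ Φ) : ContDiff ℝ ∞ (deriv Φ) :=
  (contDiff_infty_iff_deriv.1 hΦ).2

theorem contDiffAt_comp_coDet (hΦ : ContDiff ℝ ∞ Φ) (hF : ContDiffAt ℝ ∞ F x)
    (h : (coMetric F x).det ≠ 0) : ContDiffAt ℝ ∞ (fun y => Φ (coDet F y)) x :=
  hΦ.contDiffAt.comp x (contDiffAt_coDet hF h)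

theorem contDiffAt_smul_coMetricAdj (hF : ContDiffAt ℝ ∞ F x) (h : (coMetric F x).det ≠ 0)
    (hu : ContDiffAt ℝ ∞ u x) (i j : Fin d) :
    ContDiffAt ℝ ∞ (fun y => (u y • coMetricAdj F y) i j) x :=
  hu.mul (ContDiffAt.coMetricAdj hF h i j)

theorem contDiffAt_coBracket (hΦ : ContDiff ℝ ∞ Φ) (hpos : ∀ s, 0 < Φ s)
    (hF : ContDiffAt ℝ ∞ F x) (h : (coMetric F x).det ≠ 0) (hm : ContDiffAt ℝ ∞ m x) :
    ContDiffAt ℝ ∞ (coBracket Φ F m) x := by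
  have ha := contDiffAt_inner_coNormal hF h hm
  have hX := contDiffAt_coTan hF h hm
  have htr := contDiffAt_trace_coWeingarten hF h
  have hD := contDiffAt_coDet hF h
  refine ((((contDiffAt_comp_coDet (contDiff_deriv hΦ) hF h).div
    (contDiffAt_comp_coDet hΦ hF h) (hpos _).ne').mul ((((htr.mul hD).mul ha).add ?_).add
      (ContDiffAt.sum fun i _ => (hX i).mul (ContDiffAt.pd hD i)))).add
      (contDiffAt_coDiv hF h hX)).sub (htr.mul ha)
  refine ContDiffAt.sum fun i _ => ContDiffAt.sum fun j _ => ContDiffAt.sum fun k _ =>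
    ContDiffAt.sum fun l _ => ?_
  exact (((ContDiffAt.coMetricInv hF h i k).mul (ContDiffAt.coMetricInv hF h j l)).mul
    (ContDiffAt.coMetricAdj hF h i j)).mul (contDiffAt_coHess hF h ha k l)

theorem contDiffAt_coHGrad (hΦ : ContDiff ℝ ∞ Φ) (hpos : ∀ s, 0 < Φ s)
    (hF : ContDiffAt ℝ ∞ F x) (h : (coMetric F x).det ≠ 0) (hu : ContDiffAt ℝ ∞ u x) :
    ContDiffAt ℝ ∞ (coHGrad Φ F u) x := by
  have hΦD := contDiffAt_comp_coDet hΦ hF h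
  have hΦD' := contDiffAt_comp_coDet (contDiff_deriv hΦ) hF h
  have htr := contDiffAt_trace_coWeingarten hF h
  have hD := contDiffAt_coDet hF h
  have hinv : ContDiffAt ℝ ∞ (fun y => 1 / Φ (coDet F y)) x :=
    contDiffAt_const.div hΦD (hpos _).ne'
  refine ContDiffAt.add (ContDiffAt.smul (((((hΦD'.div hΦD (hpos _).ne').mul htr).mul hD).mul hu
    |>.add (hinv.mul (contDiffAt_coAdj₁ hF h (contDiffAt_coAdj₂ hF h
      (contDiffAt_smul_coMetricAdj hF h (hΦD'.mul hu)))))).sub (hu.mul htr))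
    (ContDiffAt.coNormal hF h)) (hinv.smul (ContDiffAt.sub ((hΦD'.mul hu).smul
      (contDiffAt_coPush hF (contDiffAt_coGrad hF h hD)))
      (contDiffAt_coPush hF (contDiffAt_coGrad hF h (hΦD.mul hu)))))

theorem inner_coPush_coGrad (v : ESp d → ℝ) :
    (inner ℝ (m x) (coPush F (coGrad F v x) x) : ℝ) = ∑ j, coTan F m x j * pd j v x := by
  simp only [coPush, coGrad, coTan, inner_sum, real_inner_smul_right, Finset.sum_mul]
  rw [Finset.sum_comm]
  exact Finset.sum_congr rfl fun _ _ => Finset.sum_congr rfl fun _ _ => by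
    rw [coMetricInv_symm]; ring

theorem coPairing_smul (c : ℝ) (B H : Matrix (Fin d) (Fin d) ℝ) :
    coPairing F x (c • B) H = c * coPairing F x B H := by
  simp only [coPairing, Finset.mul_sum, Matrix.smul_apply, smul_eq_mul]
  exact Finset.sum_congr rfl fun _ _ => Finset.sum_congr rfl fun _ _ =>
    Finset.sum_congr rfl fun _ _ => Finset.sum_congr rfl fun _ _ => by ring

/-- The vector field whose divergence is the difference of the two integrands that express the
derivative of the metric through the `K`- and the `H`-gradient. -/
noncomputable def coFlux (Φ : ℝ → ℝ) (F m : ESp d → ESp (d + 1)) (u : ESp d → ℝ) (x : ESp d)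
    (i : Fin d) : ℝ :=
  (coSharp F (coContract (fun y => (deriv Φ (coDet F y) * u y) • coMetricAdj F y)
      (coSharp F fun z j => pd j (fun y => inner ℝ (m y) (coNormal F y)) z)) x i
    + inner ℝ (m x) (coNormal F x) *
      coSharp F (coAdj₂ F fun y => (deriv Φ (coDet F y) * u y) • coMetricAdj F y) x i)
  + Φ (coDet F x) * u x * coTan F m x i

theorem contDiffAt_coFlux (hΦ : ContDiff ℝ ∞ Φ) (hF : ContDiffAt ℝ ∞ F x)
    (h : (coMetric F x).det ≠ 0) (hm : ContDiffAt ℝ ∞ m x) (hu : ContDiffAt ℝ ∞ u x) (i : Fin d) :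
    ContDiffAt ℝ ∞ (fun y => coFlux Φ F m u y i) x := by
  have ha := contDiffAt_inner_coNormal hF h hm
  have hB := contDiffAt_smul_coMetricAdj hF h
    ((contDiffAt_comp_coDet (contDiff_deriv hΦ) hF h).mul hu)
  refine ContDiffAt.add (ContDiffAt.add (contDiffAt_coSharp hF h (fun i => ?_) i)
    (ha.mul (contDiffAt_coSharp hF h (contDiffAt_coAdj₂ hF h hB) i)))
    (((contDiffAt_comp_coDet hΦ hF h).mul hu).mul (contDiffAt_coTan hF h hm i))
  exact ContDiffAt.sum fun j _ => (hB i j).mul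
    (contDiffAt_coSharp hF h (fun l => ContDiffAt.pd ha l) j)

theorem coFlux_eq_zero (hm : m =ᶠ[𝓝 x] 0) (i : Fin d) : coFlux Φ F m u x i = 0 := by
  have ha : (fun y => (inner ℝ (m y) (coNormal F y) : ℝ)) =ᶠ[𝓝 x] fun _ => 0 :=
    hm.mono fun y hy => by simp [hy]
  have h0 : m x = 0 := hm.self_of_nhds
  simp [coFlux, coSharp, coContract, coTan, pd_congr _ ha, pd_const, h0]

/-- Pointwise form of the adjointness of the `K`- and the `H`-gradient. The terms without
derivatives of `m` agree; the Hessian term is moved by `coPairing_coHess_sub`, and `div(m^⊤)` by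
the product rule. -/
theorem coBracket_sub_inner_coHGrad (hΦ : ContDiff ℝ ∞ Φ) (hpos : ∀ s, 0 < Φ s)
    (hF : ContDiffAt ℝ ∞ F x) (h : (coMetric F x).det ≠ 0) (hm : ContDiffAt ℝ ∞ m x)
    (hu : ContDiffAt ℝ ∞ u x) :
    Φ (coDet F x) * coBracket Φ F m x * u x
      = Φ (coDet F x) * inner ℝ (m x) (coHGrad Φ F u x) + coDiv F (coFlux Φ F m u) x := by
  have ha := contDiffAt_inner_coNormal hF h hm
  have hX := contDiffAt_coTan hF h hm
  have hΦu := (contDiffAt_comp_coDet hΦ hF h).mul hu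
  have hB := contDiffAt_smul_coMetricAdj hF h
    ((contDiffAt_comp_coDet (contDiff_deriv hΦ) hF h).mul hu)
  have hB' := contDiffAt_coAdj₂ hF h hB
  have hZ : ∀ i, ContDiffAt ℝ ∞ (fun y => coSharp F (coContract
      (fun y => (deriv Φ (coDet F y) * u y) • coMetricAdj F y)
      (coSharp F fun z j => pd j (fun y => inner ℝ (m y) (coNormal F y)) z)) y i
      + inner ℝ (m y) (coNormal F y) *
      coSharp F (coAdj₂ F fun y => (deriv Φ (coDet F y) * u y) • coMetricAdj F y) y i) x := by
    intro i
    refine ContDiffAt.add (contDiffAt_coSharp hF h (fun i => ?_) i)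
      (ha.mul (contDiffAt_coSharp hF h hB' i))
    exact ContDiffAt.sum fun j _ => (hB i j).mul
      (contDiffAt_coSharp hF h (fun l => ContDiffAt.pd ha l) j)
  have e1 : coDiv F (coFlux Φ F m u) x = _ := coDiv_add (F := F)
    (fun i => ContDiffAt.differentiableAt_infty (hZ i))
    (fun i => ContDiffAt.differentiableAt_infty (hΦu.mul (hX i)))
  rw [e1, ← coPairing_coHess_sub hF h hB hB' ha, coDiv_smul
    (ContDiffAt.differentiableAt_infty hΦu) (fun i => ContDiffAt.differentiableAt_infty (hX i)),
    coPairing_smul, coHGrad, inner_add_right, real_inner_smul_right, real_inner_smul_right,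
    inner_sub_right, real_inner_smul_right, inner_coPush_coGrad, inner_coPush_coGrad, coBracket]
  have := (hpos (coDet F x)).ne'
  field_simp
  ring

end Gradients


/-! ### Integrals over a coordinate domain -/

section Integrals

open MeasureTheory

variable {d : ℕ} {U K : Set (ESp d)} {P W : Type*} [NormedAddCommGroup P] [NormedSpace ℝ P]
  [NormedAddCommGroup W] [NormedSpace ℝ W]

/-- A smooth family on `U` that vanishes off a compact subset of `U` extends by zero. -/
theorem smAt_indicator (hU : IsOpen U) (hK : IsCompact K) (hKU : K ⊆ U) {O : Set P} (hO : IsOpen O)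
    {u : P → ESp d → W} (hu : ∀ q ∈ O, ∀ x ∈ U, SmAt u q x)
    (h0 : ∀ q ∈ O, ∀ x ∈ U, x ∉ K → u q x = 0) {q : P} (hq : q ∈ O) (x : ESp d) :
    SmAt (fun q => U.indicator (u q)) q x := by
  by_cases hx : x ∈ U
  · refine (hu q hq x hx).congr ?_
    have : ∀ᶠ z : P × ESp d in 𝓝 (q, x), z.2 ∈ U := continuousAt_snd (hU.mem_nhds hx)
    exact this.mono fun z hz => Set.indicator_of_mem hz _
  · have hxK : x ∈ Kᶜ := fun h => hx (hKU h)
    have h1 : ∀ᶠ z : P × ESp d in 𝓝 (q, x), z.2 ∈ Kᶜ :=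
      continuousAt_snd (hK.isClosed.isOpen_compl.mem_nhds hxK)
    have h2 : ∀ᶠ z : P × ESp d in 𝓝 (q, x), z.1 ∈ O := continuousAt_fst (hO.mem_nhds hq)
    refine SmAt.congr (u := fun _ _ => (0 : W)) contDiffAt_const ?_
    filter_upwards [h1, h2] with z hz1 hz2
    by_cases hz : z.2 ∈ U
    · rw [Set.indicator_of_mem hz]
      exact h0 _ hz2 _ hz hz1
    · exact Set.indicator_of_notMem hz _

theorem contDiff_indicator (hU : IsOpen U) (hK : IsCompact K) (hKU : K ⊆ U)
    {u : ESp d → W} (hu : ∀ x ∈ U, ContDiffAt ℝ ∞ u x) (h0 : ∀ x ∈ U, x ∉ K → u x = 0) :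
    ContDiff ℝ ∞ (U.indicator u) :=
  contDiff_iff_contDiffAt.2 fun x => (smAt_indicator (P := ℝ) (O := Set.univ) hU hK hKU isOpen_univ
    (u := fun _ => u) (fun _ _ x hx => SmAt.of_slice ℝ _ (hu x hx)) (fun _ _ => h0)
    (Set.mem_univ 0) x).slice

theorem hasCompactSupport_indicator {V : Type*} [NormedAddCommGroup V] (hK : IsCompact K)
    {u : ESp d → V}
    (h0 : ∀ x ∈ U, x ∉ K → u x = 0) : HasCompactSupport (U.indicator u) :=
  HasCompactSupport.intro hK fun x hx => by
    by_cases hz : x ∈ U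
    · rw [Set.indicator_of_mem hz, h0 x hz hx]
    · exact Set.indicator_of_notMem hz _

theorem continuous_indicator_of_compact {V : Type*} [NormedAddCommGroup V]
    (hU : IsOpen U) (hK : IsCompact K) (hKU : K ⊆ U) {u : ESp d → V}
    (hu : ContinuousOn u U) (h0 : ∀ x ∈ U, x ∉ K → u x = 0) :
    Continuous (U.indicator u) := by
  refine continuous_iff_continuousAt.2 fun x => ?_
  by_cases hx : x ∈ U
  · refine ((hu.continuousAt (hU.mem_nhds hx))).congr ?_
    filter_upwards [hU.mem_nhds hx] with z hz
    exact (Set.indicator_of_mem hz _).symm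
  · have hxK : x ∈ Kᶜ := fun h => hx (hKU h)
    refine (continuousAt_const (y := (0 : V))).congr ?_
    filter_upwards [hK.isClosed.isOpen_compl.mem_nhds hxK] with z hz1
    by_cases hz : z ∈ U
    · rw [Set.indicator_of_mem hz]; exact (h0 _ hz hz1).symm
    · exact (Set.indicator_of_notMem hz _).symm

theorem integrableOn_of_compact (hU : IsOpen U) (hK : IsCompact K) (hKU : K ⊆ U)
    {u : ESp d → ℝ} (hu : ContinuousOn u U) (h0 : ∀ x ∈ U, x ∉ K → u x = 0) :
    IntegrableOn u U := by
  rw [← integrable_indicator_iff hU.measurableSet]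
  exact (continuous_indicator_of_compact hU hK hKU hu h0).integrable_of_hasCompactSupport
    (hasCompactSupport_indicator hK h0)

theorem continuous_pd {u : ESp d → W} (hu : ContDiff ℝ ∞ u) (i : Fin d) : Continuous (pd i u) :=
  (hu.continuous_fderiv (by simp)).clm_apply continuous_const

theorem hasCompactSupport_pd {u : ESp d → W} (hu : HasCompactSupport u) (i : Fin d) :
    HasCompactSupport (pd i u) :=
  (hu.fderiv ℝ).comp_left (g := fun L : ESp d →L[ℝ] W => L (EuclideanSpace.single i 1)) rfl

theorem integral_pd_eq_zero {u : ESp d → ℝ} (hu : ContDiff ℝ ∞ u) (hc : HasCompactSupport u)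
    (i : Fin d) : ∫ x, pd i u x = 0 := by
  have h := integral_mul_fderiv_eq_neg_fderiv_mul_of_integrable (μ := (volume : Measure (ESp d)))
    (f := fun _ => (1 : ℝ)) (g := u) (v := EuclideanSpace.single i 1) (by simp)
    (by
      simp only [one_mul]
      exact (continuous_pd hu i).integrable_of_hasCompactSupport (hasCompactSupport_pd hc i))
    (by simpa using hu.continuous.integrable_of_hasCompactSupport hc)
    (fun _ _ => differentiableAt_const _) (fun _ _ => hu.differentiable (by simp) _)
  simpa [pd] using h

theorem pd_indicator (hU : IsOpen U) {u : ESp d → W} {x : ESp d} (hx : x ∈ U) (i : Fin d) :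
    pd i (U.indicator u) x = pd i u x :=
  pd_congr i ((hU.eventually_mem hx).mono fun _ hz => Set.indicator_of_mem hz _)

theorem setIntegral_pd_eq_zero (hU : IsOpen U) (hK : IsCompact K) (hKU : K ⊆ U)
    {u : ESp d → ℝ} (hu : ∀ x ∈ U, ContDiffAt ℝ ∞ u x) (h0 : ∀ x ∈ U, x ∉ K → u x = 0)
    (i : Fin d) : ∫ x in U, pd i u x = 0 := by
  rw [← integral_pd_eq_zero (contDiff_indicator hU hK hKU hu h0)
    (hasCompactSupport_indicator hK h0) i, ← integral_indicator hU.measurableSet]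
  refine integral_congr_ae (Filter.Eventually.of_forall fun x => ?_)
  by_cases hx : x ∈ U
  · simp only [Set.indicator_of_mem hx, pd_indicator hU hx]
  · simp only [Set.indicator_of_notMem hx]
    have hxK : x ∈ Kᶜ := fun h => hx (hKU h)
    have : U.indicator u =ᶠ[𝓝 x] fun _ => 0 := by
      filter_upwards [hK.isClosed.isOpen_compl.mem_nhds hxK] with z hz1
      by_cases hz : z ∈ U
      · rw [Set.indicator_of_mem hz]; exact h0 _ hz hz1
      · exact Set.indicator_of_notMem hz _
    rw [pd_congr i this, pd_const]

/-- The divergence theorem for a compactly supported vector field in a chart. -/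
theorem setIntegral_coDiv_eq_zero (hU : IsOpen U) (hK : IsCompact K) (hKU : K ⊆ U)
    {F : ESp d → ESp (d + 1)} (hF : ∀ x ∈ U, ContDiffAt ℝ ∞ F x)
    (hdet : ∀ x ∈ U, (coMetric F x).det ≠ 0) {X : ESp d → Fin d → ℝ}
    (hX : ∀ x ∈ U, ∀ i, ContDiffAt ℝ ∞ (fun y => X y i) x) (h0 : ∀ x ∈ U, x ∉ K → X x = 0) :
    IntegrableOn (fun x => coDiv F X x * coVolDensity F x) U ∧
      ∫ x in U, coDiv F X x * coVolDensity F x = 0 := by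
  have hv : ∀ i, ∀ x ∈ U, ContDiffAt ℝ ∞ (fun y => coVolDensity F y * X y i) x := fun i x hx =>
    (contDiffAt_coVolDensity (hF x hx) (hdet x hx)).mul (hX x hx i)
  have hv0 : ∀ i, ∀ x ∈ U, x ∉ K → coVolDensity F x * X x i = 0 := fun i x hx hxK => by
    rw [h0 x hx hxK, Pi.zero_apply, mul_zero]
  have e : Set.EqOn (fun x => coDiv F X x * coVolDensity F x)
      (fun x => ∑ i, pd i (fun y => coVolDensity F y * X y i) x) U := fun x hx => by
    simp only
    rw [mul_comm, coVolDensity_mul_coDiv (hF x hx) (hdet x hx)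
      (fun i => ContDiffAt.differentiableAt_infty (hX x hx i))]
  have hi : ∀ i, IntegrableOn (pd i fun y => coVolDensity F y * X y i) U := by
    intro i
    refine integrableOn_of_compact hU hK hKU
      (fun x hx => (ContDiffAt.pd (hv i x hx) i).continuousAt.continuousWithinAt) ?_
    intro x hx hxK
    have : (fun y => coVolDensity F y * X y i) =ᶠ[𝓝 x] fun _ => 0 := by
      filter_upwards [hK.isClosed.isOpen_compl.mem_nhds hxK, hU.mem_nhds hx] with z hz1 hz
      exact hv0 i z hz hz1
    rw [pd_congr i this, pd_const]
  constructor
  · exact IntegrableOn.congr_fun (f := fun x => ∑ i, pd i (fun y => coVolDensity F y * X y i) x)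
      (integrable_finsetSum _ fun i _ => hi i) e.symm hU.measurableSet
  · rw [setIntegral_congr_fun hU.measurableSet e, integral_finsetSum _ fun i _ => hi i]
    exact Finset.sum_eq_zero fun i _ => setIntegral_pd_eq_zero hU hK hKU (hv i) (hv0 i) i

/-- The `H`-gradient in coordinates is the adjoint of `m ↦ coBracket Φ F m`. -/
theorem setIntegral_coBracket (hU : IsOpen U) (hK : IsCompact K) (hKU : K ⊆ U)
    {Φ : ℝ → ℝ} (hΦ : ContDiff ℝ ∞ Φ) (hpos : ∀ s, 0 < Φ s)
    {F m : ESp d → ESp (d + 1)} {u : ESp d → ℝ} (hF : ∀ x ∈ U, ContDiffAt ℝ ∞ F x)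
    (hdet : ∀ x ∈ U, (coMetric F x).det ≠ 0) (hm : ∀ x ∈ U, ContDiffAt ℝ ∞ m x)
    (hu : ∀ x ∈ U, ContDiffAt ℝ ∞ u x) (h0 : ∀ x ∈ U, x ∉ K → m x = 0) :
    ∫ x in U, Φ (coDet F x) * coBracket Φ F m x * u x * coVolDensity F x
      = ∫ x in U, Φ (coDet F x) * inner ℝ (m x) (coHGrad Φ F u x) * coVolDensity F x := by
  have hZ := setIntegral_coDiv_eq_zero hU hK hKU hF hdet (X := coFlux Φ F m u)
    (fun x hx => contDiffAt_coFlux hΦ (hF x hx) (hdet x hx) (hm x hx) (hu x hx))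
    (fun x hx hxK => by
      ext i
      refine coFlux_eq_zero ?_ i
      filter_upwards [hK.isClosed.isOpen_compl.mem_nhds hxK, hU.mem_nhds hx] with z hz1 hz
      exact h0 z hz hz1)
  have hI : IntegrableOn (fun x => Φ (coDet F x) * inner ℝ (m x) (coHGrad Φ F u x)
      * coVolDensity F x) U := by
    refine integrableOn_of_compact hU hK hKU (fun x hx => ContinuousAt.continuousWithinAt ?_) ?_
    · exact ((((contDiffAt_comp_coDet hΦ (hF x hx) (hdet x hx))).mul ((hm x hx).inner ℝ
        (contDiffAt_coHGrad hΦ hpos (hF x hx) (hdet x hx) (hu x hx)))).mul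
        (contDiffAt_coVolDensity (hF x hx) (hdet x hx))).continuousAt
    · intro x hx hxK
      simp [h0 x hx hxK]
  rw [← add_zero (∫ x in U, Φ (coDet F x) * inner ℝ (m x) (coHGrad Φ F u x) * coVolDensity F x),
    ← hZ.2, ← integral_add hI hZ.1]
  refine setIntegral_congr_fun hU.measurableSet fun x hx => ?_
  rw [coBracket_sub_inner_coHGrad hΦ hpos (hF x hx) (hdet x hx) (hm x hx) (hu x hx), add_mul]

/-! ### Integrals depending on parameters -/

/-- The integral over `U` of a smooth family supported in a fixed compact set depends smoothly on
the parameters: it is the value at `0` of the convolution with the constant `1`. -/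
theorem contDiffOn_setIntegral (hU : IsOpen U) (hK : IsCompact K) (hKU : K ⊆ U)
    {O : Set P} (hO : IsOpen O) {u : P → ESp d → ℝ} (hu : ∀ q ∈ O, ∀ x ∈ U, SmAt u q x)
    (h0 : ∀ q ∈ O, ∀ x ∈ U, x ∉ K → u q x = 0) :
    ContDiffOn ℝ ∞ (fun q => ∫ x in U, u q x) O := by
  have h1 := contDiffOn_convolution_right_with_param_comp (𝕜 := ℝ) (n := ⊤)
    (μ := (volume : Measure (ESp d))) (ContinuousLinearMap.mul ℝ ℝ) (s := O)
    (v := fun _ : P => (0 : ESp d)) contDiffOn_const (f := fun _ : ESp d => (1 : ℝ))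
    (g := fun q => U.indicator (u q)) hO hK
    (fun q x hq hx => by
      by_cases hz : x ∈ U
      · rw [Set.indicator_of_mem hz, h0 q hq x hz hx]
      · exact Set.indicator_of_notMem hz _)
    (locallyIntegrable_const 1)
    (fun z hz => (smAt_indicator hU hK hKU hO hu h0 hz.1 z.2).contDiffWithinAt)
  refine h1.congr fun q _ => ?_
  simp only [convolution, ContinuousLinearMap.mul_apply', one_mul, zero_sub]
  rw [integral_neg_eq_self (fun t => U.indicator (u q) t), integral_indicator hU.measurableSet]

/-- Differentiation under the integral sign for a smooth family supported in a fixed compact set. -/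
theorem hasDerivAt_setIntegral (hU : IsOpen U) (hK : IsCompact K) (hKU : K ⊆ U)
    {O : Set ℝ} (hO : IsOpen O) {u : ℝ → ESp d → ℝ} (hu : ∀ q ∈ O, ∀ x ∈ U, SmAt u q x)
    (h0 : ∀ q ∈ O, ∀ x ∈ U, x ∉ K → u q x = 0) {q : ℝ} (hq : q ∈ O) :
    HasDerivAt (fun t => ∫ x in U, u t x) (∫ x in U, deriv (fun t => u t x) q) q := by
  set g : ℝ → ESp d → ℝ := fun t => U.indicator (u t) with hg
  have hgs : ∀ t ∈ O, ∀ x, SmAt g t x := fun t ht x => smAt_indicator hU hK hKU hO hu h0 ht x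
  have hg0 : ∀ t ∈ O, ∀ x ∉ K, g t x = 0 := fun t ht x hx => by
    by_cases hz : x ∈ U
    · simp only [hg, Set.indicator_of_mem hz, h0 t ht x hz hx]
    · exact Set.indicator_of_notMem hz _
  obtain ⟨ε, hε, hball⟩ := Metric.nhds_basis_closedBall.mem_iff.1 (hO.mem_nhds hq)
  have hcont : ∀ t ∈ O, Continuous (g t) := fun t ht =>
    continuous_iff_continuousAt.2 fun x => (hgs t ht x).slice.continuousAt
  have hd0 : ∀ t ∈ O, ∀ x ∉ K, deriv (fun t => g t x) t = 0 := fun t ht x hx => by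
    have : (fun t => g t x) =ᶠ[𝓝 t] fun _ => 0 := by
      filter_upwards [hO.mem_nhds ht] with s hs using hg0 s hs x hx
    rw [this.deriv_eq, deriv_const]
  obtain ⟨C, hC⟩ := ((isCompact_closedBall q ε).prod hK).exists_bound_of_continuousOn
    (f := fun z : ℝ × ESp d => deriv (fun t => g t z.2) z.1)
    (fun z hz => ((hgs z.1 (hball hz.1) z.2).param_deriv).continuousAt.continuousWithinAt)
  have key := hasDerivAt_integral_of_dominated_loc_of_deriv_le (μ := (volume : Measure (ESp d)))
    (F := g) (F' := fun t x => deriv (fun t => g t x) t) (x₀ := q) (s := Metric.closedBall q ε)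
    (bound := K.indicator fun _ => C) (Metric.closedBall_mem_nhds q hε)
    ((hO.eventually_mem hq).mono fun t ht => (hcont t ht).aestronglyMeasurable)
    ((hcont q hq).integrable_of_hasCompactSupport (HasCompactSupport.intro hK (hg0 q hq)))
    (continuous_iff_continuousAt.2 fun x =>
      (hgs q hq x).param_deriv.slice.continuousAt).aestronglyMeasurable
    (Filter.Eventually.of_forall fun x t ht => by
      by_cases hx : x ∈ K
      · rw [Set.indicator_of_mem hx]
        exact hC (t, x) ⟨ht, hx⟩
      · rw [Set.indicator_of_notMem hx, hd0 t (hball ht) x hx, norm_zero])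
    ((integrable_indicator_iff hK.measurableSet).2
      (integrableOn_const (C := C) hK.measure_lt_top.ne))
    (Filter.Eventually.of_forall fun x t ht =>
      (ContDiffAt.differentiableAt_infty (f := fun t => g t x) (hgs t (hball ht) x).param).hasDerivAt)
  have e1 : ∀ t, ∫ x, g t x = ∫ x in U, u t x := fun t => integral_indicator hU.measurableSet
  have e2 : ∫ x, deriv (fun t => g t x) q = ∫ x in U, deriv (fun t => u t x) q := by
    rw [← integral_indicator hU.measurableSet]
    refine integral_congr_ae (Filter.Eventually.of_forall fun x => ?_)
    by_cases hx : x ∈ U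
    · simp only [hg, Set.indicator_of_mem hx]
    · simp only [hg, Set.indicator_of_notMem hx, deriv_const]
  simpa only [e1, e2] using key.2

end Integrals


/-! ### Change of coordinates -/

section ChartChange

variable {d : ℕ} {F : ESp d → ESp (d + 1)} {φ : ESp d → ESp d} {x : ESp d}

/-- The Jacobian matrix `∂ᵢφ^a` (the transpose of the matrix of the derivative). -/
noncomputable def jacobian (φ : ESp d → ESp d) (x : ESp d) : Matrix (Fin d) (Fin d) ℝ :=
  Matrix.of fun i a => pd i φ x a

theorem det_jacobian (φ : ESp d → ESp d) (x : ESp d) :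
    (jacobian φ x).det = (fderiv ℝ φ x).det := by
  have h : LinearMap.toMatrix (EuclideanSpace.basisFun (Fin d) ℝ).toBasis
      (EuclideanSpace.basisFun (Fin d) ℝ).toBasis (fderiv ℝ φ x : ESp d →ₗ[ℝ] ESp d)
      = (jacobian φ x).transpose := by
    ext a i
    simp [LinearMap.toMatrix_apply, jacobian, pd]
  rw [ContinuousLinearMap.det, ← LinearMap.det_toMatrix
    (EuclideanSpace.basisFun (Fin d) ℝ).toBasis, h, Matrix.det_transpose]

theorem pd_comp {W : Type*} [NormedAddCommGroup W] [NormedSpace ℝ W] {u : ESp d → W}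
    (hφ : DifferentiableAt ℝ φ x) (hu : DifferentiableAt ℝ u (φ x)) (i : Fin d) :
    pd i (fun y => u (φ y)) x = ∑ a, jacobian φ x i a • pd a u (φ x) := by
  have h := (hu.hasFDerivAt.comp x hφ.hasFDerivAt).fderiv
  have h2 := (EuclideanSpace.basisFun (Fin d) ℝ).sum_repr (pd i φ x)
  have h3 : pd i (fun y => u (φ y)) x = fderiv ℝ u (φ x) (pd i φ x) := by
    rw [pd]
    change fderiv ℝ (u ∘ φ) x _ = _
    rw [h]; rfl
  rw [h3]
  conv_lhs => rw [← h2]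
  simp [pd, jacobian]

theorem coMetric_comp (hφ : DifferentiableAt ℝ φ x) (hF : DifferentiableAt ℝ F (φ x)) :
    coMetric (fun y => F (φ y)) x
      = jacobian φ x * coMetric F (φ x) * (jacobian φ x).transpose := by
  ext i j
  simp only [coMetric, Matrix.of_apply, pd_comp hφ hF, sum_inner, inner_sum, real_inner_smul_left,
    real_inner_smul_right, Matrix.mul_apply, Matrix.transpose_apply, Finset.sum_mul]
  exact Finset.sum_congr rfl fun _ _ => Finset.sum_congr rfl fun _ _ => by ring

theorem det_coMetric_comp (hφ : DifferentiableAt ℝ φ x) (hF : DifferentiableAt ℝ F (φ x)) :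
    (coMetric (fun y => F (φ y)) x).det = (jacobian φ x).det ^ 2 * (coMetric F (φ x)).det := by
  rw [coMetric_comp hφ hF, Matrix.det_mul, Matrix.det_mul, Matrix.det_transpose]
  ring

theorem coVolDensity_comp (hφ : DifferentiableAt ℝ φ x) (hF : DifferentiableAt ℝ F (φ x)) :
    coVolDensity (fun y => F (φ y)) x = |(jacobian φ x).det| * coVolDensity F (φ x) := by
  rw [coVolDensity, det_coMetric_comp hφ hF, Real.sqrt_mul (sq_nonneg _), Real.sqrt_sq_eq_abs,
    coVolDensity]

/-- Both sides pair with `w` to `det (w, ∂₁(F ∘ φ), …, ∂_d(F ∘ φ))`, which factors through the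
block matrix `1 ⊕ J` with `J` the Jacobian matrix. -/
theorem coCross_comp (hφ : DifferentiableAt ℝ φ x) (hF : DifferentiableAt ℝ F (φ x)) :
    coCross (fun y => F (φ y)) x = (jacobian φ x).det • coCross F (φ x) := by
  refine ext_inner_right ℝ fun w => ?_
  rw [real_inner_smul_left, inner_coCross, inner_coCross]
  set B : Matrix (Fin (d + 1)) (Fin (d + 1)) ℝ :=
    Matrix.of (Fin.cons (Fin.cons 1 fun _ => 0) fun i => Fin.cons 0 (jacobian φ x i) :
      Fin (d + 1) → Fin (d + 1) → ℝ) with hB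
  have hdet : B.det = (jacobian φ x).det := by
    rw [Matrix.det_succ_row_zero, Finset.sum_eq_single 0]
    · have : B.submatrix Fin.succ (Fin.succAbove 0) = jacobian φ x := by
        ext i j; simp [hB]
      rw [this]
      simp [hB]
    · intro b _ hb
      obtain ⟨k, rfl⟩ := Fin.exists_succ_eq.2 hb
      simp [hB]
    · simp
  have hmul : frameMatrix (fun y => F (φ y)) x w = B * frameMatrix F (φ x) w := by
    ext a j
    rw [Matrix.mul_apply, Fin.sum_univ_succ]
    refine Fin.cases ?_ (fun i => ?_) a
    · simp [hB, frameMatrix]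
    · simp [hB, frameMatrix, pd_comp hφ hF]
  rw [hmul, Matrix.det_mul, hdet]

theorem coNormal_comp (hφ : DifferentiableAt ℝ φ x) (hF : DifferentiableAt ℝ F (φ x))
    (hJ : 0 < (jacobian φ x).det) : coNormal (fun y => F (φ y)) x = coNormal F (φ x) := by
  rw [coNormal, coCross_comp hφ hF, norm_smul, smul_smul, Real.norm_eq_abs, abs_of_pos hJ, coNormal,
    mul_inv, mul_assoc, mul_comm _ (jacobian φ x).det, ← mul_assoc, inv_mul_cancel₀ hJ.ne', one_mul]

theorem eventually_jacobian_pos (hφ : ContDiffAt ℝ ∞ φ x) (hJ : 0 < (jacobian φ x).det) :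
    ∀ᶠ y in 𝓝 x, 0 < (jacobian φ y).det :=
  (contDiffAt_matrix_det (A := fun y => jacobian φ y) (x := x) fun i a =>
    contDiffAt_euclidean.1 (ContDiffAt.pd hφ i) a).continuousAt.eventually (lt_mem_nhds hJ)

/-- The positive Jacobian enters because reversing the orientation changes the sign of `ν`. -/
theorem secondMatrix_comp (hφ : ContDiffAt ℝ ∞ φ x) (hF : ContDiffAt ℝ ∞ F (φ x))
    (h : (coMetric F (φ x)).det ≠ 0) (hJ : 0 < (jacobian φ x).det) :
    secondMatrix (fun y => F (φ y)) x
      = jacobian φ x * secondMatrix F (φ x) * (jacobian φ x).transpose := by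
  have hφ' := ContDiffAt.differentiableAt_infty hφ
  have hF' := ContDiffAt.differentiableAt_infty hF
  have hν : coNormal (fun y => F (φ y)) =ᶠ[𝓝 x] fun y => coNormal F (φ y) := by
    filter_upwards [eventually_jacobian_pos hφ hJ, eventually_differentiableAt hφ,
      hφ.continuousAt.eventually (eventually_differentiableAt hF)] with y h1 h2 h3
    exact coNormal_comp h2 h3 h1
  ext i j
  simp only [secondMatrix, coSecond, Matrix.of_apply, pd_congr _ hν, pd_comp hφ' hF',
    pd_comp hφ' (ContDiffAt.differentiableAt_infty (ContDiffAt.coNormal hF h)), sum_inner, inner_sum,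
    real_inner_smul_left, real_inner_smul_right, Matrix.mul_apply, Matrix.transpose_apply,
    Finset.sum_mul]
  rw [← Finset.sum_neg_distrib]
  refine Finset.sum_congr rfl fun _ _ => ?_
  rw [← Finset.sum_neg_distrib]
  exact Finset.sum_congr rfl fun _ _ => by ring

theorem coDet_comp (hφ : ContDiffAt ℝ ∞ φ x) (hF : ContDiffAt ℝ ∞ F (φ x))
    (h : (coMetric F (φ x)).det ≠ 0) (hJ : 0 < (jacobian φ x).det) :
    coDet (fun y => F (φ y)) x = coDet F (φ x) := by
  rw [coDet_eq, secondMatrix_comp hφ hF h hJ,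
    coMetric_comp (ContDiffAt.differentiableAt_infty hφ) (ContDiffAt.differentiableAt_infty hF),
    coDet_eq]
  simp only [Matrix.det_mul, Matrix.det_transpose]
  have := hJ.ne'
  field_simp

theorem smAt_add_smul {m : ESp d → ESp (d + 1)} (hF : ContDiffAt ℝ ∞ F x)
    (hm : ContDiffAt ℝ ∞ m x) (q : ℝ) : SmAt (fun t y => F y + t • m y) q x :=
  (SmAt.of_slice ℝ q hF).add (contDiffAt_fst.smul (SmAt.of_slice ℝ q hm))

theorem eventually_smAt_add_smul {m : ESp d → ESp (d + 1)} (hF : ∀ᶠ y in 𝓝 x, ContDiffAt ℝ ∞ F y)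
    (hm : ∀ᶠ y in 𝓝 x, ContDiffAt ℝ ∞ m y) (q : ℝ) :
    ∀ᶠ z in 𝓝 (q, x), SmAt (fun t y => F y + t • m y) z.1 z.2 := by
  have h1 : ∀ᶠ z in 𝓝 (q, x), ContDiffAt ℝ ∞ F z.2 ∧ ContDiffAt ℝ ∞ m z.2 :=
    (continuousAt_snd (p := (q, x))).eventually (hF.and hm)
  exact h1.mono fun z hz => smAt_add_smul hz.1 hz.2 _

theorem hasDerivAt_add_smul {W : Type*} [NormedAddCommGroup W] [NormedSpace ℝ W] (a b : W) (q : ℝ) :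
    HasDerivAt (fun t : ℝ => a + t • b) b q := by
  simpa using ((hasDerivAt_id q).smul_const b).const_add a

theorem hasDerivAt_weightedDensity_line {Φ : ℝ → ℝ} (hΦ : ContDiff ℝ ∞ Φ) (hpos : ∀ s, 0 < Φ s)
    {m : ESp d → ESp (d + 1)} (hF : ∀ᶠ y in 𝓝 x, ContDiffAt ℝ ∞ F y)
    (hm : ∀ᶠ y in 𝓝 x, ContDiffAt ℝ ∞ m y) (h : (coMetric F x).det ≠ 0) :
    HasDerivAt (fun t : ℝ => Φ (coDet (fun y => F y + t • m y) x)
        * coVolDensity (fun y => F y + t • m y) x)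
      (Φ (coDet F x) * coBracket Φ F m x * coVolDensity F x) 0 := by
  have := hasDerivAt_weightedDensity (F := fun t y => F y + t • m y) (q := 0) (m := m) hΦ hpos
    (eventually_smAt_add_smul hF hm 0) (by simpa using h)
    (funext fun y => (hasDerivAt_add_smul (F y) (m y) 0).deriv.symm)
  simpa using this

/-- The bracket does not depend on the chart, since it is the logarithmic first variation of
`Φ (det L) √det g`, which changes by a factor that does not depend on the immersion. -/
theorem coBracket_comp {Φ : ℝ → ℝ} (hΦ : ContDiff ℝ ∞ Φ) (hpos : ∀ s, 0 < Φ s)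
    {m : ESp d → ESp (d + 1)} (hφ : ∀ᶠ y in 𝓝 x, ContDiffAt ℝ ∞ φ y)
    (hF : ∀ᶠ y in 𝓝 (φ x), ContDiffAt ℝ ∞ F y)
    (hm : ∀ᶠ y in 𝓝 (φ x), ContDiffAt ℝ ∞ m y) (h : (coMetric F (φ x)).det ≠ 0)
    (hJ : 0 < (jacobian φ x).det) :
    coBracket Φ (fun y => F (φ y)) (fun y => m (φ y)) x = coBracket Φ F m (φ x) := by
  have hφx := hφ.self_of_nhds
  have hdet : (coMetric (fun y => F (φ y)) x).det ≠ 0 := by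
    rw [det_coMetric_comp (ContDiffAt.differentiableAt_infty hφx)
      (ContDiffAt.differentiableAt_infty hF.self_of_nhds)]
    exact mul_ne_zero (pow_ne_zero _ hJ.ne') h
  have hFφ : ∀ᶠ y in 𝓝 x, ContDiffAt ℝ ∞ (fun y => F (φ y)) y := by
    filter_upwards [hφ, hφx.continuousAt.eventually hF] with y h1 h2 using h2.comp y h1
  have hmφ : ∀ᶠ y in 𝓝 x, ContDiffAt ℝ ∞ (fun y => m (φ y)) y := by
    filter_upwards [hφ, hφx.continuousAt.eventually hm] with y h1 h2 using h2.comp y h1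
  have h1 := hasDerivAt_weightedDensity_line hΦ hpos hFφ hmφ hdet
  have h2 := (hasDerivAt_weightedDensity_line hΦ hpos hF hm h).const_mul |(jacobian φ x).det|
  have hne : ∀ᶠ t in 𝓝 (0 : ℝ), (coMetric (fun y => F y + t • m y) (φ x)).det ≠ 0 := by
    refine ((smAt_add_smul hF.self_of_nhds hm.self_of_nhds 0).det_coMetric.param.continuousAt
      ).eventually_ne ?_
    simpa using h
  have he : (fun t : ℝ => Φ (coDet (fun y => F (φ y) + t • m (φ y)) x)
        * coVolDensity (fun y => F (φ y) + t • m (φ y)) x) =ᶠ[𝓝 0]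
      fun t => |(jacobian φ x).det| * (Φ (coDet (fun y => F y + t • m y) (φ x))
        * coVolDensity (fun y => F y + t • m y) (φ x)) := by
    filter_upwards [hne] with t ht
    have hs : ContDiffAt ℝ ∞ (fun y => F y + t • m y) (φ x) :=
      (smAt_add_smul hF.self_of_nhds hm.self_of_nhds t).slice
    rw [coDet_comp (F := fun y => F y + t • m y) hφx hs ht hJ,
      coVolDensity_comp (F := fun y => F y + t • m y) (ContDiffAt.differentiableAt_infty hφx)
      (ContDiffAt.differentiableAt_infty hs)]
    ring
  -- both sides are the derivative of the weighted density in the chart of `x`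
  have h3 := h1.unique (h2.congr_of_eventuallyEq he)
  rw [coDet_comp hφx hF.self_of_nhds h hJ, coVolDensity_comp (ContDiffAt.differentiableAt_infty hφx)
    (ContDiffAt.differentiableAt_infty hF.self_of_nhds)] at h3
  have p1 := (hpos (coDet F (φ x))).ne'
  have p2 := (coVolDensity_pos h).ne'
  have p3 := (abs_pos.2 hJ.ne').ne'
  have p4 := mul_ne_zero (mul_ne_zero p1 p3) p2
  refine mul_left_cancel₀ p4 ?_
  linarith

end ChartChange


/-! ### Independence of the chart -/

section WeakInvariance

open MeasureTheory

variable {d : ℕ} {F : ESp d → ESp (d + 1)} {φ : OpenPartialHomeomorph (ESp d) (ESp d)}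

/-- Change of variables for integrals against the volume density. -/
theorem setIntegral_comp_chartChange (hφ : ∀ x ∈ φ.source, ContDiffAt ℝ ∞ φ x)
    (hF : ∀ y ∈ φ.target, ContDiffAt ℝ ∞ F y) (w : ESp d → ℝ) :
    ∫ y in φ.target, w y * coVolDensity F y
      = ∫ x in φ.source, w (φ x) * coVolDensity (fun y => F (φ y)) x := by
  have h := integral_image_eq_integral_abs_det_fderiv_smul (volume : Measure (ESp d))
    φ.open_source.measurableSet (f := φ) (f' := fun x => fderiv ℝ φ x)
    (fun x hx => (ContDiffAt.differentiableAt_infty (hφ x hx)).hasFDerivAt.hasFDerivWithinAt)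
    φ.injOn (fun y => w y * coVolDensity F y)
  rw [φ.image_source_eq_target] at h
  rw [h]
  refine setIntegral_congr_fun φ.open_source.measurableSet fun x hx => ?_
  rw [coVolDensity_comp (ContDiffAt.differentiableAt_infty (hφ x hx))
    (ContDiffAt.differentiableAt_infty (hF _ (φ.map_source hx))), det_jacobian, smul_eq_mul]
  ring

/-- The coordinate expressions of the `H`-gradient in two charts agree, since both represent the
linear functional `m ↦ ∫ Φ (det L) · coBracket Φ F m · u · vol`, which does not depend on the chart. -/
theorem coHGrad_comp {Φ : ℝ → ℝ} (hΦ : ContDiff ℝ ∞ Φ) (hpos : ∀ s, 0 < Φ s)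
    (hφ : ∀ x ∈ φ.source, ContDiffAt ℝ ∞ φ x) (hφs : ∀ y ∈ φ.target, ContDiffAt ℝ ∞ φ.symm y)
    (hJ : ∀ x ∈ φ.source, 0 < (jacobian φ x).det)
    (hF : ∀ y ∈ φ.target, ContDiffAt ℝ ∞ F y) (hdet : ∀ y ∈ φ.target, (coMetric F y).det ≠ 0)
    {u : ESp d → ℝ} (hu : ∀ y ∈ φ.target, ContDiffAt ℝ ∞ u y) {x : ESp d} (hx : x ∈ φ.source) :
    coHGrad Φ (fun y => F (φ y)) (fun y => u (φ y)) x = coHGrad Φ F u (φ x) := by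
  have hFφ : ∀ x ∈ φ.source, ContDiffAt ℝ ∞ (fun y => F (φ y)) x :=
    fun x hx => (hF _ (φ.map_source hx)).comp x (hφ x hx)
  have huφ : ∀ x ∈ φ.source, ContDiffAt ℝ ∞ (fun y => u (φ y)) x :=
    fun x hx => (hu _ (φ.map_source hx)).comp x (hφ x hx)
  have hdetφ : ∀ x ∈ φ.source, (coMetric (fun y => F (φ y)) x).det ≠ 0 := fun x hx => by
    rw [det_coMetric_comp (ContDiffAt.differentiableAt_infty (hφ x hx))
      (ContDiffAt.differentiableAt_infty (hF _ (φ.map_source hx)))]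
    exact mul_ne_zero (pow_ne_zero _ (hJ x hx).ne') (hdet _ (φ.map_source hx))
  set Δ : ESp d → ESp (d + 1) := fun x =>
    coHGrad Φ (fun y => F (φ y)) (fun y => u (φ y)) x - coHGrad Φ F u (φ x) with hΔ
  have hΔs : ∀ x ∈ φ.source, ContDiffAt ℝ ∞ Δ x := fun x hx =>
    (contDiffAt_coHGrad hΦ hpos (hFφ x hx) (hdetφ x hx) (huφ x hx)).sub
      ((contDiffAt_coHGrad hΦ hpos (hF _ (φ.map_source hx)) (hdet _ (φ.map_source hx))
        (hu _ (φ.map_source hx))).comp x (hφ x hx))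
  set w : ESp d → ℝ := fun x => Φ (coDet (fun y => F (φ y)) x) * inner ℝ (Δ x) (Δ x)
    * coVolDensity (fun y => F (φ y)) x with hw
  have hwc : ContinuousOn w φ.source := fun x hx => by
    exact (((contDiffAt_comp_coDet hΦ (hFφ x hx) (hdetφ x hx)).mul ((hΔs x hx).inner ℝ (hΔs x hx))).mul
      (contDiffAt_coVolDensity (hFφ x hx) (hdetφ x hx))).continuousAt.continuousWithinAt
  -- the difference `Δ` of the two gradients is orthogonal to all test fields `g Δ`
  have hw0 : ∀ᵐ x ∂(volume : Measure (ESp d)), x ∈ φ.source → w x = 0 := by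
    refine φ.open_source.ae_eq_zero_of_integral_contDiff_smul_eq_zero
      (hwc.locallyIntegrableOn φ.open_source.measurableSet) fun g hg hgc hgs => ?_
    -- the test field `g Δ` in the second chart
    set m : ESp d → ESp (d + 1) := fun y => g (φ.symm y) • Δ (φ.symm y) with hm
    have hms : ∀ y ∈ φ.target, ContDiffAt ℝ ∞ m y := fun y hy =>
      (hg.contDiffAt.smul (hΔs _ (φ.map_target hy))).comp (f := φ.symm) y (hφs y hy)
    have hmφ : ∀ x ∈ φ.source, m (φ x) = g x • Δ x := fun x hx => by
      simp only [hm, φ.left_inv hx]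
    have hmφs : ∀ x ∈ φ.source, ContDiffAt ℝ ∞ (fun y => m (φ y)) x :=
      fun x hx => (hms _ (φ.map_source hx)).comp x (hφ x hx)
    have hKt : IsCompact (φ '' tsupport g) :=
      hgc.isCompact.image_of_continuousOn (φ.continuousOn.mono hgs)
    have hKt' : φ '' tsupport g ⊆ φ.target := by
      rintro _ ⟨x, hx, rfl⟩; exact φ.map_source (hgs hx)
    have hm0 : ∀ y ∈ φ.target, y ∉ φ '' tsupport g → m y = 0 := by
      intro y hy hyK
      have : φ.symm y ∉ tsupport g := fun h => hyK ⟨_, h, φ.right_inv hy⟩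
      simp only [hm, image_eq_zero_of_notMem_tsupport this, zero_smul]
    have hmφ0 : ∀ x ∈ φ.source, x ∉ tsupport g → m (φ x) = 0 := by
      intro x hx hxK
      rw [hmφ x hx, image_eq_zero_of_notMem_tsupport hxK, zero_smul]
    have e1 := setIntegral_coBracket φ.open_target hKt hKt' hΦ hpos hF hdet hms hu hm0
    have e2 := setIntegral_coBracket φ.open_source hgc.isCompact hgs hΦ hpos hFφ hdetφ hmφs huφ hmφ0
    rw [setIntegral_comp_chartChange hφ hF, setIntegral_comp_chartChange hφ hF] at e1
    have e3 : ∫ x in φ.source, Φ (coDet F (φ x)) * coBracket Φ F m (φ x) * u (φ x)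
          * coVolDensity (fun y => F (φ y)) x
        = ∫ x in φ.source, Φ (coDet (fun y => F (φ y)) x)
          * coBracket Φ (fun y => F (φ y)) (fun y => m (φ y)) x * u (φ x)
          * coVolDensity (fun y => F (φ y)) x := by
      refine setIntegral_congr_fun φ.open_source.measurableSet fun x hx => ?_
      have hy := φ.map_source hx
      rw [coDet_comp (hφ x hx) (hF _ hy) (hdet _ hy) (hJ x hx),
        coBracket_comp hΦ hpos ((φ.open_source.eventually_mem hx).mono hφ)
          ((φ.open_target.eventually_mem hy).mono hF) ((φ.open_target.eventually_mem hy).mono hms)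
          (hdet _ hy) (hJ x hx)]
    have hi : ∀ H : ESp d → ESp (d + 1), (∀ x ∈ φ.source, ContDiffAt ℝ ∞ H x) →
        IntegrableOn (fun x => Φ (coDet (fun y => F (φ y)) x) * inner ℝ (m (φ x)) (H x)
          * coVolDensity (fun y => F (φ y)) x) φ.source := by
      intro H hH
      refine integrableOn_of_compact φ.open_source hgc.isCompact hgs
        (fun x hx => ContinuousAt.continuousWithinAt ?_) ?_
      · exact (((contDiffAt_comp_coDet hΦ (hFφ x hx) (hdetφ x hx)).mul
          ((hmφs x hx).inner ℝ (hH x hx))).mul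
          (contDiffAt_coVolDensity (hFφ x hx) (hdetφ x hx))).continuousAt
      · intro x hx hxK
        simp [hmφ0 x hx hxK]
    have hi1 := hi _ fun x hx =>
      contDiffAt_coHGrad hΦ hpos (hFφ x hx) (hdetφ x hx) (huφ x hx)
    have hi2 := hi (fun x => coHGrad Φ F u (φ x)) fun x hx =>
      (contDiffAt_coHGrad hΦ hpos (hF _ (φ.map_source hx)) (hdet _ (φ.map_source hx))
        (hu _ (φ.map_source hx))).comp x (hφ x hx)
    have e4 : ∫ x in φ.source, Φ (coDet F (φ x)) * inner ℝ (m (φ x)) (coHGrad Φ F u (φ x))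
          * coVolDensity (fun y => F (φ y)) x
        = ∫ x in φ.source, Φ (coDet (fun y => F (φ y)) x)
          * inner ℝ (m (φ x)) (coHGrad Φ F u (φ x)) * coVolDensity (fun y => F (φ y)) x := by
      refine setIntegral_congr_fun φ.open_source.measurableSet fun x hx => ?_
      rw [coDet_comp (hφ x hx) (hF _ (φ.map_source hx)) (hdet _ (φ.map_source hx)) (hJ x hx)]
    have e5 : ∫ x in φ.source, g x • w x = 0 := by
      have e6 := integral_sub hi1 hi2
      rw [← e2, ← e4, ← e1, ← e3, sub_self] at e6
      rw [← e6]
      refine setIntegral_congr_fun φ.open_source.measurableSet fun x hx => ?_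
      simp only [hw]
      rw [hmφ x hx, ← sub_mul, ← mul_sub, ← inner_sub_right, real_inner_smul_left, smul_eq_mul]
      ring
    rw [← e5, ← integral_indicator φ.open_source.measurableSet]
    refine integral_congr_ae (Filter.Eventually.of_forall fun x => ?_)
    by_cases hx : x ∈ φ.source
    · simp only [Set.indicator_of_mem hx]
    · simp only [Set.indicator_of_notMem hx,
        image_eq_zero_of_notMem_tsupport (fun h => hx (hgs h)), zero_smul]
  have hw1 : Set.EqOn w 0 φ.source :=
    Measure.eqOn_open_of_ae_eq (μ := (volume : Measure (ESp d)))
      ((ae_restrict_iff' φ.open_source.measurableSet).2 hw0) φ.open_source hwc continuousOn_const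
  have h1 := hw1 hx
  simp only [hw, Pi.zero_apply, mul_eq_zero, inner_self_eq_zero, (hpos _).ne',
    (coVolDensity_pos (hdetφ x hx)).ne', or_false, false_or] at h1
  exact sub_eq_zero.1 h1

end WeakInvariance


/-! ### Smoothness and invariance on the manifold -/

section ManifoldCharts

variable {d : ℕ} {M : Type*} [TopologicalSpace M] [ChartedSpace (ESp d) M]
  {W : Type*} [NormedAddCommGroup W] [NormedSpace ℝ W]
  {P : Type*} [NormedAddCommGroup P] [NormedSpace ℝ P]

/-- The change of coordinates from the preferred chart at `i` to the preferred chart at `j`. -/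
def transition (d : ℕ) {M : Type*} [TopologicalSpace M] [ChartedSpace (ESp d) M] (i j : M) :
    OpenPartialHomeomorph (ESp d) (ESp d) :=
  (chartAt (ESp d) i).symm ≫ₕ chartAt (ESp d) j

theorem mem_transition_source {i j : M} {x : ESp d} :
    x ∈ (transition d i j).source ↔
      x ∈ (chartAt (ESp d) i).target ∧ (chartAt (ESp d) i).symm x ∈ (chartAt (ESp d) j).source := by
  simp [transition]

theorem transition_symm (i j : M) : (transition d i j).symm = transition d j i := by
  simp [transition, OpenPartialHomeomorph.trans_symm_eq_symm_trans_symm]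

theorem mem_transition_target {i j : M} {y : ESp d} :
    y ∈ (transition d i j).target ↔
      y ∈ (chartAt (ESp d) j).target ∧ (chartAt (ESp d) j).symm y ∈ (chartAt (ESp d) i).source := by
  rw [← OpenPartialHomeomorph.symm_source, transition_symm, mem_transition_source]

theorem inChart_transition {V : Type*} (u : M → V) {i j : M} {x : ESp d}
    (hx : x ∈ (transition d i j).source) :
    inChart j u (transition d i j x) = inChart i u x := by
  rw [mem_transition_source] at hx
  simp only [inChart, transition, Function.comp, OpenPartialHomeomorph.coe_trans]
  rw [(chartAt (ESp d) j).left_inv hx.2]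

theorem inChart_eventuallyEq {V : Type*} (u : M → V) {i j : M} {x : ESp d}
    (hx : x ∈ (transition d i j).source) :
    inChart i u =ᶠ[𝓝 x] fun y => inChart j u (transition d i j y) :=
  ((transition d i j).open_source.eventually_mem hx).mono fun _ hy => (inChart_transition u hy).symm

theorem inChart_pt {V : Type*} (u : M → V) (p : M) : inChart p u (pt (d := d) p) = u p := by
  simp [inChart, pt]

theorem pt_mem_target (p : M) : pt (d := d) p ∈ (chartAt (ESp d) p).target :=
  mem_chart_target _ p

theorem det_transition_pos (hor : OrientedAtlas d M) {i j : M} {x : ESp d}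
    (hx : x ∈ (transition d i j).source) : 0 < (jacobian (transition d i j) x).det := by
  rw [det_jacobian]
  exact hor _ (chart_mem_atlas _ i) _ (chart_mem_atlas _ j) x hx

/-- Smoothness of a map on `M` that depends on a parameter, expressed in the preferred charts. -/
def SmoothFam (d : ℕ) {M : Type*} [TopologicalSpace M] [ChartedSpace (ESp d) M] (O : Set P)
    (c : P → M → W) : Prop :=
  ∀ i : M, ∀ q ∈ O, ∀ x ∈ (chartAt (ESp d) i).target, SmAt (fun q => inChart i (c q)) q x

/-- Smoothness of a map on `M`, expressed in the preferred charts. -/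
def SmoothMap (d : ℕ) {M : Type*} [TopologicalSpace M] [ChartedSpace (ESp d) M]
    (u : M → W) : Prop :=
  ∀ i : M, ∀ x ∈ (chartAt (ESp d) i).target, ContDiffAt ℝ ∞ (inChart i u) x

theorem SmoothFam.slice {O : Set P} {c : P → M → W} (hc : SmoothFam d O c) {q : P} (hq : q ∈ O) :
    SmoothMap d (c q) := fun i x hx => (hc i q hq x hx).slice

theorem SmoothMap.fam {u : M → W} (hu : SmoothMap d u) (O : Set P) :
    SmoothFam d O (fun _ => u) := fun i q _ x hx => SmAt.of_slice P q (hu i x hx)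

variable [IsManifold (𝓡 d) ∞ M]

theorem contDiffAt_transition {i j : M} {x : ESp d} (hx : x ∈ (transition d i j).source) :
    ContDiffAt ℝ ∞ (transition d i j) x := by
  have h1 : ContMDiffOn (𝓡 d) (𝓡 d) ∞ (transition d i j) (transition d i j).source := by
    have h2 := contMDiffOn_chart_symm (I := 𝓡 d) (n := ∞) (x := i)
    have h3 := contMDiffOn_chart (I := 𝓡 d) (n := ∞) (x := j)
    refine h3.comp (h2.mono fun y hy => (mem_transition_source.1 hy).1) fun y hy => ?_
    exact (mem_transition_source.1 hy).2
  exact (contMDiffOn_iff_contDiffOn.1 h1).contDiffAt ((transition d i j).open_source.mem_nhds hx)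

theorem contMDiff_iff_smoothMap {u : M → W} :
    ContMDiff (𝓡 d) 𝓘(ℝ, W) ∞ u ↔ SmoothMap d u := by
  constructor
  · intro h i x hx
    have h1 : ContMDiffOn (𝓡 d) 𝓘(ℝ, W) ∞ (inChart i u) (chartAt (ESp d) i).target :=
      h.comp_contMDiffOn (contMDiffOn_chart_symm (I := 𝓡 d) (n := ∞) (x := i))
    exact (contMDiffOn_iff_contDiffOn.1 h1).contDiffAt ((chartAt (ESp d) i).open_target.mem_nhds hx)
  · intro h p
    have h1 : ContMDiffAt (𝓡 d) 𝓘(ℝ, W) ∞ (inChart p u ∘ chartAt (ESp d) p) p :=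
      ContMDiffAt.comp (I' := 𝓡 d) (g := inChart p u) (f := chartAt (ESp d) p) p
        (h p _ (pt_mem_target p)).contMDiffAt
        (contMDiffAt_of_mem_maximalAtlas (IsManifold.chart_mem_maximalAtlas p) (mem_chart_source _ p))
    refine h1.congr_of_eventuallyEq ?_
    filter_upwards [(chartAt (ESp d) p).open_source.mem_nhds (mem_chart_source _ p)] with q hq
    simp [inChart, (chartAt (ESp d) p).left_inv hq]

theorem contMDiffOn_param_chart (O : Set P) (i : M) :
    ContMDiffOn 𝓘(ℝ, P × ESp d) (𝓡 d) ∞ (fun z : P × ESp d => (chartAt (ESp d) i).symm z.2)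
      (O ×ˢ (chartAt (ESp d) i).target) := by
  refine (contMDiffOn_chart_symm (I := 𝓡 d) (n := ∞) (x := i)).comp
    (contDiff_snd.contMDiff.contMDiffOn) ?_
  intro z hz
  exact hz.2

theorem smoothFam_of_contMDiffOn {O : Set ℝ} (hO : IsOpen O) {c : ℝ → M → W}
    (hc : ContMDiffOn (𝓘(ℝ, ℝ).prod (𝓡 d)) 𝓘(ℝ, W) ∞ (fun q : ℝ × M => c q.1 q.2)
      (O ×ˢ Set.univ)) : SmoothFam d O c := by
  intro i q hq x hx
  have h1 : ContMDiffOn 𝓘(ℝ, ℝ × ESp d) 𝓘(ℝ, ℝ) ∞ (fun z : ℝ × ESp d => z.1)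
      (O ×ˢ (chartAt (ESp d) i).target) := contDiff_fst.contMDiff.contMDiffOn
  have h2 := hc.comp (h1.prodMk (contMDiffOn_param_chart O i)) fun z hz => ⟨hz.1, Set.mem_univ _⟩
  exact (contMDiffOn_iff_contDiffOn.1 h2).contDiffAt
    ((hO.prod (chartAt (ESp d) i).open_target).mem_nhds ⟨hq, hx⟩)

theorem smoothFam_of_contMDiffOn₂ {J : Set ℝ} (hJ : IsOpen J) {c : ℝ → ℝ → M → W}
    (hc : ContMDiffOn (𝓘(ℝ, ℝ).prod (𝓘(ℝ, ℝ).prod (𝓡 d))) 𝓘(ℝ, W) ∞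
      (fun q : ℝ × ℝ × M => c q.1 q.2.1 q.2.2) (Set.univ ×ˢ J ×ˢ Set.univ)) :
    SmoothFam d (Set.univ ×ˢ J) (fun q : ℝ × ℝ => c q.1 q.2) := by
  intro i q hq x hx
  have h1 : ContMDiffOn 𝓘(ℝ, (ℝ × ℝ) × ESp d) 𝓘(ℝ, ℝ) ∞ (fun z : (ℝ × ℝ) × ESp d => z.1.1)
      ((Set.univ ×ˢ J) ×ˢ (chartAt (ESp d) i).target) :=
    (contDiff_fst.fst).contMDiff.contMDiffOn
  have h2 : ContMDiffOn 𝓘(ℝ, (ℝ × ℝ) × ESp d) 𝓘(ℝ, ℝ) ∞ (fun z : (ℝ × ℝ) × ESp d => z.1.2)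
      ((Set.univ ×ˢ J) ×ˢ (chartAt (ESp d) i).target) :=
    (contDiff_fst.snd).contMDiff.contMDiffOn
  have h3 := hc.comp (h1.prodMk (h2.prodMk (contMDiffOn_param_chart (Set.univ ×ˢ J) i)))
    fun z hz => ⟨Set.mem_univ _, hz.1.2, Set.mem_univ _⟩
  exact (contMDiffOn_iff_contDiffOn.1 h3).contDiffAt
    (((isOpen_univ.prod hJ).prod (chartAt (ESp d) i).open_target).mem_nhds ⟨hq, hx⟩)

/-- An immersion, expressed in the preferred charts. -/
def ImmMap (f : M → ESp (d + 1)) : Prop :=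
  ∀ i : M, ∀ x ∈ (chartAt (ESp d) i).target, (coMetric (inChart i f) x).det ≠ 0

theorem injective_mfderiv_iff {f : M → ESp (d + 1)} (hf : ContMDiff (𝓡 d) 𝓘(ℝ, ESp (d + 1)) ∞ f)
    {i : M} {x : ESp d} (hx : x ∈ (chartAt (ESp d) i).target) :
    (coMetric (inChart i f) x).det ≠ 0 ↔ Function.Injective
      (mfderiv (𝓡 d) 𝓘(ℝ, ESp (d + 1)) f ((chartAt (ESp d) i).symm x)) := by
  have he := mdifferentiable_chart (I := 𝓡 d) i
  have h1 : HasMFDerivAt (𝓡 d) (𝓡 d) (chartAt (ESp d) i).symm x (he.symm.mfderiv hx) :=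
    (he.symm.mdifferentiableAt hx).hasMFDerivAt
  have h2 := (hf.mdifferentiableAt (x := (chartAt (ESp d) i).symm x) (by simp)).hasMFDerivAt
  have h3 := h2.comp x h1
  have h6 : ∀ v, fderiv ℝ (inChart i f) x v
      = mfderiv (𝓡 d) 𝓘(ℝ, ESp (d + 1)) f ((chartAt (ESp d) i).symm x) (he.symm.mfderiv hx v) :=
    fun v => by
      rw [← mfderiv_eq_fderiv]
      exact DFunLike.congr_fun h3.mfderiv v
  have h5 := (he.symm.mfderiv hx).bijective
  refine det_coMetric_ne_zero_iff.trans ⟨fun h a b hab => ?_, fun h a b hab => ?_⟩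
  · obtain ⟨a, rfl⟩ := h5.2 a
    obtain ⟨b, rfl⟩ := h5.2 b
    exact congrArg _ (h ((h6 a).trans (hab.trans (h6 b).symm)))
  · exact h5.1 (h ((h6 a).symm.trans (hab.trans (h6 b))))

theorem smoothImm_iff {f : M → ESp (d + 1)} : SmoothImm f ↔ SmoothMap d f ∧ ImmMap f := by
  rw [SmoothImm, contMDiff_iff_smoothMap]
  refine and_congr_right fun hf => ⟨fun h i x hx => ?_, fun h p => ?_⟩
  · exact (injective_mfderiv_iff (contMDiff_iff_smoothMap.2 hf) hx).2 (h _)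
  · have := (injective_mfderiv_iff (contMDiff_iff_smoothMap.2 hf) (pt_mem_target p)).1
      (h p _ (pt_mem_target p))
    rwa [pt, (chartAt (ESp d) p).left_inv (mem_chart_source _ p)] at this

end ManifoldCharts


/-! ### Dependence on germs -/

section Germs

variable {d : ℕ} {F F' m m' : ESp d → ESp (d + 1)} {u u' : ESp d → ℝ} {x : ESp d}

theorem coMetric_congr (h : F =ᶠ[𝓝 x] F') : coMetric F x = coMetric F' x := by
  simp only [coMetric, pd_congr _ h]

theorem coMetricInv_congr (h : F =ᶠ[𝓝 x] F') : coMetricInv F x = coMetricInv F' x := by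
  simp only [coMetricInv, coMetric_congr h]

theorem coChristoffel_congr (h : F =ᶠ[𝓝 x] F') (k i j : Fin d) :
    coChristoffel F x k i j = coChristoffel F' x k i j := by
  have he : ∀ a b, (fun y => coMetric F y a b) =ᶠ[𝓝 x] fun y => coMetric F' y a b :=
    fun a b => h.eventuallyEq_nhds.mono fun y hy => by simp only [coMetric_congr hy]
  simp only [coChristoffel, coMetricInv_congr h, pd_congr _ (he _ _)]

theorem coNormal_congr (h : F =ᶠ[𝓝 x] F') : coNormal F x = coNormal F' x := by
  simp only [coNormal, coCross, pd_congr _ h]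

theorem coWeingarten_congr (h : F =ᶠ[𝓝 x] F') : coWeingarten F x = coWeingarten F' x := by
  have he : coNormal F =ᶠ[𝓝 x] coNormal F' := h.eventuallyEq_nhds.mono fun y hy => coNormal_congr hy
  simp only [coWeingarten, coSecond, coMetricInv_congr h, pd_congr _ h, pd_congr _ he]

theorem coDet_congr (h : F =ᶠ[𝓝 x] F') : coDet F x = coDet F' x := by
  simp only [coDet, coWeingarten_congr h]

theorem coMetricAdj_congr (h : F =ᶠ[𝓝 x] F') : coMetricAdj F x = coMetricAdj F' x := by
  simp only [coMetricAdj, coMetric_congr h, coWeingarten_congr h]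

theorem coHess_congr (h : F =ᶠ[𝓝 x] F') (hu : u =ᶠ[𝓝 x] u') : coHess F u x = coHess F' u' x := by
  simp only [coHess, coChristoffel_congr h, pd_congr _ hu, pd_congr _ (pd_eventuallyEq _ hu)]

theorem coPairing_congr (h : F =ᶠ[𝓝 x] F') (B C : Matrix (Fin d) (Fin d) ℝ) :
    coPairing F x B C = coPairing F' x B C := by
  simp only [coPairing, coMetricInv_congr h]

theorem coTan_congr (h : F =ᶠ[𝓝 x] F') (hm : m x = m' x) (i : Fin d) :
    coTan F m x i = coTan F' m' x i := by
  simp only [coTan, coMetricInv_congr h, pd_congr _ h, hm]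

theorem coDiv_congr {X X' : ESp d → Fin d → ℝ} (h : F =ᶠ[𝓝 x] F') (hX : X =ᶠ[𝓝 x] X') :
    coDiv F X x = coDiv F' X' x := by
  have he : ∀ i, (fun y => X y i) =ᶠ[𝓝 x] fun y => X' y i :=
    fun i => hX.mono fun y hy => congrFun hy i
  simp only [coDiv, coChristoffel_congr h, pd_congr _ (he _), hX.self_of_nhds]

theorem coAdj₂_congr {B B' : ESp d → Matrix (Fin d) (Fin d) ℝ} (h : F =ᶠ[𝓝 x] F')
    (hB : B =ᶠ[𝓝 x] B') : coAdj₂ F B x = coAdj₂ F' B' x := by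
  have he : ∀ i j, (fun y => B y i j) =ᶠ[𝓝 x] fun y => B' y i j :=
    fun i j => hB.mono fun y hy => congrFun (congrFun hy i) j
  ext j
  simp only [coAdj₂, coCov₂, coMetricInv_congr h, coChristoffel_congr h, pd_congr _ (he _ _),
    hB.self_of_nhds]

theorem coAdj₁_congr {θ θ' : ESp d → Fin d → ℝ} (h : F =ᶠ[𝓝 x] F') (hθ : θ =ᶠ[𝓝 x] θ') :
    coAdj₁ F θ x = coAdj₁ F' θ' x := by
  have he : ∀ i, (fun y => θ y i) =ᶠ[𝓝 x] fun y => θ' y i :=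
    fun i => hθ.mono fun y hy => congrFun hy i
  simp only [coAdj₁, coCov₁, coMetricInv_congr h, coChristoffel_congr h, pd_congr _ (he _),
    hθ.self_of_nhds]

theorem coAdj₁_coAdj₂_congr {B B' : ESp d → Matrix (Fin d) (Fin d) ℝ} (h : F =ᶠ[𝓝 x] F')
    (hB : B =ᶠ[𝓝 x] B') : coAdj₁ F (coAdj₂ F B) x = coAdj₁ F' (coAdj₂ F' B') x :=
  coAdj₁_congr h ((h.eventuallyEq_nhds.and hB.eventuallyEq_nhds).mono
    fun _ hy => coAdj₂_congr hy.1 hy.2)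

theorem coPush_coGrad_congr (h : F =ᶠ[𝓝 x] F') (hu : u =ᶠ[𝓝 x] u') :
    coPush F (coGrad F u x) x = coPush F' (coGrad F' u' x) x := by
  simp only [coPush, coGrad, coMetricInv_congr h, pd_congr _ h, pd_congr _ hu]

theorem coDet_eventuallyEq (h : F =ᶠ[𝓝 x] F') : coDet F =ᶠ[𝓝 x] coDet F' :=
  h.eventuallyEq_nhds.mono fun _ hy => coDet_congr hy

theorem coBracket_congr {Φ : ℝ → ℝ} (h : F =ᶠ[𝓝 x] F') (hm : m =ᶠ[𝓝 x] m') :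
    coBracket Φ F m x = coBracket Φ F' m' x := by
  have h1 : (fun y => (inner ℝ (m y) (coNormal F y) : ℝ)) =ᶠ[𝓝 x]
      fun y => inner ℝ (m' y) (coNormal F' y) := by
    filter_upwards [h.eventuallyEq_nhds, hm] with y hy hy2
    rw [coNormal_congr hy, hy2]
  have h2 : coTan F m =ᶠ[𝓝 x] coTan F' m' := by
    filter_upwards [h.eventuallyEq_nhds, hm] with y hy hy2
    ext i
    exact coTan_congr hy hy2 i
  simp only [coBracket, coDet_congr h, coWeingarten_congr h, coPairing_congr h, coMetricAdj_congr h,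
    coHess_congr h h1, h2.self_of_nhds, coDiv_congr h h2,
    pd_congr _ (coDet_eventuallyEq h), hm.self_of_nhds, coNormal_congr h]

theorem coHGrad_congr {Φ : ℝ → ℝ} (h : F =ᶠ[𝓝 x] F') (hu : u =ᶠ[𝓝 x] u') :
    coHGrad Φ F u x = coHGrad Φ F' u' x := by
  have hD := coDet_eventuallyEq h
  have h1 : (fun y => (deriv Φ (coDet F y) * u y) • coMetricAdj F y) =ᶠ[𝓝 x]
      fun y => (deriv Φ (coDet F' y) * u' y) • coMetricAdj F' y := by
    filter_upwards [h.eventuallyEq_nhds, hu, hD] with y hy hy2 hy3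
    rw [coMetricAdj_congr hy, hy2, hy3]
  have h2 : (fun y => Φ (coDet F y) * u y) =ᶠ[𝓝 x] fun y => Φ (coDet F' y) * u' y := by
    filter_upwards [hu, hD] with y hy hy2
    rw [hy, hy2]
  simp only [coHGrad, coDet_congr h, coWeingarten_congr h, coAdj₁_coAdj₂_congr h h1,
    hu.self_of_nhds, coNormal_congr h, coPush_coGrad_congr h hD, coPush_coGrad_congr h h2]

end Germs

/-! ### The gradients on the manifold in coordinates -/

section Invariance

variable {d : ℕ} {M : Type*} [TopologicalSpace M] [ChartedSpace (ESp d) M]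

theorem eventually_inChart_contDiffAt {W : Type*} [NormedAddCommGroup W] [NormedSpace ℝ W]
    {u : M → W} (hu : SmoothMap d u) {i : M} {x : ESp d} (hx : x ∈ (chartAt (ESp d) i).target) :
    ∀ᶠ y in 𝓝 x, ContDiffAt ℝ ∞ (inChart i u) y :=
  ((chartAt (ESp d) i).open_target.eventually_mem hx).mono fun y hy => hu i y hy

theorem eq_perp_add_pushTan {f h : M → ESp (d + 1)} (hi : ImmMap f) (p : M) :
    h p = perp f h p • normal f p + pushTan f h p := by
  have h1 := eq_normal_add_tangent (hi p _ (pt_mem_target p)) (h p)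
  simp only [perp, normal, pushTan, coPush, coTan, inChart_pt]
  exact h1

variable [IsManifold (𝓡 d) ∞ M] {f h k m : M → ESp (d + 1)} {i : M} {x : ESp d}

/-- `det L`, defined at each point in the preferred chart there, is computed in every chart. -/
theorem inChart_detL (hor : OrientedAtlas d M) (hf : SmoothMap d f) (hi : ImmMap f)
    (hx : x ∈ (chartAt (ESp d) i).target) : inChart i (detL f) x = coDet (inChart i f) x := by
  set p := (chartAt (ESp d) i).symm x with hp
  have hx' : x ∈ (transition d i p).source := mem_transition_source.2 ⟨hx, mem_chart_source _ _⟩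
  have h1 : transition d i p x = pt p := rfl
  rw [coDet_congr (inChart_eventuallyEq f hx'), coDet_comp (F := inChart p f)
    (contDiffAt_transition hx') (h1 ▸ hf p _ (pt_mem_target p))
    (h1 ▸ hi p _ (pt_mem_target p)) (det_transition_pos hor hx')]
  rfl

theorem inChart_normal (hor : OrientedAtlas d M) (hf : SmoothMap d f)
    (hx : x ∈ (chartAt (ESp d) i).target) : inChart i (normal f) x = coNormal (inChart i f) x := by
  set p := (chartAt (ESp d) i).symm x with hp
  have hx' : x ∈ (transition d i p).source := mem_transition_source.2 ⟨hx, mem_chart_source _ _⟩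
  have h1 : transition d i p x = pt p := rfl
  rw [coNormal_congr (inChart_eventuallyEq f hx'), coNormal_comp (F := inChart p f)
    (ContDiffAt.differentiableAt_infty (contDiffAt_transition hx'))
    (h1 ▸ ContDiffAt.differentiableAt_infty (hf p _ (pt_mem_target p)))
    (det_transition_pos hor hx')]
  rfl

theorem inChart_detL_eventuallyEq (hor : OrientedAtlas d M) (hf : SmoothMap d f) (hi : ImmMap f)
    (hx : x ∈ (chartAt (ESp d) i).target) :
    inChart i (detL f) =ᶠ[𝓝 x] coDet (inChart i f) :=
  ((chartAt (ESp d) i).open_target.eventually_mem hx).mono fun _ hy => inChart_detL hor hf hi hy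

theorem inChart_perp_eventuallyEq (hor : OrientedAtlas d M) (hf : SmoothMap d f)
    (hx : x ∈ (chartAt (ESp d) i).target) :
    inChart i (perp f m) =ᶠ[𝓝 x] fun y => inner ℝ (inChart i m y) (coNormal (inChart i f) y) :=
  ((chartAt (ESp d) i).open_target.eventually_mem hx).mono fun y hy => by
    beta_reduce
    rw [← inChart_normal hor hf hy]; rfl

/-- The scalar factor of the `K`-gradient. -/
noncomputable def bracket (Φ : ℝ → ℝ) (f m : M → ESp (d + 1)) (p : M) : ℝ :=
  coBracket Φ (inChart p f) (inChart p m) (pt p)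

theorem KForm_eq {Φ : ℝ → ℝ} (hor : OrientedAtlas d M) (hf : SmoothMap d f) (hi : ImmMap f) (p : M) :
    KForm Φ f m h p = bracket Φ f m p • h p := by
  have hp := pt_mem_target (d := d) p
  have h1 := inChart_perp_eventuallyEq (m := m) hor hf hp
  have h2 := inChart_detL_eventuallyEq hor hf hi hp
  have h3 : perp f m p = inner ℝ (inChart p m (pt (d := d) p)) (coNormal (inChart p f) (pt p)) := by
    have := h1.self_of_nhds
    rw [inChart_pt] at this
    exact this
  simp only [KForm, bracket, coBracket, adjHess, dTan, divTan, h3]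
  rw [coHess_congr (Filter.EventuallyEq.refl _ _) h1]
  simp only [pd_congr _ h2]
  rfl

/-- The scalar factor of the `K`-gradient is computed in every chart. -/
theorem inChart_bracket {Φ : ℝ → ℝ} (hΦ : ContDiff ℝ ∞ Φ) (hpos : ∀ s, 0 < Φ s)
    (hor : OrientedAtlas d M) (hf : SmoothMap d f) (hi : ImmMap f) (hm : SmoothMap d m)
    (hx : x ∈ (chartAt (ESp d) i).target) :
    inChart i (bracket Φ f m) x = coBracket Φ (inChart i f) (inChart i m) x := by
  set p := (chartAt (ESp d) i).symm x with hp
  have hx' : x ∈ (transition d i p).source := mem_transition_source.2 ⟨hx, mem_chart_source _ _⟩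
  have h1 : transition d i p x = pt p := rfl
  have hφ : ∀ᶠ y in 𝓝 x, ContDiffAt ℝ ∞ (transition d i p) y :=
    ((transition d i p).open_source.eventually_mem hx').mono fun y hy => contDiffAt_transition hy
  rw [coBracket_congr (inChart_eventuallyEq f hx') (inChart_eventuallyEq m hx'),
    coBracket_comp (F := inChart p f) (m := inChart p m) hΦ hpos hφ
    (h1 ▸ eventually_inChart_contDiffAt hf (pt_mem_target p))
    (h1 ▸ eventually_inChart_contDiffAt hm (pt_mem_target p))
    (h1 ▸ hi p _ (pt_mem_target p)) (det_transition_pos hor hx')]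
  rfl

theorem HForm_eq {Φ : ℝ → ℝ} (hor : OrientedAtlas d M) (hf : SmoothMap d f) (hi : ImmMap f) (p : M) :
    HForm Φ f h k p = coHGrad Φ (inChart p f)
      (fun y => inner ℝ (inChart p h y) (inChart p k y)) (pt p) := by
  have hp := pt_mem_target (d := d) p
  have h2 := inChart_detL_eventuallyEq hor hf hi hp
  have h3 : (fun x : ESp d => inChart p (fun q => deriv Φ (detL f q) * inner ℝ (h q) (k q)) x
      • coMetricAdj (inChart p f) x) =ᶠ[𝓝 (pt p)] fun y => (deriv Φ (coDet (inChart p f) y)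
        * inner ℝ (inChart p h y) (inChart p k y)) • coMetricAdj (inChart p f) y :=
    h2.mono fun y hy => by
      beta_reduce
      rw [← hy]; rfl
  have h4 : inChart p (fun q => Φ (detL f q) * inner ℝ (h q) (k q)) =ᶠ[𝓝 (pt p)]
      fun y => Φ (coDet (inChart p f) y) * inner ℝ (inChart p h y) (inChart p k y) :=
    h2.mono fun y hy => by
      beta_reduce
      rw [← hy]; rfl
  have h5 := Filter.EventuallyEq.refl (𝓝 (pt (d := d) p)) (inChart p f)
  simp only [HForm, coHGrad, adjAdj, pushGrad, inChart_pt]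
  rw [coAdj₁_coAdj₂_congr h5 h3, coPush_coGrad_congr h5 h2, coPush_coGrad_congr h5 h4]
  rfl

/-- The `H`-gradient is computed in every chart. -/
theorem inChart_HForm {Φ : ℝ → ℝ} (hΦ : ContDiff ℝ ∞ Φ) (hpos : ∀ s, 0 < Φ s)
    (hor : OrientedAtlas d M) (hf : SmoothMap d f) (hi : ImmMap f) (hh : SmoothMap d h)
    (hk : SmoothMap d k) (hx : x ∈ (chartAt (ESp d) i).target) :
    inChart i (HForm Φ f h k) x = coHGrad Φ (inChart i f)
      (fun y => inner ℝ (inChart i h y) (inChart i k y)) x := by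
  set p := (chartAt (ESp d) i).symm x with hp
  have hx' : x ∈ (transition d i p).source := mem_transition_source.2 ⟨hx, mem_chart_source _ _⟩
  have h0 : ∀ y ∈ (transition d i p).target, y ∈ (chartAt (ESp d) p).target :=
    fun y hy => (mem_transition_target.1 hy).1
  have hu : (fun y => (inner ℝ (inChart i h y) (inChart i k y) : ℝ)) =ᶠ[𝓝 x]
      fun y => inner ℝ (inChart p h (transition d i p y)) (inChart p k (transition d i p y)) := by
    filter_upwards [inChart_eventuallyEq h hx', inChart_eventuallyEq k hx'] with y h1 h2
    rw [h1, h2]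
  rw [coHGrad_congr (inChart_eventuallyEq f hx') hu, coHGrad_comp (F := inChart p f)
    (u := fun y => inner ℝ (inChart p h y) (inChart p k y)) hΦ hpos
    (fun y hy => contDiffAt_transition hy)
    (fun y hy => by
      rw [← OpenPartialHomeomorph.symm_source, transition_symm] at hy
      rw [transition_symm]
      exact contDiffAt_transition hy)
    (fun y hy => det_transition_pos hor hy) (fun y hy => hf p y (h0 y hy))
    (fun y hy => hi p y (h0 y hy)) (fun y hy => (hh p y (h0 y hy)).inner ℝ (hk p y (h0 y hy))) hx']
  exact HForm_eq hor hf hi p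

theorem smoothMap_bracket {Φ : ℝ → ℝ} (hΦ : ContDiff ℝ ∞ Φ) (hpos : ∀ s, 0 < Φ s)
    (hor : OrientedAtlas d M) (hf : SmoothMap d f) (hi : ImmMap f) (hm : SmoothMap d m) :
    SmoothMap d (bracket Φ f m) := fun i x hx =>
  (contDiffAt_coBracket hΦ hpos (hf i x hx) (hi i x hx) (hm i x hx)).congr_of_eventuallyEq
    (((chartAt (ESp d) i).open_target.eventually_mem hx).mono
      fun _ hy => inChart_bracket hΦ hpos hor hf hi hm hy)

theorem smoothMap_KForm {Φ : ℝ → ℝ} (hΦ : ContDiff ℝ ∞ Φ) (hpos : ∀ s, 0 < Φ s)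
    (hor : OrientedAtlas d M) (hf : SmoothMap d f) (hi : ImmMap f) (hm : SmoothMap d m)
    (hh : SmoothMap d h) : SmoothMap d (KForm Φ f m h) := by
  have e : KForm Φ f m h = fun p => bracket Φ f m p • h p := funext fun p => KForm_eq hor hf hi p
  rw [e]
  exact fun i x hx => (smoothMap_bracket hΦ hpos hor hf hi hm i x hx).smul (hh i x hx)

theorem smoothMap_HForm {Φ : ℝ → ℝ} (hΦ : ContDiff ℝ ∞ Φ) (hpos : ∀ s, 0 < Φ s)
    (hor : OrientedAtlas d M) (hf : SmoothMap d f) (hi : ImmMap f) (hh : SmoothMap d h)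
    (hk : SmoothMap d k) : SmoothMap d (HForm Φ f h k) := fun i x hx =>
  (contDiffAt_coHGrad hΦ hpos (hf i x hx) (hi i x hx)
    ((hh i x hx).inner ℝ (hk i x hx))).congr_of_eventuallyEq
    (((chartAt (ESp d) i).open_target.eventually_mem hx).mono
      fun _ hy => inChart_HForm hΦ hpos hor hf hi hh hk hy)

theorem smoothMap_detL (hor : OrientedAtlas d M) (hf : SmoothMap d f) (hi : ImmMap f) :
    SmoothMap d (detL f) := fun i x hx =>
  (contDiffAt_coDet (hf i x hx) (hi i x hx)).congr_of_eventuallyEq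
    (inChart_detL_eventuallyEq hor hf hi hx)

end Invariance


/-! ### Integration on the manifold -/

section SmoothOperations

variable {d : ℕ} {M : Type*} [TopologicalSpace M] [ChartedSpace (ESp d) M]

theorem continuousOn_inChart {V : Type*} [NormedAddCommGroup V] [NormedSpace ℝ V] {u : M → V}
    (hu : SmoothMap d u) (i : M) : ContinuousOn (inChart i u) (chartAt (ESp d) i).target :=
  fun x hx => (hu i x hx).continuousAt.continuousWithinAt

theorem continuousOn_coVolDensity {f : M → ESp (d + 1)} (hf : SmoothMap d f) (hi : ImmMap f)
    (i : M) : ContinuousOn (coVolDensity (inChart i f)) (chartAt (ESp d) i).target :=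
  fun x hx => (contDiffAt_coVolDensity (hf i x hx) (hi i x hx)).continuousAt.continuousWithinAt

theorem smoothMap_add {V : Type*} [NormedAddCommGroup V] [NormedSpace ℝ V] {u v : M → V}
    (hu : SmoothMap d u) (hv : SmoothMap d v) :
    SmoothMap d (fun p => u p + v p) := fun i x hx => (hu i x hx).add (hv i x hx)

theorem smoothMap_sub {V : Type*} [NormedAddCommGroup V] [NormedSpace ℝ V] {u v : M → V}
    (hu : SmoothMap d u) (hv : SmoothMap d v) :
    SmoothMap d (fun p => u p - v p) := fun i x hx => (hu i x hx).sub (hv i x hx)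

theorem smoothMap_mul {u v : M → ℝ} (hu : SmoothMap d u) (hv : SmoothMap d v) :
    SmoothMap d (fun p => u p * v p) := fun i x hx => (hu i x hx).mul (hv i x hx)

theorem smoothMap_smul {V : Type*} [NormedAddCommGroup V] [NormedSpace ℝ V] {u : M → ℝ} {v : M → V}
    (hu : SmoothMap d u) (hv : SmoothMap d v) :
    SmoothMap d (fun p => u p • v p) := fun i x hx => (hu i x hx).smul (hv i x hx)

theorem smoothMap_inner {n : ℕ} {u v : M → ESp n} (hu : SmoothMap d u) (hv : SmoothMap d v) :
    SmoothMap d (fun p => (inner ℝ (u p) (v p) : ℝ)) := fun i x hx => (hu i x hx).inner ℝ (hv i x hx)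

theorem smoothMap_comp {Φ : ℝ → ℝ} (hΦ : ContDiff ℝ ∞ Φ) {u : M → ℝ} (hu : SmoothMap d u) :
    SmoothMap d (fun p => Φ (u p)) := fun i x hx => hΦ.contDiffAt.comp x (hu i x hx)

end SmoothOperations

section Integration

open MeasureTheory

variable {d : ℕ} {M : Type*} [TopologicalSpace M] [ChartedSpace (ESp d) M]
  [IsManifold (𝓡 d) ∞ M] [T2Space M] [CompactSpace M]

theorem tsupport_chartPartition_subset (i : M) :
    tsupport (chartPartition d M i) ⊆ (chartAt (ESp d) i).source :=
  (exists_chartPartition d M).choose_spec i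

theorem finite_chartPartition (d : ℕ) (M : Type*) [TopologicalSpace M] [ChartedSpace (ESp d) M]
    [IsManifold (𝓡 d) ∞ M] [T2Space M] [CompactSpace M] :
    {i : M | (Function.support (chartPartition d M i)).Nonempty}.Finite :=
  (chartPartition d M).locallyFinite.finite_nonempty_of_compact

/-- The indices of the nonzero functions of the partition of unity. -/
noncomputable def partitionIndex (d : ℕ) (M : Type*) [TopologicalSpace M] [ChartedSpace (ESp d) M]
    [IsManifold (𝓡 d) ∞ M] [T2Space M] [CompactSpace M] : Finset M :=
  (finite_chartPartition d M).toFinset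

theorem chartPartition_eq_zero {i : M} (hi : i ∉ partitionIndex d M) (p : M) :
    chartPartition d M i p = 0 := by
  by_contra h
  exact hi ((finite_chartPartition d M).mem_toFinset.2 ⟨p, h⟩)

theorem sum_chartPartition (p : M) : ∑ i ∈ partitionIndex d M, chartPartition d M i p = 1 := by
  rw [← (chartPartition d M).sum_eq_one (Set.mem_univ p), finsum_eq_sum_of_support_subset]
  intro i hi
  by_contra h
  exact hi (chartPartition_eq_zero h p)

theorem smoothMap_chartPartition (i : M) : SmoothMap d (chartPartition d M i) :=
  contMDiff_iff_smoothMap.1 (chartPartition d M i).contMDiff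

theorem integralVol_eq_sum (f : M → ESp (d + 1)) (u : M → ℝ) :
    integralVol f u = ∑ i ∈ partitionIndex d M, ∫ x in (chartAt (ESp d) i).target,
      inChart i (chartPartition d M i) x * inChart i u x * coVolDensity (inChart i f) x := by
  rw [integralVol, finsum_eq_sum_of_support_subset]
  intro i hi
  by_contra h
  refine hi ?_
  simp [inChart, chartPartition_eq_zero h]

/-- The image in the chart of a closed set contained in the chart domain. -/
def chartImage (d : ℕ) {M : Type*} [TopologicalSpace M] [ChartedSpace (ESp d) M] (i : M)
    (C : Set M) : Set (ESp d) := chartAt (ESp d) i '' C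

section ChartImage

variable {d : ℕ} {M : Type*} [TopologicalSpace M] [ChartedSpace (ESp d) M] {i : M} {C : Set M}

theorem isCompact_chartImage [CompactSpace M] (hC : IsClosed C)
    (hi : C ⊆ (chartAt (ESp d) i).source) : IsCompact (chartImage d i C) :=
  hC.isCompact.image_of_continuousOn ((chartAt (ESp d) i).continuousOn.mono hi)

theorem chartImage_subset (hi : C ⊆ (chartAt (ESp d) i).source) :
    chartImage d i C ⊆ (chartAt (ESp d) i).target := by
  rintro _ ⟨p, hp, rfl⟩
  exact (chartAt (ESp d) i).map_source (hi hp)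

theorem notMem_of_notMem_chartImage {x : ESp d} (hx : x ∈ (chartAt (ESp d) i).target)
    (hxC : x ∉ chartImage d i C) : (chartAt (ESp d) i).symm x ∉ C :=
  fun h => hxC ⟨_, h, (chartAt (ESp d) i).right_inv hx⟩

theorem integrableOn_chart [CompactSpace M] {f : M → ESp (d + 1)} (hf : SmoothMap d f) (hi : ImmMap f)
    (hC : IsClosed C) (hCi : C ⊆ (chartAt (ESp d) i).source) {w : M → ℝ} (hw : SmoothMap d w)
    (h0 : ∀ p ∉ C, w p = 0) :
    IntegrableOn (fun x => inChart i w x * coVolDensity (inChart i f) x)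
      (chartAt (ESp d) i).target :=
  integrableOn_of_compact (chartAt (ESp d) i).open_target (isCompact_chartImage hC hCi)
    (chartImage_subset hCi) ((continuousOn_inChart hw i).mul (continuousOn_coVolDensity hf hi i))
    fun x hx hxK => by
      rw [inChart, Function.comp, h0 _ (notMem_of_notMem_chartImage hx hxK), zero_mul]

end ChartImage

variable {f : M → ESp (d + 1)}

theorem integrableOn_chartPartition_mul (hf : SmoothMap d f) (hi : ImmMap f) (i : M) {u : M → ℝ}
    (hu : SmoothMap d u) :
    IntegrableOn (fun x => inChart i (chartPartition d M i) x * inChart i u x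
      * coVolDensity (inChart i f) x) (chartAt (ESp d) i).target :=
  integrableOn_chart hf hi (isClosed_tsupport (chartPartition d M i))
    (tsupport_chartPartition_subset i) (smoothMap_mul (smoothMap_chartPartition i) hu)
    fun p hp => by rw [image_eq_zero_of_notMem_tsupport hp, zero_mul]

theorem integralVol_add (hf : SmoothMap d f) (hi : ImmMap f) {u v : M → ℝ} (hu : SmoothMap d u)
    (hv : SmoothMap d v) :
    integralVol f (fun p => u p + v p) = integralVol f u + integralVol f v := by
  simp only [integralVol_eq_sum]
  rw [← Finset.sum_add_distrib]
  refine Finset.sum_congr rfl fun i _ => ?_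
  rw [← integral_add (integrableOn_chartPartition_mul hf hi i hu)
    (integrableOn_chartPartition_mul hf hi i hv)]
  refine integral_congr_ae (Filter.Eventually.of_forall fun x => ?_)
  simp only [inChart, Function.comp]
  ring

theorem integralVol_smul (c : ℝ) (u : M → ℝ) :
    integralVol f (fun p => c * u p) = c * integralVol f u := by
  simp only [integralVol_eq_sum, Finset.mul_sum, ← integral_const_mul]
  refine Finset.sum_congr rfl fun i _ => integral_congr_ae (Filter.Eventually.of_forall fun x => ?_)
  simp only [inChart, Function.comp]
  ring

theorem integralVol_sum (hf : SmoothMap d f) (hi : ImmMap f) {ι : Type*} (s : Finset ι)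
    {u : ι → M → ℝ} (hu : ∀ j ∈ s, SmoothMap d (u j)) :
    integralVol f (fun p => ∑ j ∈ s, u j p) = ∑ j ∈ s, integralVol f (u j) := by
  classical
  induction s using Finset.induction_on with
  | empty =>
    have := integralVol_smul (f := f) 0 (fun _ : M => (0 : ℝ))
    simpa using this
  | insert a s ha ih =>
    simp only [Finset.sum_insert ha]
    have hs : SmoothMap d (fun p : M => ∑ j ∈ s, u j p) := fun i x hx => by
      have : (inChart i (fun p => ∑ j ∈ s, u j p) : ESp d → ℝ)
          = fun y => ∑ j ∈ s, inChart i (u j) y := rfl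
      rw [this]
      exact ContDiffAt.sum fun j hj => hu j (Finset.mem_insert_of_mem hj) i x hx
    rw [integralVol_add hf hi (hu a (Finset.mem_insert_self a s)) hs,
      ih fun j hj => hu j (Finset.mem_insert_of_mem hj)]

/-- The integral of a function supported in one chart is computed in that chart. -/
theorem integralVol_eq_setIntegral (hf : SmoothMap d f) (hi : ImmMap f) {j : M} {C : Set M}
    (hC : IsClosed C) (hCj : C ⊆ (chartAt (ESp d) j).source) {w : M → ℝ} (hw : SmoothMap d w)
    (h0 : ∀ p ∉ C, w p = 0) :
    integralVol f w
      = ∫ x in (chartAt (ESp d) j).target, inChart j w x * coVolDensity (inChart j f) x := by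
  have key : ∀ i : M, ∫ x in (chartAt (ESp d) i).target,
      inChart i (chartPartition d M i) x * inChart i w x * coVolDensity (inChart i f) x
      = ∫ x in (chartAt (ESp d) j).target,
        inChart j (chartPartition d M i) x * inChart j w x * coVolDensity (inChart j f) x := by
    intro i
    have e1 : ∫ x in (chartAt (ESp d) i).target,
        inChart i (chartPartition d M i) x * inChart i w x * coVolDensity (inChart i f) x
        = ∫ x in (transition d i j).source,
        inChart i (chartPartition d M i) x * inChart i w x * coVolDensity (inChart i f) x := by
      refine setIntegral_eq_of_subset_of_forall_sdiff_eq_zero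
        (chartAt (ESp d) i).open_target.measurableSet
        (fun x hx => (mem_transition_source.1 hx).1) fun x hx => ?_
      have : (chartAt (ESp d) i).symm x ∉ C := fun h =>
        hx.2 (mem_transition_source.2 ⟨hx.1, hCj h⟩)
      simp only [inChart, Function.comp, h0 _ this, mul_zero, zero_mul]
    have e2 : ∫ x in (chartAt (ESp d) j).target,
        inChart j (chartPartition d M i) x * inChart j w x * coVolDensity (inChart j f) x
        = ∫ x in (transition d i j).target,
        inChart j (chartPartition d M i) x * inChart j w x * coVolDensity (inChart j f) x := by
      refine setIntegral_eq_of_subset_of_forall_sdiff_eq_zero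
        (chartAt (ESp d) j).open_target.measurableSet
        (fun x hx => (mem_transition_target.1 hx).1) fun x hx => ?_
      have : (chartAt (ESp d) j).symm x ∉ tsupport (chartPartition d M i) := fun h =>
        hx.2 (mem_transition_target.2 ⟨hx.1, tsupport_chartPartition_subset i h⟩)
      simp only [inChart, Function.comp, image_eq_zero_of_notMem_tsupport this, zero_mul]
    rw [e1, e2, setIntegral_comp_chartChange (F := inChart j f) (φ := transition d i j)
      (fun x hx => contDiffAt_transition hx)
      (fun y hy => hf j y (mem_transition_target.1 hy).1)
      (fun y => inChart j (chartPartition d M i) y * inChart j w y)]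
    refine setIntegral_congr_fun (transition d i j).open_source.measurableSet fun x hx => ?_
    rw [inChart_transition (chartPartition d M i) hx, inChart_transition w hx]
    congr 1
    simp only [coVolDensity, coMetric_congr (inChart_eventuallyEq f hx)]
  rw [integralVol_eq_sum]
  simp only [key]
  rw [← integral_finsetSum]
  · refine integral_congr_ae (Filter.Eventually.of_forall fun x => ?_)
    beta_reduce
    rw [← Finset.sum_mul, ← Finset.sum_mul]
    simp only [inChart, Function.comp, sum_chartPartition, one_mul]
  · intro i _
    exact integrableOn_chart hf hi hC hCj (smoothMap_mul (smoothMap_chartPartition i) hw)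
      fun p hp => by rw [h0 p hp, mul_zero]

/-- A nonnegative smooth function with vanishing integral vanishes. -/
theorem eq_zero_of_integralVol_eq_zero (hf : SmoothMap d f) (hi : ImmMap f) {u : M → ℝ}
    (hu : SmoothMap d u) (hu0 : ∀ p, 0 ≤ u p) (h : integralVol f u = 0) (p : M) : u p = 0 := by
  rw [integralVol_eq_sum] at h
  have hnn : ∀ i : M, ∀ x, 0 ≤ inChart i (chartPartition d M i) x * inChart i u x
      * coVolDensity (inChart i f) x := fun i x =>
    mul_nonneg (mul_nonneg ((chartPartition d M).nonneg i _) (hu0 _)) (Real.sqrt_nonneg _)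
  rw [Finset.sum_eq_zero_iff_of_nonneg
    fun i _ => integral_nonneg (hnn i)] at h
  obtain ⟨i, hiT, hip⟩ : ∃ i ∈ partitionIndex d M, chartPartition d M i p ≠ 0 := by
    by_contra hcon
    push Not at hcon
    have := sum_chartPartition (d := d) p
    rw [Finset.sum_eq_zero hcon] at this
    exact zero_ne_one this
  have hps : p ∈ (chartAt (ESp d) i).source :=
    tsupport_chartPartition_subset i (subset_tsupport _ hip)
  have h1 := (integral_eq_zero_iff_of_nonneg (hnn i) (integrableOn_chartPartition_mul hf hi i hu)).1
    (h i hiT)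
  have hc : ContinuousOn (fun x => inChart i (chartPartition d M i) x * inChart i u x
      * coVolDensity (inChart i f) x) (chartAt (ESp d) i).target :=
    ((continuousOn_inChart (smoothMap_chartPartition i) i).mul (continuousOn_inChart hu i)).mul
      (continuousOn_coVolDensity hf hi i)
  have h2 := Measure.eqOn_open_of_ae_eq h1 (chartAt (ESp d) i).open_target hc continuousOn_const
  have hx := (chartAt (ESp d) i).map_source hps
  have h3 := h2 hx
  simp only [inChart, Function.comp, (chartAt (ESp d) i).left_inv hps, Pi.zero_apply] at h3
  rcases mul_eq_zero.1 h3 with h4 | h4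
  · exact (mul_eq_zero.1 h4).resolve_left hip
  · exact absurd h4 (coVolDensity_pos (hi i _ hx)).ne'

end Integration


/-! ### The first variation of the weighted volume and its adjoint -/

section Adjoint

open MeasureTheory

theorem coBracket_sum {d : ℕ} {Φ : ℝ → ℝ} {F : ESp d → ESp (d + 1)} {x : ESp d}
    (hF : ∀ᶠ y in 𝓝 x, ContDiffAt ℝ ∞ F y) (h : (coMetric F x).det ≠ 0) {ι : Type*} (s : Finset ι)
    {m : ι → ESp d → ESp (d + 1)} (hm : ∀ k ∈ s, ContDiffAt ℝ ∞ (m k) x) :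
    coBracket Φ F (fun y => ∑ k ∈ s, m k y) x = ∑ k ∈ s, coBracket Φ F (m k) x := by
  rw [coBracket_eq hF h (ContDiffAt.sum hm),
    Finset.sum_congr rfl fun k hk => coBracket_eq (Φ := Φ) hF h (hm k hk)]
  simp only [varDet, varVol, varMetric_sum s hm, varSecond_sum s hm, Finset.mul_sum,
    Matrix.trace_sum, Finset.sum_add_distrib, Finset.sum_div, ← Finset.sum_sub_distrib]

theorem coBracket_eq_zero {d : ℕ} {Φ : ℝ → ℝ} {F m : ESp d → ESp (d + 1)} {x : ESp d}
    (hF : ∀ᶠ y in 𝓝 x, ContDiffAt ℝ ∞ F y) (h : (coMetric F x).det ≠ 0)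
    (hm : ∀ᶠ y in 𝓝 x, m y = 0) : coBracket Φ F m x = 0 := by
  -- the zero field is an empty sum, and the bracket is additive
  have h1 : m =ᶠ[𝓝 x] fun y => ∑ k ∈ (∅ : Finset ℕ), (fun _ => 0 : ℕ → ESp d → ESp (d + 1)) k y :=
    hm.mono fun y hy => by simpa using hy
  rw [coBracket_congr (Filter.EventuallyEq.refl _ _) h1, coBracket_sum hF h _ (by simp)]
  simp

variable {d : ℕ} {M : Type*} [TopologicalSpace M] [ChartedSpace (ESp d) M]
  [IsManifold (𝓡 d) ∞ M] [T2Space M] [CompactSpace M]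
  {f h k m : M → ESp (d + 1)} {Φ : ℝ → ℝ}

theorem bracket_chartPartition_eq_zero (hf : SmoothMap d f) (hi : ImmMap f) {j p : M}
    (hp : p ∉ tsupport (chartPartition d M j)) :
    bracket Φ f (fun q => chartPartition d M j q • m q) p = 0 := by
  refine coBracket_eq_zero (eventually_inChart_contDiffAt hf (pt_mem_target p))
    (hi p _ (pt_mem_target p)) ?_
  have h1 : ContinuousAt (chartAt (ESp d) p).symm (pt p) :=
    (chartAt (ESp d) p).continuousAt_symm (pt_mem_target p)
  have h2 : (chartAt (ESp d) p).symm (pt p) = p := (chartAt (ESp d) p).left_inv (mem_chart_source _ p)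
  have h3 : ∀ᶠ q in 𝓝 ((chartAt (ESp d) p).symm (pt p)), q ∉ tsupport (chartPartition d M j) := by
    rw [h2]
    exact (isClosed_tsupport _).isOpen_compl.mem_nhds hp
  filter_upwards [h1.eventually h3] with y hy
  simp only [inChart, Function.comp]
  rw [image_eq_zero_of_notMem_tsupport hy, zero_smul]

theorem bracket_eq_sum (hf : SmoothMap d f) (hi : ImmMap f) (hm : SmoothMap d m) (p : M) :
    bracket Φ f m p
      = ∑ j ∈ partitionIndex d M, bracket Φ f (fun q => chartPartition d M j q • m q) p := by
  simp only [bracket]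
  rw [← coBracket_sum (eventually_inChart_contDiffAt hf (pt_mem_target p))
    (hi p _ (pt_mem_target p)) (partitionIndex d M)
    (fun j _ => smoothMap_smul (smoothMap_chartPartition j) hm p _ (pt_mem_target p))]
  congr 1
  ext1 y
  simp only [inChart, Function.comp, ← Finset.sum_smul, sum_chartPartition, one_smul]

/-- The `H`-gradient is the formal adjoint of the first variation of the weighted volume: integration
by parts, localized to the charts by writing `m` as the sum of the fields `ρⱼ m`. -/
theorem integralVol_bracket (hΦ : ContDiff ℝ ∞ Φ) (hpos : ∀ s, 0 < Φ s) (hor : OrientedAtlas d M)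
    (hf : SmoothMap d f) (hi : ImmMap f) (hm : SmoothMap d m) (hh : SmoothMap d h)
    (hk : SmoothMap d k) :
    integralVol f (fun p => Φ (detL f p) * (bracket Φ f m p * inner ℝ (h p) (k p)))
      = GMet Φ f m (HForm Φ f h k) := by
  have hD := smoothMap_comp hΦ (smoothMap_detL hor hf hi)
  have hH := smoothMap_HForm hΦ hpos hor hf hi hh hk
  have hmj := fun j : M => smoothMap_smul (smoothMap_chartPartition j) hm
  have e1 : (fun p => Φ (detL f p) * (bracket Φ f m p * inner ℝ (h p) (k p)))
      = fun p => ∑ j ∈ partitionIndex d M, Φ (detL f p) *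
        (bracket Φ f (fun q => chartPartition d M j q • m q) p * inner ℝ (h p) (k p)) := by
    ext p
    rw [bracket_eq_sum hf hi hm, Finset.sum_mul, Finset.mul_sum]
  have e2 : (fun p => Φ (detL f p) * inner ℝ (m p) (HForm Φ f h k p))
      = fun p => ∑ j ∈ partitionIndex d M, Φ (detL f p) *
        inner ℝ (chartPartition d M j p • m p) (HForm Φ f h k p) := by
    ext p
    rw [← Finset.mul_sum, ← sum_inner, ← Finset.sum_smul, sum_chartPartition, one_smul]
  have s1 := fun j : M => smoothMap_mul hD (smoothMap_mul
    (smoothMap_bracket hΦ hpos hor hf hi (hmj j)) (smoothMap_inner hh hk))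
  have s2 := fun j : M => smoothMap_mul hD (smoothMap_inner (hmj j) hH)
  rw [GMet, e1, e2, integralVol_sum hf hi _ (fun j _ => s1 j), integralVol_sum hf hi _ fun j _ => s2 j]
  refine Finset.sum_congr rfl fun j _ => ?_
  have hC := isClosed_tsupport (chartPartition d M j)
  have hCj := tsupport_chartPartition_subset (d := d) j
  have hU := (chartAt (ESp d) j).open_target
  rw [integralVol_eq_setIntegral hf hi hC hCj (s1 j)
    (fun p hp => by rw [bracket_chartPartition_eq_zero hf hi hp, zero_mul, mul_zero]),
    integralVol_eq_setIntegral hf hi hC hCj (s2 j)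
    (fun p hp => by rw [image_eq_zero_of_notMem_tsupport hp, zero_smul, inner_zero_left, mul_zero])]
  refine Eq.trans ?_ ((setIntegral_coBracket hU (isCompact_chartImage hC hCj)
    (chartImage_subset hCj) hΦ hpos (hf j) (hi j) (hmj j j)
    (fun x hx => (hh j x hx).inner ℝ (hk j x hx)) fun x hx hxK => ?_).trans ?_)
  · refine setIntegral_congr_fun hU.measurableSet fun x hx => ?_
    have h1 := inChart_bracket hΦ hpos hor hf hi (hmj j) hx
    have h2 := inChart_detL hor hf hi hx
    simp only [inChart, Function.comp] at h1 h2 ⊢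
    rw [h1, h2]
    ring
  · simp only [inChart, Function.comp]
    rw [image_eq_zero_of_notMem_tsupport (notMem_of_notMem_chartImage hx hxK), zero_smul]
  · refine setIntegral_congr_fun hU.measurableSet fun x hx => ?_
    have h1 := inChart_HForm hΦ hpos hor hf hi hh hk hx
    have h2 := inChart_detL hor hf hi hx
    simp only [inChart, Function.comp] at h1 h2 ⊢
    rw [h1, h2]

end Adjoint


/-! ### The metric along families of immersions -/

section Families

open MeasureTheory

variable {d : ℕ} {M : Type*} [TopologicalSpace M] [ChartedSpace (ESp d) M]
  {P : Type*} [NormedAddCommGroup P] [NormedSpace ℝ P]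
  {W : Type*} [NormedAddCommGroup W] [NormedSpace ℝ W]

theorem SmAt.coDet {F : P → ESp d → ESp (d + 1)} {q : P} {x : ESp d} (hF : SmAt F q x)
    (h : (ImmGeo.coMetric (F q) x).det ≠ 0) : SmAt (fun r y => ImmGeo.coDet (F r) y) q x :=
  contDiffAt_matrix_det fun i j => hF.coWeingarten (coCross_ne_zero h) h i j

/-- The velocity of a family depending on one parameter. -/
theorem SmoothFam.velocity {O : Set ℝ} {c : ℝ → M → W} (hc : SmoothFam d O c) :
    SmoothFam d O (fun t p => deriv (fun τ => c τ p) t) := fun i q hq x hx =>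
  (hc i q hq x hx).param_deriv

theorem SmoothFam.mono {O O' : Set P} {c : P → M → W} (hc : SmoothFam d O c) (h : O' ⊆ O) :
    SmoothFam d O' c := fun i q hq x hx => hc i q (h hq) x hx

theorem SmoothFam.contDiffAt {O : Set P} {c : P → M → W} (hc : SmoothFam d O c) {q : P} (hq : q ∈ O)
    (p : M) : ContDiffAt ℝ ∞ (fun r => c r p) q := by
  have := (hc p q hq _ (pt_mem_target p)).param
  simpa only [inChart_pt] using this

variable [IsManifold (𝓡 d) ∞ M] [T2Space M] [CompactSpace M] {Φ : ℝ → ℝ}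

theorem GMet_eq_sum (hor : OrientedAtlas d M) {f h k : M → ESp (d + 1)} (hf : SmoothMap d f)
    (hi : ImmMap f) :
    GMet Φ f h k = ∑ i ∈ partitionIndex d M, ∫ x in (chartAt (ESp d) i).target,
      inChart i (chartPartition d M i) x * ((Φ (coDet (inChart i f) x) * coVolDensity (inChart i f) x)
        * inner ℝ (inChart i h x) (inChart i k x)) := by
  rw [GMet, integralVol_eq_sum]
  refine Finset.sum_congr rfl fun i _ => ?_
  refine setIntegral_congr_fun (chartAt (ESp d) i).open_target.measurableSet fun x hx => ?_
  have h2 := inChart_detL hor hf hi hx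
  simp only [inChart, Function.comp] at h2 ⊢
  rw [h2]
  ring

theorem smAt_integrand (hΦ : ContDiff ℝ ∞ Φ) {O : Set P} {c h k : P → M → ESp (d + 1)}
    (hc : SmoothFam d O c) (hi : ∀ q ∈ O, ImmMap (c q)) (hh : SmoothFam d O h)
    (hk : SmoothFam d O k) (i : M) {q : P} (hq : q ∈ O) {x : ESp d}
    (hx : x ∈ (chartAt (ESp d) i).target) :
    SmAt (fun q x => inChart i (chartPartition d M i) x * ((Φ (coDet (inChart i (c q)) x)
      * coVolDensity (inChart i (c q)) x) * inner ℝ (inChart i (h q) x) (inChart i (k q) x))) q x := by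
  have h1 := SmAt.of_slice P q (smoothMap_chartPartition i i x hx)
  have h2 : SmAt (fun q x => Φ (coDet (inChart i (c q)) x)) q x :=
    hΦ.contDiffAt.comp (q, x) ((hc i q hq x hx).coDet (hi q hq i x hx))
  exact ContDiffAt.mul h1 ((ContDiffAt.mul h2 ((hc i q hq x hx).coVolDensity (hi q hq i x hx))).mul
    ((hh i q hq x hx).inner (hk i q hq x hx)))

theorem integrand_eq_zero {i : M} {x : ESp d} (hx : x ∈ (chartAt (ESp d) i).target)
    (hxK : x ∉ chartImage d i (tsupport (chartPartition d M i))) (r : ℝ) :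
    inChart i (chartPartition d M i) x * r = 0 := by
  simp only [inChart, Function.comp]
  rw [image_eq_zero_of_notMem_tsupport (notMem_of_notMem_chartImage hx hxK), zero_mul]

/-- The metric depends smoothly on parameters. -/
theorem contDiffOn_GMet (hΦ : ContDiff ℝ ∞ Φ) (hor : OrientedAtlas d M) {O : Set P} (hO : IsOpen O)
    {c h k : P → M → ESp (d + 1)} (hc : SmoothFam d O c) (hi : ∀ q ∈ O, ImmMap (c q))
    (hh : SmoothFam d O h) (hk : SmoothFam d O k) :
    ContDiffOn ℝ ∞ (fun q => GMet Φ (c q) (h q) (k q)) O := by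
  refine (ContDiffOn.sum fun i (_ : i ∈ partitionIndex d M) => contDiffOn_setIntegral
    (chartAt (ESp d) i).open_target
    (isCompact_chartImage (isClosed_tsupport (chartPartition d M i)) (tsupport_chartPartition_subset i))
    (chartImage_subset (tsupport_chartPartition_subset i)) hO
    (fun q hq x hx => smAt_integrand hΦ hc hi hh hk i hq hx)
    fun q _ x hx hxK => integrand_eq_zero hx hxK _).congr fun q hq => ?_
  exact GMet_eq_sum hor (hc.slice hq) (hi q hq)

/-- The derivative of the metric along a curve of immersions. -/
theorem hasDerivAt_GMet (hΦ : ContDiff ℝ ∞ Φ) (hpos : ∀ s, 0 < Φ s) (hor : OrientedAtlas d M)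
    {O : Set ℝ} (hO : IsOpen O) {c h k : ℝ → M → ESp (d + 1)} (hc : SmoothFam d O c)
    (hi : ∀ q ∈ O, ImmMap (c q)) (hh : SmoothFam d O h) (hk : SmoothFam d O k) {q : ℝ} (hq : q ∈ O)
    {c' h' k' : M → ESp (d + 1)} (hc' : ∀ p, HasDerivAt (fun t => c t p) (c' p) q)
    (hh' : ∀ p, HasDerivAt (fun t => h t p) (h' p) q)
    (hk' : ∀ p, HasDerivAt (fun t => k t p) (k' p) q) :
    HasDerivAt (fun t => GMet Φ (c t) (h t) (k t))
      (integralVol (c q) (fun p => Φ (detL (c q) p) * (bracket Φ (c q) c' p * inner ℝ (h q p) (k q p)))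
        + GMet Φ (c q) h' (k q) + GMet Φ (c q) (h q) k') q := by
  have hcs := hc.slice hq
  have hD := smoothMap_comp hΦ (smoothMap_detL hor hcs (hi q hq))
  have ec : c' = fun p => deriv (fun t => c t p) q := funext fun p => (hc' p).deriv.symm
  have eh : h' = fun p => deriv (fun t => h t p) q := funext fun p => (hh' p).deriv.symm
  have ek : k' = fun p => deriv (fun t => k t p) q := funext fun p => (hk' p).deriv.symm
  have hcm : SmoothMap d c' := ec ▸ hc.velocity.slice hq
  have hhm : SmoothMap d h' := eh ▸ hh.velocity.slice hq
  have hkm : SmoothMap d k' := ek ▸ hk.velocity.slice hq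
  have s1 := smoothMap_mul hD (smoothMap_mul (smoothMap_bracket hΦ hpos hor hcs (hi q hq) hcm)
    (smoothMap_inner (hh.slice hq) (hk.slice hq)))
  have s2 := smoothMap_mul hD (smoothMap_inner hhm (hk.slice hq))
  have s3 := smoothMap_mul hD (smoothMap_inner (hh.slice hq) hkm)
  have s12 := smoothMap_add s1 s2
  have key := HasDerivAt.fun_sum fun i (_ : i ∈ partitionIndex d M) => hasDerivAt_setIntegral
    (chartAt (ESp d) i).open_target
    (isCompact_chartImage (isClosed_tsupport (chartPartition d M i)) (tsupport_chartPartition_subset i))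
    (chartImage_subset (tsupport_chartPartition_subset i)) hO
    (fun q hq x hx => smAt_integrand hΦ hc hi hh hk i hq hx)
    (fun q _ x hx hxK => integrand_eq_zero hx hxK _) hq
  refine (key.congr_of_eventuallyEq ((hO.eventually_mem hq).mono fun t ht =>
    GMet_eq_sum hor (hc.slice ht) (hi t ht))).congr_deriv ?_
  rw [GMet, GMet, ← integralVol_add hcs (hi q hq) s1 s2, ← integralVol_add hcs (hi q hq) s12 s3,
    integralVol_eq_sum]
  refine Finset.sum_congr rfl fun i _ => ?_
  refine setIntegral_congr_fun (chartAt (ESp d) i).open_target.measurableSet fun x hx => ?_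
  have hev : ∀ᶠ z : ℝ × ESp d in 𝓝 (q, x), SmAt (fun t => inChart i (c t)) z.1 z.2 := by
    filter_upwards [(hO.prod (chartAt (ESp d) i).open_target).mem_nhds ⟨hq, hx⟩] with z hz
    exact hc i z.1 hz.1 z.2 hz.2
  have d1 := hasDerivAt_weightedDensity (m := inChart i c') hΦ hpos hev (hi q hq i x hx)
    (by rw [ec]; rfl)
  have d2 := hasDerivAt_inner (hh' ((chartAt (ESp d) i).symm x)) (hk' ((chartAt (ESp d) i).symm x))
  have d3 := ((d1.fun_mul d2).const_mul (inChart i (chartPartition d M i) x)).deriv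
  have b1 := inChart_bracket hΦ hpos hor hcs (hi q hq) hcm hx
  have b2 := inChart_detL hor hcs (hi q hq) hx
  refine d3.trans ?_
  simp only [inChart, Function.comp] at b1 b2 ⊢
  rw [b1, b2]
  ring

end Families


/-! ### The metric gradients -/

section Gradients

variable {d : ℕ} {M : Type*} [TopologicalSpace M] [ChartedSpace (ESp d) M]
  {P : Type*} [NormedAddCommGroup P] [NormedSpace ℝ P] [IsManifold (𝓡 d) ∞ M]

/-- In a smooth family of maps of a compact manifold, being an immersion is an open condition. -/
theorem eventually_immMap [CompactSpace M] {O : Set P} (hO : IsOpen O) {c : P → M → ESp (d + 1)}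
    (hc : SmoothFam d O c) {q₀ : P} (hq₀ : q₀ ∈ O) (hi : ImmMap (c q₀)) :
    ∀ᶠ q in 𝓝 q₀, ImmMap (c q) := by
  have h1 : ∀ᶠ q in 𝓝 q₀, ∀ p ∈ (Set.univ : Set M), q ∈ O ∧
      Function.Injective (mfderiv (𝓡 d) 𝓘(ℝ, ESp (d + 1)) (c q) p) := by
    refine isCompact_univ.eventually_forall_of_forall_eventually fun p _ => ?_
    have h2 : ∀ᶠ z : P × ESp d in 𝓝 (q₀, pt p), (coMetric (inChart p (c z.1)) z.2).det ≠ 0 :=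
      ((hc p q₀ hq₀ _ (pt_mem_target p)).det_coMetric.continuousAt).eventually_ne
        (hi p _ (pt_mem_target p))
    have h3 : Filter.Tendsto (fun z : P × M => (z.1, chartAt (ESp d) p z.2)) (𝓝 (q₀, p))
        (𝓝 (q₀, pt p)) :=
      continuousAt_fst.prodMk (((chartAt (ESp d) p).continuousAt (mem_chart_source _ p)).comp
        continuousAt_snd)
    filter_upwards [h3.eventually h2, (hO.prod (chartAt (ESp d) p).open_source).mem_nhds
      ⟨hq₀, mem_chart_source _ p⟩] with z hz hzm
    refine ⟨hzm.1, ?_⟩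
    have h4 := (injective_mfderiv_iff (contMDiff_iff_smoothMap.2 (hc.slice hzm.1))
      ((chartAt (ESp d) p).map_source hzm.2)).1 hz
    rwa [(chartAt (ESp d) p).left_inv hzm.2] at h4
  refine h1.mono fun q hq i x hx => ?_
  exact (injective_mfderiv_iff (contMDiff_iff_smoothMap.2 (hc.slice (hq ((chartAt (ESp d) i).symm x)
    (Set.mem_univ _)).1)) hx).2 (hq _ (Set.mem_univ _)).2

theorem isOpen_setOf_immMap [CompactSpace M] {O : Set P} (hO : IsOpen O) {c : P → M → ESp (d + 1)}
    (hc : SmoothFam d O c) : IsOpen {q ∈ O | ImmMap (c q)} :=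
  isOpen_iff_mem_nhds.2 fun _ hq => (hO.eventually_mem hq.1).and (eventually_immMap hO hc hq.1 hq.2)

/-- The straight line `f + t m` is a curve of immersions for small times. -/
theorem curveThrough_add_smul [CompactSpace M] {f m : M → ESp (d + 1)} (hf : SmoothImm f)
    (hm : SmoothField m) : CurveThrough f m (fun t p => f p + t • m p) := by
  have h0 : ContMDiff (𝓘(ℝ, ℝ).prod (𝓡 d)) 𝓘(ℝ, ESp (d + 1)) ∞
      (fun q : ℝ × M => f q.2 + q.1 • m q.2) :=
    (hf.1.comp contMDiff_snd).add (contMDiff_fst.smul (hm.comp contMDiff_snd))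
  have hF : SmoothFam d Set.univ (fun (t : ℝ) p => f p + t • m p) :=
    smoothFam_of_contMDiffOn isOpen_univ h0.contMDiffOn
  refine ⟨h0, ?_, by simp, fun p => ?_⟩
  · refine (eventually_immMap isOpen_univ hF (Set.mem_univ 0) ?_).mono fun t ht =>
      smoothImm_iff.2 ⟨hF.slice (Set.mem_univ t), ht⟩
    simpa using (smoothImm_iff.1 hf).2
  · simpa using ((hasDerivAt_id (0 : ℝ)).smul_const (m p)).const_add (f p)

variable [T2Space M] [CompactSpace M] {Φ : ℝ → ℝ} {f h k m : M → ESp (d + 1)}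

theorem GMet_KForm (hor : OrientedAtlas d M) (hf : SmoothMap d f) (hi : ImmMap f) :
    GMet Φ f (KForm Φ f m h) k
      = integralVol f (fun p => Φ (detL f p) * (bracket Φ f m p * inner ℝ (h p) (k p))) := by
  simp only [GMet, KForm_eq hor hf hi, real_inner_smul_left]

theorem GMet_zero_left : GMet Φ f (fun _ => 0) k = 0 := by
  simp [GMet, integralVol_eq_sum, inChart, Function.comp_def]

theorem GMet_comm : GMet Φ f h k = GMet Φ f k h := by
  simp only [GMet, real_inner_comm]

theorem GMet_zero_right : GMet Φ f h (fun _ => 0) = 0 := by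
  rw [GMet_comm, GMet_zero_left]

theorem GMet_smul_left (r : ℝ) : GMet Φ f (fun p => r • h p) k = r * GMet Φ f h k := by
  rw [GMet, GMet, ← integralVol_smul]
  congr 1
  ext p
  rw [real_inner_smul_left]
  ring

theorem GMet_smul_right (r : ℝ) : GMet Φ f h (fun p => r • k p) = r * GMet Φ f h k := by
  rw [GMet_comm, GMet_smul_left, GMet_comm]

theorem GMet_add_right (hΦ : ContDiff ℝ ∞ Φ) (hor : OrientedAtlas d M) (hf : SmoothMap d f)
    (hi : ImmMap f) {l : M → ESp (d + 1)} (hh : SmoothMap d h) (hk : SmoothMap d k)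
    (hl : SmoothMap d l) :
    GMet Φ f h (fun p => k p + l p) = GMet Φ f h k + GMet Φ f h l := by
  have hD := smoothMap_comp hΦ (smoothMap_detL hor hf hi)
  rw [GMet, GMet, GMet, ← integralVol_add hf hi (smoothMap_mul hD (smoothMap_inner hh hk))
    (smoothMap_mul hD (smoothMap_inner hh hl))]
  simp only [inner_add_right, mul_add]

theorem GMet_sub_right (hΦ : ContDiff ℝ ∞ Φ) (hor : OrientedAtlas d M) (hf : SmoothMap d f)
    (hi : ImmMap f) {l : M → ESp (d + 1)} (hh : SmoothMap d h) (hk : SmoothMap d k)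
    (hl : SmoothMap d l) :
    GMet Φ f h (fun p => k p - l p) = GMet Φ f h k - GMet Φ f h l := by
  have h1 := GMet_add_right hΦ hor hf hi hh (smoothMap_sub hk hl) hl
  simp only [sub_add_cancel] at h1
  linarith

/-- The metric is positive definite. -/
theorem eq_zero_of_GMet_self_eq_zero (hΦ : ContDiff ℝ ∞ Φ) (hpos : ∀ s, 0 < Φ s)
    (hor : OrientedAtlas d M) (hf : SmoothMap d f) (hi : ImmMap f) (hh : SmoothMap d h)
    (h0 : GMet Φ f h h = 0) (p : M) : h p = 0 := by
  have hD := smoothMap_comp hΦ (smoothMap_detL hor hf hi)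
  have := eq_zero_of_integralVol_eq_zero hf hi (smoothMap_mul hD (smoothMap_inner hh hh))
    (fun p => mul_nonneg (hpos _).le real_inner_self_nonneg) h0 p
  exact inner_self_eq_zero.1 ((mul_eq_zero.1 this).resolve_left (hpos _).ne')

/-- A smooth field is determined by the functional on smooth fields that it represents. -/
theorem eq_of_GMet_right_eq (hΦ : ContDiff ℝ ∞ Φ) (hpos : ∀ s, 0 < Φ s)
    (hor : OrientedAtlas d M) (hf : SmoothMap d f) (hi : ImmMap f) (hh : SmoothMap d h)
    (hk : SmoothMap d k) (h0 : ∀ l, SmoothMap d l → GMet Φ f l h = GMet Φ f l k) : h = k := by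
  have hs := smoothMap_sub hh hk
  have h1 := GMet_sub_right hΦ hor hf hi hs hh hk
  rw [h0 _ hs, sub_self] at h1
  exact funext fun p => sub_eq_zero.1 (eq_zero_of_GMet_self_eq_zero hΦ hpos hor hf hi hs h1 p)

/-- The derivative of `G^Φ(h, k)` along a curve of immersions, for constant `h` and `k`. -/
theorem hasDerivAt_GMet_curveThrough (hΦ : ContDiff ℝ ∞ Φ) (hpos : ∀ s, 0 < Φ s)
    (hor : OrientedAtlas d M) {c : ℝ → M → ESp (d + 1)} (hc : CurveThrough f m c)
    (hh : SmoothMap d h) (hk : SmoothMap d k) :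
    HasDerivAt (fun t => GMet Φ (c t) h k) (GMet Φ f (KForm Φ f m h) k) 0 := by
  obtain ⟨hs, hev, rfl, hd⟩ := hc
  have hF : SmoothFam d Set.univ c := smoothFam_of_contMDiffOn isOpen_univ hs.contMDiffOn
  have hO := isOpen_setOf_immMap isOpen_univ hF
  have h0 := smoothImm_iff.1 hev.self_of_nhds
  refine (hasDerivAt_GMet hΦ hpos hor hO (hF.mono (Set.subset_univ _)) (fun q hq => hq.2)
    (hh.fam _) (hk.fam _) ⟨Set.mem_univ 0, h0.2⟩ hd (fun p => hasDerivAt_const _ _)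
    (fun p => hasDerivAt_const _ _)).congr_deriv ?_
  rw [GMet_zero_left, GMet_zero_right, add_zero, add_zero, GMet_KForm hor h0.1 h0.2]

/-- The two gradients represent the same trilinear form. -/
theorem GMet_KForm_eq_GMet_HForm (hΦ : ContDiff ℝ ∞ Φ) (hpos : ∀ s, 0 < Φ s)
    (hor : OrientedAtlas d M) (hf : SmoothMap d f) (hi : ImmMap f) (hm : SmoothMap d m)
    (hh : SmoothMap d h) (hk : SmoothMap d k) :
    GMet Φ f (KForm Φ f m h) k = GMet Φ f m (HForm Φ f h k) := by
  rw [GMet_KForm hor hf hi, integralVol_bracket hΦ hpos hor hf hi hm hh hk]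

/-- The `K`-gradient exists, is unique and is given by the formula. -/
theorem isKGradient_iff (hΦ : ContDiff ℝ ∞ Φ) (hpos : ∀ s, 0 < Φ s) (hor : OrientedAtlas d M)
    (hf : SmoothImm f) (hm : SmoothField m) (hh : SmoothField h) {X : M → ESp (d + 1)} :
    IsKGradient Φ f m h X ↔ X = KForm Φ f m h := by
  obtain ⟨hfs, hi⟩ := smoothImm_iff.1 hf
  have hms : SmoothMap d m := contMDiff_iff_smoothMap.1 hm
  have hhs : SmoothMap d h := contMDiff_iff_smoothMap.1 hh
  have hK := smoothMap_KForm hΦ hpos hor hfs hi hms hhs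
  constructor
  · rintro ⟨hX, hXk⟩
    refine eq_of_GMet_right_eq hΦ hpos hor hfs hi (contMDiff_iff_smoothMap.1 hX) hK fun k hk => ?_
    have hc := curveThrough_add_smul hf hm
    have := (hXk k (contMDiff_iff_smoothMap.2 hk) _ hc).unique
      (hasDerivAt_GMet_curveThrough hΦ hpos hor hc hhs hk)
    rwa [GMet_comm, GMet_comm (h := k)]
  · rintro rfl
    exact ⟨contMDiff_iff_smoothMap.2 hK, fun k hk c hc =>
      hasDerivAt_GMet_curveThrough hΦ hpos hor hc hhs (contMDiff_iff_smoothMap.1 hk)⟩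

/-- The `H`-gradient exists, is unique and is given by the formula. -/
theorem isHGradient_iff (hΦ : ContDiff ℝ ∞ Φ) (hpos : ∀ s, 0 < Φ s) (hor : OrientedAtlas d M)
    (hf : SmoothImm f) (hh : SmoothField h) (hk : SmoothField k) {X : M → ESp (d + 1)} :
    IsHGradient Φ f h k X ↔ X = HForm Φ f h k := by
  obtain ⟨hfs, hi⟩ := smoothImm_iff.1 hf
  have hhs : SmoothMap d h := contMDiff_iff_smoothMap.1 hh
  have hks : SmoothMap d k := contMDiff_iff_smoothMap.1 hk
  have hH := smoothMap_HForm hΦ hpos hor hfs hi hhs hks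
  have key : ∀ m, SmoothField m → ∀ c, CurveThrough f m c →
      HasDerivAt (fun t => GMet Φ (c t) h k) (GMet Φ f m (HForm Φ f h k)) 0 := fun m hm c hc =>
    (hasDerivAt_GMet_curveThrough hΦ hpos hor hc hhs hks).congr_deriv
      (GMet_KForm_eq_GMet_HForm hΦ hpos hor hfs hi (contMDiff_iff_smoothMap.1 hm) hhs hks)
  constructor
  · rintro ⟨hX, hXm⟩
    refine eq_of_GMet_right_eq hΦ hpos hor hfs hi (contMDiff_iff_smoothMap.1 hX) hH fun m hm => ?_
    have hm' := contMDiff_iff_smoothMap.2 hm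
    have hc := curveThrough_add_smul hf hm'
    exact (hXm m hm' _ hc).unique (key m hm' _ hc)
  · rintro rfl
    exact ⟨contMDiff_iff_smoothMap.2 hH, key⟩

end Gradients


/-! ### Calculus for families with two parameters -/

section TwoParameters

open MeasureTheory

variable {W : Type*} [NormedAddCommGroup W] [NormedSpace ℝ W]

theorem hasDerivAt_fst {u : ℝ × ℝ → W} {s t : ℝ} (hu : DifferentiableAt ℝ u (s, t)) :
    HasDerivAt (fun σ => u (σ, t)) (fderiv ℝ u (s, t) (1, 0)) s :=
  HasFDerivAt.comp_hasDerivAt s (f := fun σ : ℝ => (σ, t)) hu.hasFDerivAt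
    ((hasDerivAt_id s).prodMk (hasDerivAt_const s t))

theorem hasDerivAt_snd {u : ℝ × ℝ → W} {s t : ℝ} (hu : DifferentiableAt ℝ u (s, t)) :
    HasDerivAt (fun τ => u (s, τ)) (fderiv ℝ u (s, t) (0, 1)) t :=
  HasFDerivAt.comp_hasDerivAt t (f := fun τ : ℝ => (s, τ)) hu.hasFDerivAt
    ((hasDerivAt_const t s).prodMk (hasDerivAt_id t))

/-- If an open set contains `{0} × [a, b]`, it contains `(-ε, ε) × [a, b]` for some `ε > 0`. -/
theorem eventually_forall_Icc_mem {a b : ℝ} {U : Set (ℝ × ℝ)} (hU : IsOpen U)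
    (h : ∀ t ∈ Set.Icc a b, ((0 : ℝ), t) ∈ U) :
    ∀ᶠ s in 𝓝 (0 : ℝ), ∀ t ∈ Set.Icc a b, (s, t) ∈ U :=
  isCompact_Icc.eventually_forall_of_forall_eventually
    (P := fun s t => (s, t) ∈ U) fun t ht => hU.mem_nhds (h t ht)

theorem continuousOn_fderiv_apply {E : Type*} [NormedAddCommGroup E] [NormedSpace ℝ E]
    {I : E → W} {U : Set E} (hU : IsOpen U) (hI : ContDiffOn ℝ ∞ I U) (v : E) :
    ContinuousOn (fun z => fderiv ℝ I z v) U := fun _ hz =>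
  (contDiffAt_fderiv_apply (hI.contDiffAt (hU.mem_nhds hz)) v).continuousAt.continuousWithinAt

/-- Differentiation under the integral sign over a compact interval. -/
theorem hasDerivAt_intervalIntegral_param {a b : ℝ} (hab : a ≤ b) {U : Set (ℝ × ℝ)} (hU : IsOpen U)
    (h : ∀ t ∈ Set.Icc a b, ((0 : ℝ), t) ∈ U) {I : ℝ × ℝ → ℝ} (hI : ContDiffOn ℝ ∞ I U) :
    HasDerivAt (fun s => ∫ t in a..b, I (s, t)) (∫ t in a..b, fderiv ℝ I (0, t) (1, 0)) 0 := by
  have hev := eventually_forall_Icc_mem hU h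
  obtain ⟨ε, hε, hball⟩ := Metric.nhds_basis_closedBall.mem_iff.1 hev
  have hK : Metric.closedBall (0 : ℝ) ε ×ˢ Set.Icc a b ⊆ U := fun z hz => hball hz.1 z.2 hz.2
  have hD := continuousOn_fderiv_apply hU hI (1, 0)
  obtain ⟨C, hC⟩ := ((isCompact_closedBall (0 : ℝ) ε).prod isCompact_Icc).exists_bound_of_continuousOn
    (hD.mono hK)
  have hsl : ∀ {g : ℝ × ℝ → ℝ}, ContinuousOn g U → ∀ s ∈ Metric.closedBall (0 : ℝ) ε,
      ContinuousOn (fun t => g (s, t)) (Set.Icc a b) := fun hg s hs =>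
    hg.comp (Continuous.prodMk_right s).continuousOn fun t ht => hK ⟨hs, ht⟩
  have hmeas : ∀ {g : ℝ × ℝ → ℝ}, ContinuousOn g U → ∀ s ∈ Metric.closedBall (0 : ℝ) ε,
      IntervalIntegrable (fun t => g (s, t)) volume a b := fun hg s hs =>
    ContinuousOn.intervalIntegrable (by rw [Set.uIcc_of_le hab]; exact hsl hg s hs)
  have h0 : (0 : ℝ) ∈ Metric.closedBall (0 : ℝ) ε := Metric.mem_closedBall_self hε.le
  have huI : Set.uIoc a b ⊆ Set.Icc a b := by
    rw [Set.uIoc_of_le hab]; exact Set.Ioc_subset_Icc_self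
  exact (intervalIntegral.hasDerivAt_integral_of_dominated_loc_of_deriv_le
    (F := fun s t => I (s, t)) (F' := fun s t => fderiv ℝ I (s, t) (1, 0)) (bound := fun _ => C)
    (Metric.closedBall_mem_nhds (0 : ℝ) hε)
    (Filter.eventually_of_mem (Metric.closedBall_mem_nhds (0 : ℝ) hε) fun s hs =>
      (hmeas hI.continuousOn s hs).def'.aestronglyMeasurable)
    (hmeas hI.continuousOn 0 h0)
    (hmeas hD 0 h0).def'.aestronglyMeasurable
    (Filter.Eventually.of_forall fun t ht s hs => hC (s, t) ⟨hs, huI ht⟩)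
    intervalIntegrable_const
    (Filter.Eventually.of_forall fun t ht s hs => hasDerivAt_fst
      (((hI.contDiffAt (hU.mem_nhds (hK ⟨hs, huI ht⟩)))).differentiableAt (by simp)))).2

/-- The fundamental lemma of the calculus of variations on an open interval. -/
theorem eqOn_zero_of_intervalIntegral_smooth_mul {a b : ℝ} (hab : a < b) {β : ℝ → ℝ}
    (hβ : ContinuousOn β (Set.Ioo a b))
    (h : ∀ χ : ℝ → ℝ, ContDiff ℝ ∞ χ → tsupport χ ⊆ Set.Ioo a b → ∫ t in a..b, χ t * β t = 0) :
    ∀ t ∈ Set.Ioo a b, β t = 0 := by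
  have h1 := isOpen_Ioo.ae_eq_zero_of_integral_contDiff_smul_eq_zero
    (hβ.locallyIntegrableOn (μ := volume) measurableSet_Ioo) fun χ hχ _ hs => by
      rw [← h χ hχ hs, intervalIntegral.integral_of_le hab.le]
      refine (setIntegral_eq_integral_of_forall_compl_eq_zero fun t ht => ?_).symm
      rw [image_eq_zero_of_notMem_tsupport fun hc => ht (Set.Ioo_subset_Ioc_self (hs hc)), zero_smul]
  exact Measure.eqOn_open_of_ae_eq ((ae_restrict_iff' measurableSet_Ioo).2 h1) isOpen_Ioo hβ
    continuousOn_const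

variable {d : ℕ} {M : Type*} [TopologicalSpace M] [ChartedSpace (ESp d) M]
  {P : Type*} [NormedAddCommGroup P] [NormedSpace ℝ P]
  {Q : Type*} [NormedAddCommGroup Q] [NormedSpace ℝ Q]

theorem SmoothFam.comp {O : Set P} {O' : Set Q} {c : P → M → W} (hc : SmoothFam d O c) {φ : Q → P}
    (hφ : ContDiff ℝ ∞ φ) (hO : ∀ q ∈ O', φ q ∈ O) : SmoothFam d O' (fun q => c (φ q)) :=
  fun i q hq x hx => ContDiffAt.comp (q, x) (f := fun z : Q × ESp d => (φ z.1, z.2))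
    (g := fun z : P × ESp d => inChart i (c z.1) z.2) (hc i (φ q) (hO q hq) x hx)
    ((hφ.comp contDiff_fst).prodMk contDiff_snd).contDiffAt

/-- The derivative of a family in a fixed direction of the parameter space is a smooth family. -/
theorem SmoothFam.fderiv {O : Set P} {c : P → M → W} (hc : SmoothFam d O c) (v : P) :
    SmoothFam d O (fun q p => _root_.fderiv ℝ (fun r => c r p) q v) := fun i q hq x hx => by
  have h1 := contDiffAt_fderiv_apply (hc i q hq x hx) (v, 0)
  refine ContDiffAt.congr_of_eventuallyEq h1
    ((eventually_differentiableAt (hc i q hq x hx)).mono fun z hz => ?_)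
  have h2 : HasFDerivAt (fun r : P => (r, z.2)) (ContinuousLinearMap.inl ℝ P (ESp d)) z.1 :=
    hasFDerivAt_prodMk_left z.1 z.2
  have h3 := HasFDerivAt.comp z.1 (f := fun r : P => (r, z.2)) hz.hasFDerivAt h2
  have h4 := h3.fderiv
  exact (congrArg (fun L : P →L[ℝ] W => L v) h4).trans (by simp)

end TwoParameters


/-! ### The first variation of the energy -/

section Energy

open MeasureTheory

variable {d : ℕ} {M : Type*} [TopologicalSpace M] [ChartedSpace (ESp d) M]

theorem SmoothFam.congr {P : Type*} [NormedAddCommGroup P] [NormedSpace ℝ P]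
    {W : Type*} [NormedAddCommGroup W] [NormedSpace ℝ W] {O : Set P} (hO : IsOpen O)
    {c c' : P → M → W} (hc : SmoothFam d O c) (h : ∀ q ∈ O, c' q = c q) : SmoothFam d O c' :=
  fun i q hq x hx => by
    refine SmAt.congr (hc i q hq x hx) ?_
    filter_upwards [continuousAt_fst.eventually (hO.eventually_mem hq)] with z hz
    rw [h z.1 hz]

/-- The amount by which the path `f` fails to satisfy the geodesic equation at time `t`. -/
noncomputable def geoDefect (Φ : ℝ → ℝ) (f : ℝ → M → ESp (d + 1)) (t : ℝ) (p : M) : ESp (d + 1) :=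
  deriv (fun τ => velocity f τ p) t
    - ((1 / 2 : ℝ) • HForm Φ (f t) (velocity f t) (velocity f t) p
      - KForm Φ (f t) (velocity f t) (velocity f t) p)

variable {J : Set ℝ} {c : ℝ → ℝ → M → ESp (d + 1)}

theorem SmoothFam.differentiableAt₂ (hc : SmoothFam d (Set.univ ×ˢ J) fun q : ℝ × ℝ => c q.1 q.2)
    {s t : ℝ} (ht : t ∈ J) (p : M) : DifferentiableAt ℝ (fun q : ℝ × ℝ => c q.1 q.2 p) (s, t) :=
  (hc.contDiffAt (q := (s, t)) ⟨Set.mem_univ _, ht⟩ p).differentiableAt (by simp)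

theorem velocity_eq_fderiv (hc : SmoothFam d (Set.univ ×ˢ J) fun q : ℝ × ℝ => c q.1 q.2)
    {s t : ℝ} (ht : t ∈ J) (p : M) :
    velocity (c s) t p = fderiv ℝ (fun q : ℝ × ℝ => c q.1 q.2 p) (s, t) (0, 1) :=
  (hasDerivAt_snd (hc.differentiableAt₂ ht p)).deriv

theorem variation_eq_fderiv (hc : SmoothFam d (Set.univ ×ˢ J) fun q : ℝ × ℝ => c q.1 q.2)
    {s t : ℝ} (ht : t ∈ J) (p : M) :
    deriv (fun σ => c σ t p) s = fderiv ℝ (fun q : ℝ × ℝ => c q.1 q.2 p) (s, t) (1, 0) :=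
  (hasDerivAt_fst (hc.differentiableAt₂ ht p)).deriv

theorem smoothFam_velocity₂ (hJ : IsOpen J)
    (hc : SmoothFam d (Set.univ ×ˢ J) fun q : ℝ × ℝ => c q.1 q.2) :
    SmoothFam d (Set.univ ×ˢ J) fun q : ℝ × ℝ => velocity (c q.1) q.2 :=
  (hc.fderiv (0, 1)).congr (isOpen_univ.prod hJ) fun _ hq => funext fun p =>
    velocity_eq_fderiv hc hq.2 p

theorem smoothFam_variation₂ (hJ : IsOpen J)
    (hc : SmoothFam d (Set.univ ×ˢ J) fun q : ℝ × ℝ => c q.1 q.2) :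
    SmoothFam d (Set.univ ×ˢ J) fun q : ℝ × ℝ => fun p => deriv (fun σ => c σ q.2 p) q.1 :=
  (hc.fderiv (1, 0)).congr (isOpen_univ.prod hJ) fun _ hq => funext fun p =>
    variation_eq_fderiv hc hq.2 p

theorem SmoothFam.snd {u : ℝ → ℝ → M → ESp (d + 1)}
    (hu : SmoothFam d (Set.univ ×ˢ J) fun q : ℝ × ℝ => u q.1 q.2) (s : ℝ) : SmoothFam d J (u s) :=
  hu.comp (φ := fun t : ℝ => (s, t)) (contDiff_const.prodMk contDiff_id)
    fun _ ht => ⟨Set.mem_univ _, ht⟩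

theorem SmoothFam.fst {u : ℝ → ℝ → M → ESp (d + 1)}
    (hu : SmoothFam d (Set.univ ×ˢ J) fun q : ℝ × ℝ => u q.1 q.2) {t : ℝ} (ht : t ∈ J) :
    SmoothFam d Set.univ (fun s => u s t) :=
  hu.comp (φ := fun s : ℝ => (s, t)) (contDiff_id.prodMk contDiff_const)
    fun _ _ => ⟨Set.mem_univ _, ht⟩

/-- The variation of the velocity is the velocity of the variation. -/
theorem hasDerivAt_velocity_variation (hJ : IsOpen J)
    (hc : SmoothFam d (Set.univ ×ˢ J) fun q : ℝ × ℝ => c q.1 q.2) {t : ℝ} (ht : t ∈ J) (p : M) :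
    HasDerivAt (fun s => velocity (c s) t p) (deriv (fun τ => deriv (fun σ => c σ τ p) 0) t) 0 := by
  have hp := hc.contDiffAt (q := ((0 : ℝ), t)) ⟨Set.mem_univ _, ht⟩ p
  have h1 := hasDerivAt_fst ((contDiffAt_fderiv_apply hp (0, 1)).differentiableAt (by simp))
  have h2 := hasDerivAt_snd ((contDiffAt_fderiv_apply hp (1, 0)).differentiableAt (by simp))
  have e1 : deriv (fun τ => deriv (fun σ => c σ τ p) 0) t
      = fderiv ℝ (fun q => fderiv ℝ (fun q : ℝ × ℝ => c q.1 q.2 p) q (1, 0)) (0, t) (0, 1) := by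
    refine (h2.congr_of_eventuallyEq ?_).deriv
    filter_upwards [hJ.eventually_mem ht] with τ hτ
    exact variation_eq_fderiv hc hτ p
  rw [e1, fderiv_fderiv_apply_comm hp]
  exact h1.congr_of_eventuallyEq (Filter.Eventually.of_forall fun s => velocity_eq_fderiv hc ht p)

/-- The parameters `(s, t)` with `t ∈ J` for which `c s t` is an immersion. -/
def immersionSet (J : Set ℝ) (c : ℝ → ℝ → M → ESp (d + 1)) : Set (ℝ × ℝ) :=
  {q : ℝ × ℝ | q ∈ (Set.univ : Set ℝ) ×ˢ J ∧ ImmMap (c q.1 q.2)}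

theorem mem_immersionSet {s t : ℝ} : (s, t) ∈ immersionSet J c ↔ t ∈ J ∧ ImmMap (c s t) :=
  and_congr_left' (and_iff_right (Set.mem_univ s))

variable [IsManifold (𝓡 d) ∞ M] [CompactSpace M]

theorem isOpen_immersionSet (hJ : IsOpen J)
    (hc : SmoothFam d (Set.univ ×ˢ J) fun q : ℝ × ℝ => c q.1 q.2) :
    IsOpen (immersionSet J c) :=
  isOpen_setOf_immMap (isOpen_univ.prod hJ) hc

variable [T2Space M] {Φ : ℝ → ℝ}

theorem contDiffOn_energyDensity (hΦ : ContDiff ℝ ∞ Φ) (hor : OrientedAtlas d M) (hJ : IsOpen J)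
    (hc : SmoothFam d (Set.univ ×ˢ J) fun q : ℝ × ℝ => c q.1 q.2) :
    ContDiffOn ℝ ∞ (fun q : ℝ × ℝ => GMet Φ (c q.1 q.2) (velocity (c q.1) q.2) (velocity (c q.1) q.2))
      (immersionSet J c) :=
  contDiffOn_GMet hΦ hor (isOpen_immersionSet hJ hc) (hc.mono fun _ hq => hq.1) (fun _ hq => hq.2)
    ((smoothFam_velocity₂ hJ hc).mono fun _ hq => hq.1)
    ((smoothFam_velocity₂ hJ hc).mono fun _ hq => hq.1)

theorem differentiableAt_energyDensity (hΦ : ContDiff ℝ ∞ Φ) (hor : OrientedAtlas d M)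
    (hJ : IsOpen J) (hc : SmoothFam d (Set.univ ×ˢ J) fun q : ℝ × ℝ => c q.1 q.2)
    {s t : ℝ} (ht : t ∈ J) (hi : ImmMap (c s t)) :
    DifferentiableAt ℝ (fun q : ℝ × ℝ => GMet Φ (c q.1 q.2) (velocity (c q.1) q.2)
      (velocity (c q.1) q.2)) (s, t) := by
  have h1 := (contDiffOn_energyDensity hΦ hor hJ hc).contDiffAt
    ((isOpen_immersionSet hJ hc).mem_nhds (mem_immersionSet.2 ⟨ht, hi⟩))
  exact ContDiffAt.differentiableAt_infty h1

theorem contDiffOn_GMet_variation_velocity (hΦ : ContDiff ℝ ∞ Φ) (hor : OrientedAtlas d M)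
    (hJ : IsOpen J) (hc : SmoothFam d (Set.univ ×ˢ J) fun q : ℝ × ℝ => c q.1 q.2)
    (hi : ∀ t ∈ J, ImmMap (c 0 t)) :
    ContDiffOn ℝ ∞ (fun t => GMet Φ (c 0 t) (fun p => deriv (fun σ => c σ t p) 0) (velocity (c 0) t))
      J :=
  contDiffOn_GMet hΦ hor hJ (hc.snd 0) hi
    (SmoothFam.snd (u := fun s t p => deriv (fun σ => c σ t p) s) (smoothFam_variation₂ hJ hc) 0)
    (SmoothFam.snd (u := fun s t => velocity (c s) t) (smoothFam_velocity₂ hJ hc) 0)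

/-- The first variation of the energy density. With `m` the variation field and `S` the defect of
the geodesic equation, it is `2 (d/dt) G(m, f_t) - 2 G(m, S)`. -/
theorem fderiv_energyDensity (hΦ : ContDiff ℝ ∞ Φ) (hpos : ∀ s, 0 < Φ s) (hor : OrientedAtlas d M)
    (hJ : IsOpen J) (hc : SmoothFam d (Set.univ ×ˢ J) fun q : ℝ × ℝ => c q.1 q.2)
    (hi : ∀ t ∈ J, ImmMap (c 0 t)) {t : ℝ} (ht : t ∈ J) :
    fderiv ℝ (fun q : ℝ × ℝ => GMet Φ (c q.1 q.2) (velocity (c q.1) q.2) (velocity (c q.1) q.2))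
        (0, t) (1, 0)
      = 2 * (deriv (fun t => GMet Φ (c 0 t) (fun p => deriv (fun σ => c σ t p) 0)
          (velocity (c 0) t)) t
        - GMet Φ (c 0 t) (fun p => deriv (fun σ => c σ t p) 0) (geoDefect Φ (c 0) t)) := by
  have hV := smoothFam_velocity₂ hJ hc
  have hX := smoothFam_variation₂ hJ hc
  have hc0 := hc.snd 0
  have hV0 : SmoothFam d J (velocity (c 0)) :=
    SmoothFam.snd (u := fun s t => velocity (c s) t) hV 0
  have hX0 : SmoothFam d J fun t p => deriv (fun σ => c σ t p) 0 :=
    SmoothFam.snd (u := fun s t p => deriv (fun σ => c σ t p) s) hX 0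
  set m : M → ESp (d + 1) := fun p => deriv (fun σ => c σ t p) 0 with hm
  set v : M → ESp (d + 1) := velocity (c 0) t with hv
  set v' : M → ESp (d + 1) := fun p => deriv (fun τ => velocity (c 0) τ p) t with hv'
  set m' : M → ESp (d + 1) := fun p => deriv (fun τ => deriv (fun σ => c σ τ p) 0) t with hm'
  have hfs := hc0.slice ht
  have hms : SmoothMap d m := hX0.slice ht
  have hvs : SmoothMap d v := hV0.slice ht
  have hvs' : SmoothMap d v' := hV0.velocity.slice ht
  have hi0 := hi t ht
  have hK := smoothMap_KForm hΦ hpos hor hfs hi0 hvs hvs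
  have hH := smoothMap_HForm hΦ hpos hor hfs hi0 hvs hvs
  have hmix : ∀ p, HasDerivAt (fun s => velocity (c s) t p) (m' p) 0 := fun p =>
    hasDerivAt_velocity_variation hJ hc ht p
  have hv0 : ∀ p, HasDerivAt (fun τ => c 0 τ p) (v p) t := fun p =>
    ((hc0.contDiffAt ht p).differentiableAt (by simp)).hasDerivAt
  have hm0 : ∀ p, HasDerivAt (fun τ => deriv (fun σ => c σ τ p) 0) (m' p) t := fun p =>
    ((hX0.contDiffAt ht p).differentiableAt (by simp)).hasDerivAt
  have hvv : ∀ p, HasDerivAt (fun τ => velocity (c 0) τ p) (v' p) t := fun p =>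
    ((hV0.contDiffAt ht p).differentiableAt (by simp)).hasDerivAt
  have hct := hc.fst ht
  have hVt : SmoothFam d Set.univ (fun s => velocity (c s) t) :=
    SmoothFam.fst (u := fun s t => velocity (c s) t) hV ht
  have hcm : ∀ p, HasDerivAt (fun s => c s t p) (m p) 0 := fun p =>
    ((hct.contDiffAt (Set.mem_univ 0) p).differentiableAt (by simp)).hasDerivAt
  have hO := isOpen_setOf_immMap isOpen_univ hct
  -- the gradient property turns both variations of the metric into pairings with `m`
  have e1 := integralVol_bracket (h := v) (k := v) hΦ hpos hor hfs hi0 hms hvs hvs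
  have e2 : integralVol (c 0 t) (fun p => Φ (detL (c 0 t) p)
      * (bracket Φ (c 0 t) v p * inner ℝ (m p) (v p))) = GMet Φ (c 0 t) m (KForm Φ (c 0 t) v v) := by
    simp only [GMet, KForm_eq hor hfs hi0, real_inner_smul_right]
  have hA : HasDerivAt (fun τ => GMet Φ (c 0 τ) (fun p => deriv (fun σ => c σ τ p) 0)
      (velocity (c 0) τ)) (GMet Φ (c 0 t) m (KForm Φ (c 0 t) v v) + GMet Φ (c 0 t) m' v
        + GMet Φ (c 0 t) m v') t := by
    rw [← e2]
    exact hasDerivAt_GMet hΦ hpos hor hJ hc0 hi hX0 hV0 ht hv0 hm0 hvv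
  have hI : HasDerivAt (fun s => GMet Φ (c s t) (velocity (c s) t) (velocity (c s) t))
      (GMet Φ (c 0 t) m (HForm Φ (c 0 t) v v) + GMet Φ (c 0 t) m' v + GMet Φ (c 0 t) v m') 0 := by
    rw [← e1]
    exact hasDerivAt_GMet (q := 0) hΦ hpos hor hO (hct.mono fun _ h => h.1) (fun _ h => h.2)
      (hVt.mono fun _ h => h.1) (hVt.mono fun _ h => h.1) ⟨Set.mem_univ _, hi0⟩ hcm hmix hmix
  have hI2 := hasDerivAt_fst (differentiableAt_energyDensity hΦ hor hJ hc ht hi0)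
  have e3 : GMet Φ (c 0 t) m (geoDefect Φ (c 0) t) = GMet Φ (c 0 t) m v'
      - ((1 / 2) * GMet Φ (c 0 t) m (HForm Φ (c 0 t) v v)
        - GMet Φ (c 0 t) m (KForm Φ (c 0 t) v v)) := by
    have hH2 : SmoothMap d (fun p => (1 / 2 : ℝ) • HForm Φ (c 0 t) v v p) :=
      fun i x hx => (hH i x hx).const_smul (1 / 2 : ℝ)
    rw [← GMet_smul_right, ← GMet_sub_right hΦ hor hfs hi0 hms hH2 hK,
      ← GMet_sub_right hΦ hor hfs hi0 hms hvs' (smoothMap_sub hH2 hK)]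
    rfl
  rw [hI2.unique hI, hA.deriv, e3, GMet_comm (h := v) (k := m')]
  ring

theorem continuousOn_fderiv_energyDensity (hΦ : ContDiff ℝ ∞ Φ) (hor : OrientedAtlas d M)
    (hJ : IsOpen J) (hc : SmoothFam d (Set.univ ×ˢ J) fun q : ℝ × ℝ => c q.1 q.2)
    (hi : ∀ t ∈ J, ImmMap (c 0 t)) :
    ContinuousOn (fun t => fderiv ℝ (fun q : ℝ × ℝ => GMet Φ (c q.1 q.2)
      (velocity (c q.1) q.2) (velocity (c q.1) q.2)) (0, t) (1, 0)) J :=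
  (continuousOn_fderiv_apply (isOpen_immersionSet hJ hc) (contDiffOn_energyDensity hΦ hor hJ hc)
    (1, 0)).comp (Continuous.prodMk_right (0 : ℝ)).continuousOn
    fun t ht => mem_immersionSet.2 ⟨ht, hi t ht⟩

theorem continuousOn_GMet_variation_geoDefect (hΦ : ContDiff ℝ ∞ Φ) (hpos : ∀ s, 0 < Φ s)
    (hor : OrientedAtlas d M) (hJ : IsOpen J)
    (hc : SmoothFam d (Set.univ ×ˢ J) fun q : ℝ × ℝ => c q.1 q.2) (hi : ∀ t ∈ J, ImmMap (c 0 t)) :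
    ContinuousOn (fun t => GMet Φ (c 0 t) (fun p => deriv (fun σ => c σ t p) 0)
      (geoDefect Φ (c 0) t)) J := by
  have hA := (contDiffOn_GMet_variation_velocity hΦ hor hJ hc hi).continuousOn_deriv_of_isOpen hJ
    (by simp)
  refine (hA.sub ((continuousOn_fderiv_energyDensity hΦ hor hJ hc hi).const_mul (1 / 2))).congr
    fun t ht => ?_
  rw [Pi.sub_apply, fderiv_energyDensity hΦ hpos hor hJ hc hi ht]
  ring

/-- The first variation of the energy for fixed end points. -/
theorem hasDerivAt_energy (hΦ : ContDiff ℝ ∞ Φ) (hpos : ∀ s, 0 < Φ s) (hor : OrientedAtlas d M)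
    (hJ : IsOpen J) (hc : SmoothFam d (Set.univ ×ˢ J) fun q : ℝ × ℝ => c q.1 q.2)
    (hi : ∀ t ∈ J, ImmMap (c 0 t)) {a b : ℝ} (hab : a ≤ b) (hJab : Set.Icc a b ⊆ J)
    (ha : ∀ s, c s a = c 0 a) (hb : ∀ s, c s b = c 0 b) :
    HasDerivAt (fun s => energy Φ a b (c s))
      (- ∫ t in a..b, GMet Φ (c 0 t) (fun p => deriv (fun σ => c σ t p) 0) (geoDefect Φ (c 0) t)) 0 := by
  have hmem : ∀ t ∈ J, ((0 : ℝ), t) ∈ immersionSet J c :=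
    fun t ht => mem_immersionSet.2 ⟨ht, hi t ht⟩
  have hI := contDiffOn_energyDensity hΦ hor hJ hc
  have hA := contDiffOn_GMet_variation_velocity hΦ hor hJ hc hi
  have h1 := (hasDerivAt_intervalIntegral_param hab (isOpen_immersionSet hJ hc)
    (fun t ht => hmem t (hJab ht)) hI).const_mul (1 / 2)
  refine HasDerivAt.congr_deriv h1 ?_
  have huI : Set.uIcc a b ⊆ J := by rwa [Set.uIcc_of_le hab]
  have hdA : ContinuousOn (deriv fun t => GMet Φ (c 0 t) (fun p => deriv (fun σ => c σ t p) 0)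
      (velocity (c 0) t)) (Set.uIcc a b) :=
    (hA.continuousOn_deriv_of_isOpen hJ (by simp)).mono huI
  have hdI := (continuousOn_fderiv_energyDensity hΦ hor hJ hc hi).mono huI
  have hm0 : ∀ t, (∀ s, c s t = c 0 t) → (fun p => deriv (fun σ => c σ t p) 0) = fun _ => 0 :=
    fun t ht => funext fun p => by simp [ht]
  -- the term `∂_t G(m, f_t)` integrates to zero because `m` vanishes at the end points
  have hftc := intervalIntegral.integral_eq_sub_of_hasDerivAt
    (fun t ht => ((hA.contDiffAt (hJ.mem_nhds (huI ht))).differentiableAt (by simp)).hasDerivAt)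
    hdA.intervalIntegrable
  rw [hm0 a ha, hm0 b hb, GMet_zero_left, GMet_zero_left, sub_zero] at hftc
  have hsub := intervalIntegral.integral_sub (hdI.intervalIntegrable.const_mul (1 / 2))
    (hdA.intervalIntegrable (μ := volume))
  rw [hftc, sub_zero] at hsub
  rw [← intervalIntegral.integral_const_mul, ← intervalIntegral.integral_neg]
  refine hsub.symm.trans ?_
  refine intervalIntegral.integral_congr fun t ht => ?_
  beta_reduce
  rw [fderiv_energyDensity hΦ hpos hor hJ hc hi (huI ht)]
  ring

end Energy


/-! ### Geodesics -/

section Geodesics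

open MeasureTheory

variable {d : ℕ} {M : Type*} [TopologicalSpace M] [ChartedSpace (ESp d) M] {J : Set ℝ}
  {f : ℝ → M → ESp (d + 1)} {Φ : ℝ → ℝ}

theorem geoDefect_congr (hJ : IsOpen J) {f' : ℝ → M → ESp (d + 1)} (h : ∀ t ∈ J, f' t = f t) {t : ℝ}
    (ht : t ∈ J) : geoDefect Φ f' t = geoDefect Φ f t := by
  have hv : ∀ τ ∈ J, velocity f' τ = velocity f τ := fun τ hτ => funext fun p =>
    Filter.EventuallyEq.deriv_eq ((hJ.eventually_mem hτ).mono fun r hr => congrFun (h r hr) p)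
  ext1 p
  have hd : deriv (fun τ => velocity f' τ p) t = deriv (fun τ => velocity f τ p) t :=
    Filter.EventuallyEq.deriv_eq ((hJ.eventually_mem ht).mono fun r hr => congrFun (hv r hr) p)
  simp only [geoDefect, hd, h t ht, hv t ht]

theorem geodesicRHS_eq (g h : M → ESp (d + 1)) (p : M) :
    geodesicRHS Φ g h p = (1 / 2 : ℝ) • HForm Φ g h h p - KForm Φ g h h p := by
  simp only [geodesicRHS, HForm, KForm, real_inner_self_eq_norm_sq, smul_add, smul_smul]
  rw [one_div_mul_one_div]

/-- The variation `f + s χ(t) k` of the path `f`. -/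
noncomputable def pathVariation {N : Type*} (f : ℝ → N → ESp (d + 1)) (χ : ℝ → ℝ)
    (k : N → ESp (d + 1)) (s t : ℝ) (p : N) : ESp (d + 1) :=
  f t p + (s * χ t) • k p

theorem pathVariation_zero {N : Type*} (f : ℝ → N → ESp (d + 1)) (χ : ℝ → ℝ) (k : N → ESp (d + 1))
    (t : ℝ) : pathVariation f χ k 0 t = f t :=
  funext fun p => by simp [pathVariation]

theorem pathVariation_of_eq_zero {N : Type*} (f : ℝ → N → ESp (d + 1)) {χ : ℝ → ℝ}
    (k : N → ESp (d + 1)) (s : ℝ) {t : ℝ} (ht : χ t = 0) : pathVariation f χ k s t = f t :=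
  funext fun p => by simp [pathVariation, ht]

theorem deriv_pathVariation {N : Type*} (f : ℝ → N → ESp (d + 1)) (χ : ℝ → ℝ)
    (k : N → ESp (d + 1)) (t : ℝ) :
    (fun p => deriv (fun σ => pathVariation f χ k σ t p) 0) = fun p => χ t • k p := by
  ext1 p
  have h1 : HasDerivAt (fun σ : ℝ => f t p + (σ * χ t) • k p) ((1 * χ t) • k p) 0 :=
    (((hasDerivAt_id (0 : ℝ)).mul_const (χ t)).smul_const (k p)).const_add (f t p)
  rw [one_mul] at h1
  exact h1.deriv

theorem contMDiffOn_pathVariation (hf : SmoothImmPath J f) {k : M → ESp (d + 1)} (hk : SmoothField k)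
    {χ : ℝ → ℝ} (hχ : ContDiff ℝ ∞ χ) :
    ContMDiffOn (𝓘(ℝ, ℝ).prod (𝓘(ℝ, ℝ).prod (𝓡 d))) 𝓘(ℝ, ESp (d + 1)) ∞
      (fun q : ℝ × ℝ × M => pathVariation f χ k q.1 q.2.1 q.2.2)
      (Set.univ ×ˢ J ×ˢ Set.univ) := by
  have h1 := hf.1.comp (contMDiff_snd (I := 𝓘(ℝ, ℝ)) (J := 𝓘(ℝ, ℝ).prod (𝓡 d)) (n := ∞)
    (M := ℝ) (N := ℝ × M)).contMDiffOn (s := Set.univ ×ˢ J ×ˢ Set.univ) fun q hq => hq.2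
  have h2 : ContMDiff (𝓘(ℝ, ℝ).prod (𝓘(ℝ, ℝ).prod (𝓡 d))) 𝓘(ℝ, ℝ) ∞
      (fun q : ℝ × ℝ × M => q.1 * χ q.2.1) :=
    contMDiff_fst.mul (hχ.contMDiff.comp (contMDiff_fst.comp contMDiff_snd))
  have h3 : ContMDiff (𝓘(ℝ, ℝ).prod (𝓘(ℝ, ℝ).prod (𝓡 d))) 𝓘(ℝ, ESp (d + 1)) ∞
      (fun q : ℝ × ℝ × M => k q.2.2) :=
    hk.comp (contMDiff_snd.comp contMDiff_snd)
  exact h1.add (h2.smul h3).contMDiffOn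

variable [IsManifold (𝓡 d) ∞ M]

theorem SmoothImmPath.smoothFam (hJ : IsOpen J) (hf : SmoothImmPath J f) : SmoothFam d J f :=
  smoothFam_of_contMDiffOn hJ hf.1

theorem SmoothImmPath.immMap (hf : SmoothImmPath J f) : ∀ t ∈ J, ImmMap (f t) :=
  fun t ht => (smoothImm_iff.1 (hf.2 t ht)).2

theorem hasDerivAt_velocity_iff (hJ : IsOpen J) (hf : SmoothImmPath J f) {t : ℝ} (ht : t ∈ J) (p : M) :
    HasDerivAt (fun τ => velocity f τ p) ((1 / 2 : ℝ) • HForm Φ (f t) (velocity f t) (velocity f t) p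
      - KForm Φ (f t) (velocity f t) (velocity f t) p) t ↔ geoDefect Φ f t p = 0 := by
  rw [geoDefect, sub_eq_zero]
  refine ⟨fun h => h.deriv, fun h => ?_⟩
  rw [← h]
  exact (((hf.smoothFam hJ).velocity.contDiffAt ht p).differentiableAt (by simp)).hasDerivAt

theorem smoothMap_geoDefect (hΦ : ContDiff ℝ ∞ Φ) (hpos : ∀ s, 0 < Φ s) (hor : OrientedAtlas d M)
    (hJ : IsOpen J) (hf : SmoothImmPath J f) {t : ℝ} (ht : t ∈ J) : SmoothMap d (geoDefect Φ f t) := by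
  have hF := hf.smoothFam hJ
  have hv : SmoothMap d (velocity f t) := hF.velocity.slice ht
  have hv' : SmoothMap d (fun p => deriv (fun τ => velocity f τ p) t) := hF.velocity.velocity.slice ht
  have hi := hf.immMap t ht
  have hH : SmoothMap d (fun p => (1 / 2 : ℝ) • HForm Φ (f t) (velocity f t) (velocity f t) p) :=
    fun i x hx => (smoothMap_HForm hΦ hpos hor (hF.slice ht) hi hv hv i x hx).const_smul (1 / 2 : ℝ)
  exact smoothMap_sub hv' (smoothMap_sub hH (smoothMap_KForm hΦ hpos hor (hF.slice ht) hi hv hv))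

variable [T2Space M] [CompactSpace M]

theorem continuousOn_GMet_geoDefect (hΦ : ContDiff ℝ ∞ Φ) (hpos : ∀ s, 0 < Φ s)
    (hor : OrientedAtlas d M) (hJ : IsOpen J) (hf : SmoothImmPath J f) {k : M → ESp (d + 1)}
    (hk : SmoothField k) : ContinuousOn (fun t => GMet Φ (f t) k (geoDefect Φ f t)) J := by
  -- `k` is the variation field of `f + s k`
  have hc := smoothFam_of_contMDiffOn₂ hJ (c := pathVariation f (fun _ => 1) k)
    (contMDiffOn_pathVariation hf hk contDiff_const)
  have hi : ∀ t ∈ J, ImmMap (pathVariation f (fun _ => 1) k 0 t) := fun t ht => by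
    rw [pathVariation_zero]; exact hf.immMap t ht
  refine (continuousOn_GMet_variation_geoDefect hΦ hpos hor hJ hc hi).congr fun t ht => ?_
  beta_reduce
  rw [geoDefect_congr hJ (fun t _ => pathVariation_zero f (fun _ => 1) k t) ht, deriv_pathVariation,
    pathVariation_zero]
  simp only [one_smul]

/-- A path of immersions is a geodesic if and only if it solves the geodesic equation. -/
theorem isGeodesic_iff (hΦ : ContDiff ℝ ∞ Φ) (hpos : ∀ s, 0 < Φ s) (hor : OrientedAtlas d M)
    (hJ : IsOpen J) (hf : SmoothImmPath J f) :
    IsGeodesic Φ J f ↔ ∀ t ∈ J, ∀ p, geoDefect Φ f t p = 0 := by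
  constructor
  · intro hgeo t₀ ht₀
    have hS := smoothMap_geoDefect hΦ hpos hor hJ hf ht₀
    -- the variation field `χ k` with `k` the defect at time `t₀`
    set k := geoDefect Φ f t₀ with hk
    have hkf : SmoothField k := contMDiff_iff_smoothMap.2 hS
    obtain ⟨ε, hε, hball⟩ := Metric.nhds_basis_closedBall.mem_iff.1 (hJ.mem_nhds ht₀)
    rw [Real.closedBall_eq_Icc] at hball
    have hab : t₀ - ε < t₀ + ε := by linarith
    have hβ := continuousOn_GMet_geoDefect hΦ hpos hor hJ hf hkf
    refine eq_zero_of_GMet_self_eq_zero hΦ hpos hor ((hf.smoothFam hJ).slice ht₀) (hf.immMap t₀ ht₀) hS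
      (eqOn_zero_of_intervalIntegral_smooth_mul hab (hβ.mono (Set.Ioo_subset_Icc_self.trans hball))
        (fun χ hχ hχs => ?_) t₀ ⟨by linarith, by linarith⟩)
    have hcs := contMDiffOn_pathVariation hf hkf hχ
    have hc := smoothFam_of_contMDiffOn₂ hJ (c := pathVariation f χ k) hcs
    have hi : ∀ t ∈ J, ImmMap (pathVariation f χ k 0 t) := fun t ht => by
      rw [pathVariation_zero]; exact hf.immMap t ht
    have hend : ∀ t, t ∉ Set.Ioo (t₀ - ε) (t₀ + ε) → ∀ s, pathVariation f χ k s t = f t :=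
      fun t ht s => pathVariation_of_eq_zero f k s
        (image_eq_zero_of_notMem_tsupport fun h => ht (hχs h))
    have ha := hend (t₀ - ε) (by simp)
    have hb := hend (t₀ + ε) (by simp)
    have hfix : FixedEndVariation J (t₀ - ε) (t₀ + ε) f (pathVariation f χ k) := by
      refine ⟨hcs, ?_, fun t _ => pathVariation_zero f χ k t, ha, hb⟩
      refine (eventually_forall_Icc_mem (isOpen_immersionSet hJ hc) fun t ht =>
        mem_immersionSet.2 ⟨hball ht, hi t (hball ht)⟩).mono fun s hs t ht => ?_
      have hst := mem_immersionSet.1 (hs t ht)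
      exact smoothImm_iff.2 ⟨(hc.snd s).slice hst.1, hst.2⟩
    have h1 := hgeo _ _ hab hball _ hfix
    have h2 := hasDerivAt_energy hΦ hpos hor hJ hc hi hab.le hball
      (fun s => (ha s).trans (ha 0).symm) (fun s => (hb s).trans (hb 0).symm)
    have h3 := neg_eq_zero.1 (h2.unique h1)
    rw [← h3]
    refine intervalIntegral.integral_congr fun t ht => ?_
    rw [Set.uIcc_of_le hab.le] at ht
    beta_reduce
    rw [geoDefect_congr hJ (fun t _ => pathVariation_zero f χ k t) (hball ht), deriv_pathVariation,
      pathVariation_zero, GMet_smul_left]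
  · intro h0 a b hab hJab c hfix
    obtain ⟨hcs, -, hc0, ha, hb⟩ := hfix
    have hc := smoothFam_of_contMDiffOn₂ hJ hcs
    have hi : ∀ t ∈ J, ImmMap (c 0 t) := fun t ht => by rw [hc0 t ht]; exact hf.immMap t ht
    refine (hasDerivAt_energy hΦ hpos hor hJ hc hi hab.le hJab (fun s => (ha s).trans (ha 0).symm)
      (fun s => (hb s).trans (hb 0).symm)).congr_deriv ?_
    rw [neg_eq_zero]
    refine (intervalIntegral.integral_congr fun t ht => ?_).trans intervalIntegral.integral_zero
    rw [Set.uIcc_of_le hab.le] at ht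
    beta_reduce
    rw [geoDefect_congr hJ hc0 (hJab ht), funext (h0 t (hJab ht)), GMet_zero_right]

/-- The geodesic equation as a first order system. -/
theorem isGeodesic_iff_exists (hΦ : ContDiff ℝ ∞ Φ) (hpos : ∀ s, 0 < Φ s) (hor : OrientedAtlas d M)
    (hJ : IsOpen J) (hf : SmoothImmPath J f) :
    IsGeodesic Φ J f ↔ ∃ h : ℝ → M → ESp (d + 1), ∀ t ∈ J, ∀ p,
      HasDerivAt (fun τ => f τ p) (h t p) t ∧
      h t p = perp (f t) (h t) p • normal (f t) p + pushTan (f t) (h t) p ∧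
      HasDerivAt (fun τ => h τ p) (geodesicRHS Φ (f t) (h t) p) t := by
  rw [isGeodesic_iff hΦ hpos hor hJ hf]
  simp only [geodesicRHS_eq]
  constructor
  · intro h0
    exact ⟨velocity f, fun t ht p =>
      ⟨(((hf.smoothFam hJ).contDiffAt ht p).differentiableAt (by simp)).hasDerivAt,
        eq_perp_add_pushTan (hf.immMap t ht) p,
        (hasDerivAt_velocity_iff hJ hf ht p).2 (h0 t ht p)⟩⟩
  · rintro ⟨h, hh⟩ t ht p
    have hv : ∀ τ ∈ J, h τ = velocity f τ := fun τ hτ => funext fun p => ((hh τ hτ p).1.deriv).symm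
    have h1 := (hh t ht p).2.2
    rw [hv t ht] at h1
    refine (hasDerivAt_velocity_iff hJ hf ht p).1 (h1.congr_of_eventuallyEq ?_)
    exact (hJ.eventually_mem ht).mono fun τ hτ => congrFun (hv τ hτ).symm p

end Geodesics

end ImmGeo

theorem mainTheorem2 (d : ℕ) (M : Type*) [TopologicalSpace M] [ChartedSpace (ImmGeo.ESp d) M]
    [IsManifold (𝓡 d) ∞ M] [T2Space M] [CompactSpace M] [ConnectedSpace M]
    (hor : ImmGeo.OrientedAtlas d M)
    (Φ : ℝ → ℝ) (hΦ : ContDiff ℝ ∞ Φ) (hpos : ∀ x, 0 < Φ x) :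
    (∀ f m h X : M → ImmGeo.ESp (d + 1), ImmGeo.SmoothImm f → ImmGeo.SmoothField m →
      ImmGeo.SmoothField h →
      (ImmGeo.IsKGradient Φ f m h X ↔ X = ImmGeo.KForm Φ f m h)) ∧
    (∀ f h k X : M → ImmGeo.ESp (d + 1), ImmGeo.SmoothImm f → ImmGeo.SmoothField h →
      ImmGeo.SmoothField k →
      (ImmGeo.IsHGradient Φ f h k X ↔ X = ImmGeo.HForm Φ f h k)) ∧
    (∀ (J : Set ℝ) (f : ℝ → M → ImmGeo.ESp (d + 1)), IsOpen J → J.OrdConnected →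
      ImmGeo.SmoothImmPath J f →
      (ImmGeo.IsGeodesic Φ J f ↔
        ∀ t ∈ J, ∀ p, HasDerivAt (fun τ => ImmGeo.velocity f τ p)
          ((1 / 2 : ℝ) • ImmGeo.HForm Φ (f t) (ImmGeo.velocity f t) (ImmGeo.velocity f t) p
            - ImmGeo.KForm Φ (f t) (ImmGeo.velocity f t) (ImmGeo.velocity f t) p) t) ∧
      (ImmGeo.IsGeodesic Φ J f ↔
        ∃ h : ℝ → M → ImmGeo.ESp (d + 1), ∀ t ∈ J, ∀ p,
          HasDerivAt (fun τ => f τ p) (h t p) t ∧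
          h t p = ImmGeo.perp (f t) (h t) p • ImmGeo.normal (f t) p
            + ImmGeo.pushTan (f t) (h t) p ∧
          HasDerivAt (fun τ => h τ p) (ImmGeo.geodesicRHS Φ (f t) (h t) p) t)) := by
  refine ⟨fun f m h X hf hm hh => ImmGeo.isKGradient_iff hΦ hpos hor hf hm hh,
    fun f h k X hf hh hk => ImmGeo.isHGradient_iff hΦ hpos hor hf hh hk,
    fun J f hJ _ hf => ⟨?_, ImmGeo.isGeodesic_iff_exists hΦ hpos hor hJ hf⟩⟩
  rw [ImmGeo.isGeodesic_iff hΦ hpos hor hJ hf]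
  exact forall₂_congr fun t ht => forall_congr' fun p =>
    (ImmGeo.hasDerivAt_velocity_iff hJ hf ht p).symm
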